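/- Let $R$ be a commutative $\mathbb C$-algebra (the coefficient functions on four-dimensional space-time) and let the module of (complexified) 1-forms have an $R$-basis $h_{\alpha\dot\alpha}$, $\alpha,\dot\alpha\in\{0,1\}$ (the vierbein); $\Lambda^q$ denotes $q$-forms in the exterior algebra, and all products of forms are wedge products. Put $\epsilon_{01}=\epsilon^{01}=1$ (antisymmetric; the same for dotted indices), $p^\alpha=\epsilon^{\alpha\beta}p_\beta$, $p_\alpha=-i\,\partial/\partial y^\alpha$, $\bar p^{\dot\alpha}=\epsilon^{\dot\alpha\dot\beta}\bar p_{\dot\beta}$, $\bar p_{\dot\alpha}=-i\,\partial/\partial\bar y^{\dot\alpha}$ (acting on everything to the right), and $$H_{\alpha\beta}=h_{\alpha\dot\gamma}\epsilon^{\dot\gamma\dot\delta}h_{\beta\dot\delta},\quad \bar H_{\dot\alpha\dot\beta}=h_{\gamma\dot\alpha}\epsilon^{\gamma\delta}h_{\delta\dot\beta},\quad \mathcal H_{\alpha\dot\alpha}=h_{\alpha\dot\beta}\epsilon^{\dot\beta\dot\gamma}\bar H_{\dot\gamma\dot\alpha},$$ $h(u,\bar u)=h_{\alpha\dot\alpha}u^\alpha\bar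 u^{\dot\alpha}$, $H(u,v)=\tfrac12H_{\alpha\beta}u^\alpha v^\beta$, $\bar H(\bar u,\bar v)=\tfrac12\bar H_{\dot\alpha\dot\beta}\bar u^{\dot\alpha}\bar v^{\dot\beta}$, $\mathcal H(u,\bar u)=\mathcal H_{\alpha\dot\alpha}u^\alpha\bar u^{\dot\alpha}$. A rank-one field is a pair $w=(\omega,C)$ of form-valued formal power series in $(y,\bar y)$. Let $\mathcal N,\bar{\mathcal N}$ count the degrees in $y$ and $\bar y$. A field has spin $s\in\tfrac12\mathbb Z_{\ge0}$ if $\mathcal N+\bar{\mathcal N}+2=2s$ on $\omega$ and $|\mathcal N-\bar{\mathcal N}|=2s$ on $C$. With the degree $\mathcal G=|\mathcal N-\bar{\mathcal N}|$ on $\omega$ and $\mathcal G=\mathcal N+\bar{\mathcal N}$ on $C$, the $\omega$ part is the part with $\mathcal G<2s$ and the $C$ part is the part with $\mathcal G\ge2s$. Fix a complex number $\eta\neq0$ and let $\theta(x)=1$ for $x>0$ and $\theta(x)=0$ for $x\le0$. The operator $\Sigma^{(1)}_-$ maps $(\omega,C)$ to the field with components $$\big[ih(p,\bar y)\theta(\mathcal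 N-\bar{\mathcal N}-1)+ih(y,\bar p)\theta(\bar{\mathcal N}-\mathcal N-1)\big]\omega+\big[\tfrac i2\bar\eta H(p,p)\delta_{\bar{\mathcal N},0}+\tfrac i2\eta\bar H(\bar p,\bar p)\delta_{\mathcal N,0}\big]C$$ in the $\omega$ sector and $-ih(p,\bar p)C$ in the $C$ sector. For $q\ge1$ let $W^s_q$ be the space of spin-$s$ fields with $\omega$ a $q$-form and $C$ a $(q-1)$-form (and $W^s_0$ the space of those with $\omega$ a 0-form and $C=0$). For $q\ge1$, in spin $s$, $$H^{q-(q-1)}(\Sigma^{(1)}_-)=\{w\in W^s_q:\Sigma^{(1)}_-w=0\}\big/\Sigma^{(1)}_-W^s_{q-1}.$$ Let $\psi_{m,n}$ denote an arbitrary homogeneous polynomial of degree $m$ in $y$ and $n$ in $\bar y$ with coefficients in $R$. Then in each case below the displayed fields are cocycles, and assigning to the parameters $\psi$ the class of the displayed field is an $R$-linear isomorphism onto $H^{3-2}(\Sigma^{(1)}_-)$: - $s=0,\tfrac12$: $H^{3-2}(\Sigma^{(1)}_-)=0$; - $s=1$: $\omega=0$, $C=[\eta H(y,y)+\bar\eta\bar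 H(\bar y,\bar y)]\psi_{0,0}$ (for real $\eta$ this is, up to rescaling $\psi_{0,0}$, $[H(y,y)+\bar H(\bar y,\bar y)]\psi_{0,0}$); - $s=2,3,\dots$: $\omega=[\mathcal H(y,\bar p)-\mathcal H(p,\bar y)]\psi_{s-1,s-1}$, $C=0$; - $s=\tfrac32,\tfrac52,\dots$: $\omega=\mathcal H(y,\bar p)\psi_{s-3/2,s-1/2}+\mathcal H(p,\bar y)\psi'_{s-1/2,s-3/2}$, $C=0$, with independent $\psi$ and $\psi'$ (the second term is the "c.c." one). Moreover $H^{4-3}(\Sigma^{(1)}_-)=0$ for every spin $s=0,\tfrac12,1,\tfrac32,\dots$ -/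

import Mathlib

namespace HigherSpin

noncomputable section

/-- The spinor variables: `Sum.inl α` stands for `y^α`, `Sum.inr α'` for `ȳ^α'`. -/
abbrev Var := Fin 2 ⊕ Fin 2

/-- Formal power series in `Y = (y, ȳ)` whose coefficients are differential forms. The ring `R` is
the ring of coefficient functions on space-time, `M` the `R`-module of 1-forms; the algebra of
differential forms is the exterior algebra of `M` over `R`. -/
abbrev Form (R M : Type*) [CommRing R] [AddCommGroup M] [Module R M] :=
  MvPowerSeries Var (ExteriorAlgebra R M)

/-- Degree in `y` of a monomial. -/
def degY (d : Var →₀ ℕ) : ℕ := d (Sum.inl 0) + d (Sum.inl 1)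

/-- Degree in `ȳ` of a monomial. -/
def degYbar (d : Var →₀ ℕ) : ℕ := d (Sum.inr 0) + d (Sum.inr 1)

/-- The antisymmetric symbol, `ε_{01} = ε^{01} = 1`. -/
def eps : Fin 2 → Fin 2 → ℂ := !![0, 1; -1, 0]

section Operators

variable {R M : Type*} [CommRing R] [Algebra ℂ R] [AddCommGroup M] [Module R M]

/-- A complex number as an element of `R` (a constant function). -/
def cst (R : Type*) [CommRing R] [Algebra ℂ R] (c : ℂ) : R := algebraMap ℂ R c

/-- Multiplication by the variable `i`. -/
def mulVar (i : Var) : Module.End R (Form R M) := LinearMap.mulLeft R (MvPowerSeries.X i)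

/-- Left exterior multiplication by a differential form. -/
def wedge (ω : ExteriorAlgebra R M) : Module.End R (Form R M) :=
  LinearMap.mulLeft R (MvPowerSeries.C ω)

/-- The formal partial derivative with respect to the variable `i`. -/
def partialY (i : Var) : Module.End R (Form R M) where
  toFun f := fun d => (((d i + 1 : ℕ) : R)) • MvPowerSeries.coeff (d + Finsupp.single i 1) f
  map_add' f g := by
    funext d
    exact smul_add _ _ _
  map_smul' c f := by
    funext d
    exact smul_comm ((d i + 1 : ℕ) : R) c (MvPowerSeries.coeff (d + Finsupp.single i 1) f)

/-- The function `φ(𝒩, 𝒩̄)` of the operators counting the degrees in `y` and in `ȳ`. -/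
def numFun (φ : ℤ → ℤ → ℂ) : Module.End R (Form R M) where
  toFun f := fun d => cst R (φ (degY d) (degYbar d)) • MvPowerSeries.coeff d f
  map_add' f g := by
    funext d
    exact smul_add _ _ _
  map_smul' c f := by
    funext d
    exact smul_comm (cst R (φ (degY d) (degYbar d))) c (MvPowerSeries.coeff d f)

/-- The step function, with `θ(0) = 0`. -/
def theta (n : ℤ) : ℂ := if 0 < n then 1 else 0

/-- The Kronecker symbol `δ_{n,0}`. -/
def delta0 (n : ℤ) : ℂ := if n = 0 then 1 else 0

/-- A spinor of operators, given by its components with an upper index. -/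
abbrev Spinor (R M : Type*) [CommRing R] [AddCommGroup M] [Module R M] :=
  Fin 2 → Module.End R (Form R M)

/-- `y^α` -/
def y : Spinor R M := fun α => mulVar (Sum.inl α)

/-- `ȳ^α'` -/
def ybar : Spinor R M := fun α => mulVar (Sum.inr α)

/-- `p^α = ε^{αβ} p_β`, where `p_β = -i ∂/∂y^β` -/
def p : Spinor R M := fun α => ∑ β, cst R (eps α β * (-Complex.I)) • partialY (Sum.inl β)

/-- `p̄^α' = ε^{α'β'} p̄_β'`, where `p̄_β' = -i ∂/∂ȳ^β'` -/
def pbar : Spinor R M := fun α => ∑ β, cst R (eps α β * (-Complex.I)) • partialY (Sum.inr β)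

/-- The vierbein 1-forms `h_{αα'}`, a frame of the module of 1-forms. -/
def h1 (h : Module.Basis (Fin 2 × Fin 2) R M) (α α' : Fin 2) : ExteriorAlgebra R M :=
  ExteriorAlgebra.ι R (h (α, α'))

/-- `H_{αβ} = h_{αγ'} h_β^{γ'}`, with `h_β^{γ'} = ε^{γ'δ'} h_{βδ'}` -/
def H2 (h : Module.Basis (Fin 2 × Fin 2) R M) (α β : Fin 2) : ExteriorAlgebra R M :=
  ∑ γ, ∑ δ, cst R (eps γ δ) • (h1 h α γ * h1 h β δ)

/-- `H̄_{α'β'} = h_{γα'} h^γ_{β'}`, with `h^γ_{β'} = ε^{γδ} h_{δβ'}` -/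
def Hbar2 (h : Module.Basis (Fin 2 × Fin 2) R M) (α β : Fin 2) : ExteriorAlgebra R M :=
  ∑ γ, ∑ δ, cst R (eps γ δ) • (h1 h γ α * h1 h δ β)

/-- `ℋ_{αα'} = h_{αβ'} H̄^{β'}_{α'}`, with `H̄^{β'}_{α'} = ε^{β'γ'} H̄_{γ'α'}` -/
def H3 (h : Module.Basis (Fin 2 × Fin 2) R M) (α α' : Fin 2) : ExteriorAlgebra R M :=
  ∑ β, ∑ γ, cst R (eps β γ) • (h1 h α β * Hbar2 h γ α')

/-- `T(u,v) = T_{αβ} u^α v^β`, as an operator. -/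
def contract (T : Fin 2 → Fin 2 → ExteriorAlgebra R M) (u v : Spinor R M) :
    Module.End R (Form R M) :=
  ∑ α, ∑ β, wedge (T α β) * u α * v β

/-- `h(u,ū) = h_{αα'} u^α ū^α'` -/
def hOp (h : Module.Basis (Fin 2 × Fin 2) R M) (u v : Spinor R M) : Module.End R (Form R M) :=
  contract (h1 h) u v

/-- `H(u,v) = ½ H_{αβ} u^α v^β` -/
def HOp (h : Module.Basis (Fin 2 × Fin 2) R M) (u v : Spinor R M) : Module.End R (Form R M) :=
  cst R (1 / 2) • contract (H2 h) u v

/-- `H̄(ū,v̄) = ½ H̄_{α'β'} ū^α' v̄^β'` -/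
def HbarOp (h : Module.Basis (Fin 2 × Fin 2) R M) (u v : Spinor R M) : Module.End R (Form R M) :=
  cst R (1 / 2) • contract (Hbar2 h) u v

/-- `ℋ(u,ū) = ℋ_{αα'} u^α ū^α'` -/
def H3Op (h : Module.Basis (Fin 2 × Fin 2) R M) (u v : Spinor R M) : Module.End R (Form R M) :=
  contract (H3 h) u v

/-- The part of `Σ₋` acting within the `ω` sector. -/
def sigmaOmegaOmega (h : Module.Basis (Fin 2 × Fin 2) R M) : Module.End R (Form R M) :=
  cst R Complex.I • (hOp h p ybar * numFun (fun n nb => theta (n - nb - 1)) +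
    hOp h y pbar * numFun (fun n nb => theta (nb - n - 1)))

/-- The part of `Σ₋` mapping the `C` sector to the `ω` sector. -/
def sigmaOmegaC (h : Module.Basis (Fin 2 × Fin 2) R M) (η : ℂ) : Module.End R (Form R M) :=
  cst R (Complex.I / 2 * starRingEnd ℂ η) • (HOp h p p * numFun (fun _ nb => delta0 nb)) +
    cst R (Complex.I / 2 * η) • (HbarOp h pbar pbar * numFun (fun n _ => delta0 n))

/-- The part of `Σ₋` acting within the `C` sector. -/
def sigmaCC (h : Module.Basis (Fin 2 × Fin 2) R M) : Module.End R (Form R M) :=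
  cst R (-Complex.I) • hOp h p pbar

/-- The operator `Σ₋` on rank-one fields `(ω, C)`. The spin and the degree of a component of
bidegree `(n, n̄)` in `(y, ȳ)` are `s = (n + n̄ + 2)/2`, `G = |n - n̄|` in the `ω` sector, and
`s = |n - n̄|/2`, `G = n + n̄` in the `C` sector; so the `ω` sector is the part with `G < 2s`
and the `C` sector is the part with `G ≥ 2s`. -/
def sigmaMinus (h : Module.Basis (Fin 2 × Fin 2) R M) (η : ℂ) :
    Form R M × Form R M →ₗ[R] Form R M × Form R M :=
  LinearMap.prod
    (sigmaOmegaOmega h ∘ₗ LinearMap.fst R _ _ + sigmaOmegaC h η ∘ₗ LinearMap.snd R _ _)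
    (sigmaCC h ∘ₗ LinearMap.snd R _ _)

end Operators

section Spaces

variable (R M : Type*) [CommRing R] [AddCommGroup M] [Module R M]

/-- The series whose component of bidegree `(m, n)` in `(y, ȳ)` has coefficients in `S m n`. -/
def seriesIn (S : ℕ → ℕ → Submodule R (ExteriorAlgebra R M)) : Submodule R (Form R M) where
  carrier := {f | ∀ d, MvPowerSeries.coeff d f ∈ S (degY d) (degYbar d)}
  add_mem' hf hg d := (S _ _).add_mem (hf d) (hg d)
  zero_mem' _ := (S _ _).zero_mem
  smul_mem' c _ hf d := (S _ _).smul_mem c (hf d)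

/-- The form degree in the `C` sector is one less than in the `ω` sector; there is nothing in
the `C` sector if the form degree in the `ω` sector is zero. -/
def lowerForms : ℕ → Submodule R (ExteriorAlgebra R M)
  | 0 => ⊥
  | r + 1 => ⋀[R]^r M

/-- The rank-one fields `(ω, C)` of spin `t / 2` that have form degree `q` in the `ω` sector
and form degree `q - 1` in the `C` sector. -/
def rankOne (q t : ℕ) : Submodule R (Form R M × Form R M) :=
  (seriesIn R M fun m n => if m + n + 2 = t then ⋀[R]^q M else ⊥).prod
    (seriesIn R M fun m n => if |(m : ℤ) - n| = t then lowerForms R M q else ⊥)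

/-- The functions (0-forms) that are homogeneous polynomials of degree `m` in `y` and `n` in `ȳ`. -/
def bihom (m n : ℕ) : Submodule R (Form R M) :=
  seriesIn R M fun a b => if a = m ∧ b = n then ⋀[R]^0 M else ⊥

end Spaces

section Cohomology

variable {R M : Type*} [CommRing R] [Algebra ℂ R] [AddCommGroup M] [Module R M]

/-- The cocycles of form degree `q` (`q - 1` in the `C` sector) and spin `t / 2`. -/
def cocycles (h : Module.Basis (Fin 2 × Fin 2) R M) (η : ℂ) (q t : ℕ) :
    Submodule R (Form R M × Form R M) :=
  rankOne R M q t ⊓ LinearMap.ker (sigmaMinus h η)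

/-- The coboundaries of form degree `q` (`q - 1` in the `C` sector) and spin `t / 2`. -/
def coboundaries (h : Module.Basis (Fin 2 × Fin 2) R M) (η : ℂ) (q t : ℕ) :
    Submodule R (Form R M × Form R M) :=
  match q with
  | 0 => ⊥
  | r + 1 => (rankOne R M r t).map (sigmaMinus h η)

/-- `H^{q-(q-1)}(Σ₋)` in spin `t / 2`. -/
abbrev Cohomology (h : Module.Basis (Fin 2 × Fin 2) R M) (η : ℂ) (q t : ℕ) :=
  cocycles h η q t ⧸ (coboundaries h η q t).submoduleOf (cocycles h η q t)

/-- The cohomology is represented by the elements `rep ψ` with `ψ ∈ P`: they are cocycles, and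
`ψ ↦ [rep ψ]` is an isomorphism from `P` onto the cohomology. -/
def RepresentedBy (h : Module.Basis (Fin 2 × Fin 2) R M) (η : ℂ) (q t : ℕ)
    {N : Type*} [AddCommGroup N] [Module R N] (P : Submodule R N)
    (rep : N → Form R M × Form R M) : Prop :=
  ∃ e : P ≃ₗ[R] Cohomology h η q t, ∀ ψ : P, ∃ hz : rep ψ ∈ cocycles h η q t,
    e ψ = Submodule.Quotient.mk ⟨rep ψ, hz⟩

end Cohomology

end

end HigherSpin

/-!
In the given frame every form is given by spinor-valued power series: a 2-form by two symmetric
bispinors `A`, `B`, a 3-form by a bispinor `W^{αα'}`, a 4-form by a single series `g` (`form2`,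
`form3`, `form4`; these components are unique by `eq_zero_of_form3_eq_zero` and
`eq_zero_of_form4_eq_zero`). For two spinors of operators `u`, `v` that commute with one another,
the maps `h(u, v)`, `H(u, u)`, `H̄(v, v)` become explicit expressions in `u` and `v`, and
`h(u, v)² = 0`. The cohomology of `h(u, v)` then follows from two facts: `u_α x^α = 0` has only the
solutions `x^α = u^α z` (`IsExact`), and the components of `p` and `p̄` are surjective on power
series, while the image of `y_α t^α` consists of the series without terms of degree zero in `y`.

In the `C` sector, `Σ₋` is a multiple of `h(p, p̄)`. It has no cohomology in the 3-forms, and in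
the 2-forms only the classes of `H(y, y) φ(y) + H̄(ȳ, ȳ) χ(ȳ)`
(`exists_hOp_p_pbar_eq_of_two`). On those, the map to the `ω` sector gives nonzero multiples of
the volume form times `φ(y)` and `χ(ȳ)` (`sigmaOmegaC_HOp_y`, `sigmaOmegaC_HbarOp_ybar`), which can
cancel only when both have degree zero, that is, for spin one; and the image of the `ω` sector,
whose terms have positive degree in both `y` and `ȳ`, cannot cancel them
(`exists_reduced_cocycle`). This leaves the one class of spin one.

In the `ω` sector, `Σ₋` is a multiple of `h(p, ȳ)` for `m ≥ n + 2` and of `h(y, p̄)` for `n ≥ m +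
2`, where `(m, n)` is the bidegree in `(y, ȳ)`. A 3-form closed under `h(p, ȳ)` is exact up to the
image of `H(p, p)` (`exists_hOp_p_ybar_eq`), and the latter is also exact because of the map from
the `C` sector to the `ω` sector. So only the value of `h(p, ȳ)` on the part with `m > n` matters,
and it is attained on `ℋ(y, p̄) ψ`, since `h(p, ȳ) ℋ(y, p̄) = -3 (𝒩 + 2) 𝒩̄` times the volume form
(`hOp_p_ybar_H3Op`); likewise for the part with `n > m`. For half-integer spin, the cocycle
condition leaves these values free exactly on the terms with `m - n = ±1`, on which `Σ₋` vanishes;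
this gives the two parameters `ψ` and `ψ'`. For integer spin, the values `h(p, ȳ) ω` and `h(y, p̄)
ω` meet in the bidegree `m = n`, where they have to cancel; this gives the one parameter `ψ`. The
3-forms with `m = n ≥ 1` are exact (`mem_range_of_center`). The same composites show that all
4-forms of the `ω` sector are exact (`form4_mem_range`), and that no nonzero representative is
exact.

The exactness of a field is shown in the space of all pairs of series; the projections onto given
form degree and spin commute with `Σ₋` and turn it into exactness in the complex of given spin
(`mem_coboundaries`).
-/

set_option linter.unusedSectionVars false
set_option linter.unusedSimpArgs false

namespace HigherSpin

open Module

/-! ### Coordinates, derivatives and coefficientwise operators -/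

section Calculus

variable {R M : Type*} [CommRing R] [AddCommGroup M] [Module R M]

theorem coeff_mulVar (i : Var) (f : Form R M) (d : Var →₀ ℕ) :
    MvPowerSeries.coeff d (mulVar i f) =
      if 1 ≤ d i then MvPowerSeries.coeff (d - Finsupp.single i 1) f else 0 := by
  simp [mulVar, MvPowerSeries.X, MvPowerSeries.coeff_monomial_mul, Nat.one_le_iff_ne_zero]

theorem coeff_mulVar_add (i : Var) (f : Form R M) (d : Var →₀ ℕ) :
    MvPowerSeries.coeff (d + Finsupp.single i 1) (mulVar i f) = MvPowerSeries.coeff d f := by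
  simp [coeff_mulVar]

theorem coeff_mulVar_of_eq_zero {i : Var} (f : Form R M) {d : Var →₀ ℕ} (hd : d i = 0) :
    MvPowerSeries.coeff d (mulVar i f) = 0 := by
  simp [coeff_mulVar, hd]

theorem coeff_partialY (i : Var) (f : Form R M) (d : Var →₀ ℕ) :
    MvPowerSeries.coeff d (partialY i f) =
      ((d i + 1 : ℕ) : R) • MvPowerSeries.coeff (d + Finsupp.single i 1) f := rfl

theorem coeff_wedge (ω : ExteriorAlgebra R M) (f : Form R M) (d : Var →₀ ℕ) :
    MvPowerSeries.coeff d (wedge ω f) = ω * MvPowerSeries.coeff d f := by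
  simp [wedge, MvPowerSeries.coeff_C_mul]

/-- Every exponent either avoids the variable `i` or is divisible by it. -/
theorem exists_add_single_or_eq_zero (i : Var) (d : Var →₀ ℕ) :
    d i = 0 ∨ ∃ e, d = e + Finsupp.single i 1 := by
  rcases Nat.eq_zero_or_pos (d i) with h | h
  · exact Or.inl h
  · exact Or.inr ⟨d - Finsupp.single i 1,
      (tsub_add_cancel_of_le (by simpa [Nat.one_le_iff_ne_zero] using h.ne')).symm⟩

theorem form_ext {f g : Form R M}
    (H : ∀ d, MvPowerSeries.coeff d f = MvPowerSeries.coeff d g) : f = g :=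
  MvPowerSeries.ext H

theorem mulVar_comm (i j : Var) :
    (mulVar i * mulVar j : End R (Form R M)) = mulVar j * mulVar i := by
  ext1 f
  simp only [Module.End.mul_apply, mulVar, LinearMap.mulLeft_apply]
  rw [← mul_assoc, ← mul_assoc, (MvPowerSeries.commute_X (MvPowerSeries.X j) i).eq]

theorem partialY_comm (i j : Var) :
    (partialY i * partialY j : End R (Form R M)) = partialY j * partialY i := by
  ext1 f
  refine form_ext fun d => ?_
  simp only [Module.End.mul_apply, coeff_partialY, smul_smul]
  rcases eq_or_ne i j with rfl | hij
  · rfl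
  · simp [hij, hij.symm, mul_comm, add_right_comm]

theorem partialY_mulVar_self (i : Var) :
    (partialY i * mulVar i : End R (Form R M)) = mulVar i * partialY i + 1 := by
  ext1 f
  refine form_ext fun d => ?_
  simp only [Module.End.mul_apply, coeff_partialY, coeff_mulVar_add, LinearMap.add_apply, map_add,
    Module.End.one_apply]
  rcases exists_add_single_or_eq_zero i d with hd | ⟨e, rfl⟩
  · simp [coeff_mulVar_of_eq_zero _ hd, hd]
  · simp [coeff_mulVar_add, coeff_partialY, add_smul]

theorem partialY_mulVar {i j : Var} (hij : i ≠ j) :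
    (partialY i * mulVar j : End R (Form R M)) = mulVar j * partialY i := by
  ext1 f
  refine form_ext fun d => ?_
  simp only [Module.End.mul_apply, coeff_partialY]
  rcases exists_add_single_or_eq_zero j d with hd | ⟨e, rfl⟩
  · rw [coeff_mulVar_of_eq_zero _ hd, coeff_mulVar_of_eq_zero _ (by simp [hd, hij.symm]), smul_zero]
  · rw [coeff_mulVar_add, add_right_comm, coeff_mulVar_add, coeff_partialY]
    simp [hij]

theorem wedge_mulVar (ω : ExteriorAlgebra R M) (i : Var) :
    (wedge ω * mulVar i : End R (Form R M)) = mulVar i * wedge ω := by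
  ext1 f
  refine form_ext fun d => ?_
  simp only [Module.End.mul_apply, coeff_wedge, coeff_mulVar]
  split_ifs <;> simp

theorem wedge_partialY (ω : ExteriorAlgebra R M) (i : Var) :
    (wedge ω * partialY i : End R (Form R M)) = partialY i * wedge ω := by
  ext1 f
  refine form_ext fun d => ?_
  simp [Module.End.mul_apply, coeff_wedge, coeff_partialY]

theorem wedge_mul (ω χ : ExteriorAlgebra R M) :
    (wedge (ω * χ) : End R (Form R M)) = wedge ω * wedge χ := by
  ext1 f
  refine form_ext fun d => ?_
  simp [Module.End.mul_apply, coeff_wedge, mul_assoc]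

theorem wedge_add (ω χ : ExteriorAlgebra R M) :
    (wedge (ω + χ) : End R (Form R M)) = wedge ω + wedge χ := by
  ext1 f
  refine form_ext fun d => ?_
  simp [coeff_wedge, add_mul]

theorem wedge_smul (r : R) (ω : ExteriorAlgebra R M) :
    (wedge (r • ω) : End R (Form R M)) = r • wedge ω := by
  ext1 f
  refine form_ext fun d => ?_
  simp [coeff_wedge]

theorem wedge_zero : (wedge 0 : End R (Form R M)) = 0 := by
  simpa using wedge_smul (M := M) (0 : R) 0

theorem wedge_neg (ω : ExteriorAlgebra R M) : (wedge (-ω) : End R (Form R M)) = -wedge ω := by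
  ext1 f
  refine form_ext fun d => ?_
  simp [coeff_wedge]

/-- The operator acting on the coefficients of bidegree `(m, n)` in `(y, ȳ)` by `L m n`. The
bidegree is taken in `ℤ`, so that shifts of it are invertible; the values of `L` at negative
bidegrees do not matter. -/
noncomputable def coeffMap (L : ℤ → ℤ → End R (ExteriorAlgebra R M)) : End R (Form R M) where
  toFun f := fun d => L (degY d) (degYbar d) (MvPowerSeries.coeff d f)
  map_add' f g := by
    funext d
    exact map_add (L (degY d) (degYbar d)) _ _
  map_smul' c f := by
    funext d
    exact map_smul (L (degY d) (degYbar d)) c _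

theorem coeff_coeffMap (L : ℤ → ℤ → End R (ExteriorAlgebra R M)) (f : Form R M) (d : Var →₀ ℕ) :
    MvPowerSeries.coeff d (coeffMap L f) = L (degY d) (degYbar d) (MvPowerSeries.coeff d f) := rfl

theorem coeffMap_congr {L L' : ℤ → ℤ → End R (ExteriorAlgebra R M)}
    (H : ∀ m n : ℕ, L m n = L' m n) : coeffMap L = coeffMap L' := by
  ext1 f
  refine form_ext fun d => ?_
  rw [coeff_coeffMap, coeff_coeffMap, H]

theorem coeffMap_mul (L L' : ℤ → ℤ → End R (ExteriorAlgebra R M)) :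
    coeffMap L * coeffMap L' = coeffMap fun m n => L m n * L' m n := rfl

theorem degY_inl (d : Var →₀ ℕ) (a : Fin 2) :
    degY (d + Finsupp.single (Sum.inl a) 1) = degY d + 1 := by
  fin_cases a <;> simp [degY] <;> ring

theorem degY_inr (d : Var →₀ ℕ) (a : Fin 2) :
    degY (d + Finsupp.single (Sum.inr a) 1) = degY d := by
  simp [degY]

theorem degYbar_inl (d : Var →₀ ℕ) (a : Fin 2) :
    degYbar (d + Finsupp.single (Sum.inl a) 1) = degYbar d := by
  simp [degYbar]

theorem degYbar_inr (d : Var →₀ ℕ) (a : Fin 2) :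
    degYbar (d + Finsupp.single (Sum.inr a) 1) = degYbar d + 1 := by
  fin_cases a <;> simp [degYbar] <;> ring

theorem coeffMap_mulVar_inl (L : ℤ → ℤ → End R (ExteriorAlgebra R M)) (a : Fin 2) :
    coeffMap L * mulVar (Sum.inl a) =
      mulVar (Sum.inl a) * coeffMap fun m n => L (m + 1) n := by
  ext1 f
  refine form_ext fun d => ?_
  simp only [Module.End.mul_apply, coeff_coeffMap]
  rcases exists_add_single_or_eq_zero (Sum.inl a) d with hd | ⟨e, rfl⟩
  · rw [coeff_mulVar_of_eq_zero _ hd, coeff_mulVar_of_eq_zero _ hd, map_zero]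
  · rw [coeff_mulVar_add, coeff_mulVar_add, coeff_coeffMap, degY_inl, degYbar_inl]
    push_cast
    rfl

theorem coeffMap_mulVar_inr (L : ℤ → ℤ → End R (ExteriorAlgebra R M)) (a : Fin 2) :
    coeffMap L * mulVar (Sum.inr a) =
      mulVar (Sum.inr a) * coeffMap fun m n => L m (n + 1) := by
  ext1 f
  refine form_ext fun d => ?_
  simp only [Module.End.mul_apply, coeff_coeffMap]
  rcases exists_add_single_or_eq_zero (Sum.inr a) d with hd | ⟨e, rfl⟩
  · rw [coeff_mulVar_of_eq_zero _ hd, coeff_mulVar_of_eq_zero _ hd, map_zero]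
  · rw [coeff_mulVar_add, coeff_mulVar_add, coeff_coeffMap, degY_inr, degYbar_inr]
    push_cast
    rfl

theorem coeffMap_partialY_inl (L : ℤ → ℤ → End R (ExteriorAlgebra R M)) (a : Fin 2) :
    coeffMap L * partialY (Sum.inl a) =
      partialY (Sum.inl a) * coeffMap fun m n => L (m - 1) n := by
  ext1 f
  refine form_ext fun d => ?_
  simp only [Module.End.mul_apply, coeff_coeffMap, coeff_partialY, degY_inl, degYbar_inl, map_smul]
  simp

theorem coeffMap_partialY_inr (L : ℤ → ℤ → End R (ExteriorAlgebra R M)) (a : Fin 2) :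
    coeffMap L * partialY (Sum.inr a) =
      partialY (Sum.inr a) * coeffMap fun m n => L m (n - 1) := by
  ext1 f
  refine form_ext fun d => ?_
  simp only [Module.End.mul_apply, coeff_coeffMap, coeff_partialY, degY_inr, degYbar_inr, map_smul]
  simp

theorem coeffMap_wedge (L : ℤ → ℤ → End R (ExteriorAlgebra R M)) (ω : ExteriorAlgebra R M) :
    coeffMap L * wedge ω = coeffMap fun m n => L m n * LinearMap.mulLeft R ω := by
  ext1 f
  refine form_ext fun d => ?_
  simp [Module.End.mul_apply, coeff_coeffMap, coeff_wedge]

theorem wedge_coeffMap (L : ℤ → ℤ → End R (ExteriorAlgebra R M)) (ω : ExteriorAlgebra R M) :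
    wedge ω * coeffMap L = coeffMap fun m n => LinearMap.mulLeft R ω * L m n := by
  ext1 f
  refine form_ext fun d => ?_
  simp [Module.End.mul_apply, coeff_coeffMap, coeff_wedge]

end Calculus

/-! ### Spinors of operators -/

section Spinors

variable {R M : Type*} [CommRing R] [Algebra ℂ R] [AddCommGroup M] [Module R M]

theorem cst_add (a b : ℂ) : cst R (a + b) = cst R a + cst R b := map_add _ _ _

theorem cst_mul (a b : ℂ) : cst R (a * b) = cst R a * cst R b := map_mul _ _ _

theorem cst_neg (a : ℂ) : cst R (-a) = -cst R a := map_neg _ _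

theorem cst_sub (a b : ℂ) : cst R (a - b) = cst R a - cst R b := map_sub _ _ _

theorem cst_zero : cst R 0 = 0 := map_zero _

theorem cst_one : cst R 1 = 1 := map_one _

theorem cst_natCast (n : ℕ) : cst R n = n := map_natCast _ n

theorem cst_smul_cancel {V : Type*} [AddCommGroup V] [Module R V] {a b : ℂ} (hab : a * b = 1)
    (x : V) : cst R a • cst R b • x = x := by
  rw [smul_smul, ← cst_mul, hab, cst_one, one_smul]

theorem cst_smul_eq_zero {V : Type*} [AddCommGroup V] [Module R V] {a : ℂ} (ha : a ≠ 0) {x : V}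
    (hx : cst R a • x = 0) : x = 0 := by
  have := cst_smul_cancel (R := R) (inv_mul_cancel₀ ha) x
  rw [← this, hx, smul_zero]

theorem coeff_smul' (r : R) (f : Form R M) (d : Var →₀ ℕ) :
    MvPowerSeries.coeff d (r • f) = r • MvPowerSeries.coeff d f := rfl

theorem numFun_eq_coeffMap (φ : ℤ → ℤ → ℂ) :
    (numFun φ : End R (Form R M)) = coeffMap fun m n => cst R (φ m n) • 1 := rfl

theorem coeff_numFun (φ : ℤ → ℤ → ℂ) (f : Form R M) (d : Var →₀ ℕ) :
    MvPowerSeries.coeff d (numFun φ f) =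
      cst R (φ (degY d) (degYbar d)) • MvPowerSeries.coeff d f := rfl

theorem numFun_congr {φ ψ : ℤ → ℤ → ℂ} (H : ∀ m n : ℕ, φ m n = ψ m n) :
    (numFun φ : End R (Form R M)) = numFun ψ := by
  rw [numFun_eq_coeffMap, numFun_eq_coeffMap]
  exact coeffMap_congr fun m n => by rw [H]

theorem numFun_mul (φ ψ : ℤ → ℤ → ℂ) :
    (numFun φ * numFun ψ : End R (Form R M)) = numFun fun m n => φ m n * ψ m n := by
  ext1 f
  refine form_ext fun d => ?_
  simp only [Module.End.mul_apply, coeff_numFun, smul_smul, cst_mul]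

theorem numFun_add (φ ψ : ℤ → ℤ → ℂ) :
    (numFun φ + numFun ψ : End R (Form R M)) = numFun fun m n => φ m n + ψ m n := by
  ext1 f
  refine form_ext fun d => ?_
  simp only [LinearMap.add_apply, map_add, coeff_numFun, cst_add, add_smul]

theorem numFun_smul (c : ℂ) (φ : ℤ → ℤ → ℂ) :
    (cst R c • numFun φ : End R (Form R M)) = numFun fun m n => c * φ m n := by
  ext1 f
  refine form_ext fun d => ?_
  simp only [LinearMap.smul_apply, coeff_smul', coeff_numFun, cst_mul, mul_smul]

theorem numFun_one : (numFun fun _ _ => 1 : End R (Form R M)) = 1 := by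
  ext1 f
  refine form_ext fun d => ?_
  simp only [coeff_numFun, cst_one, one_smul, Module.End.one_apply]

theorem numFun_zero : (numFun fun _ _ => 0 : End R (Form R M)) = 0 := by
  ext1 f
  refine form_ext fun d => ?_
  simp only [coeff_numFun, cst_zero, zero_smul, LinearMap.zero_apply, map_zero]

theorem wedge_numFun (ω : ExteriorAlgebra R M) (φ : ℤ → ℤ → ℂ) :
    (wedge ω * numFun φ : End R (Form R M)) = numFun φ * wedge ω := by
  ext1 f
  refine form_ext fun d => ?_
  simp [Module.End.mul_apply, coeff_numFun, coeff_wedge]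

theorem p_zero : (p 0 : End R (Form R M)) = cst R (-Complex.I) • partialY (Sum.inl 1) := by
  simp [p, eps, cst_zero]

theorem p_one : (p 1 : End R (Form R M)) = cst R Complex.I • partialY (Sum.inl 0) := by
  simp [p, eps, cst_zero]

theorem pbar_zero : (pbar 0 : End R (Form R M)) = cst R (-Complex.I) • partialY (Sum.inr 1) := by
  simp [pbar, eps, cst_zero]

theorem pbar_one : (pbar 1 : End R (Form R M)) = cst R Complex.I • partialY (Sum.inr 0) := by
  simp [pbar, eps, cst_zero]

theorem coeffMap_y (L : ℤ → ℤ → End R (ExteriorAlgebra R M)) (α : Fin 2) :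
    coeffMap L * y α = y α * coeffMap fun m n => L (m + 1) n :=
  coeffMap_mulVar_inl L α

theorem coeffMap_ybar (L : ℤ → ℤ → End R (ExteriorAlgebra R M)) (α : Fin 2) :
    coeffMap L * ybar α = ybar α * coeffMap fun m n => L m (n + 1) :=
  coeffMap_mulVar_inr L α

theorem coeffMap_p (L : ℤ → ℤ → End R (ExteriorAlgebra R M)) (α : Fin 2) :
    coeffMap L * p α = p α * coeffMap fun m n => L (m - 1) n := by
  simp only [p, Finset.mul_sum, Finset.sum_mul, mul_smul_comm, smul_mul_assoc,
    coeffMap_partialY_inl]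

theorem coeffMap_pbar (L : ℤ → ℤ → End R (ExteriorAlgebra R M)) (α : Fin 2) :
    coeffMap L * pbar α = pbar α * coeffMap fun m n => L m (n - 1) := by
  simp only [pbar, Finset.mul_sum, Finset.sum_mul, mul_smul_comm, smul_mul_assoc,
    coeffMap_partialY_inr]

theorem numFun_y (φ : ℤ → ℤ → ℂ) (α : Fin 2) :
    (numFun φ * y α : End R (Form R M)) = y α * numFun fun m n => φ (m + 1) n := by
  rw [numFun_eq_coeffMap, numFun_eq_coeffMap, coeffMap_y]

theorem numFun_ybar (φ : ℤ → ℤ → ℂ) (α : Fin 2) :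
    (numFun φ * ybar α : End R (Form R M)) = ybar α * numFun fun m n => φ m (n + 1) := by
  rw [numFun_eq_coeffMap, numFun_eq_coeffMap, coeffMap_ybar]

theorem numFun_p (φ : ℤ → ℤ → ℂ) (α : Fin 2) :
    (numFun φ * p α : End R (Form R M)) = p α * numFun fun m n => φ (m - 1) n := by
  rw [numFun_eq_coeffMap, numFun_eq_coeffMap, coeffMap_p]

theorem numFun_pbar (φ : ℤ → ℤ → ℂ) (α : Fin 2) :
    (numFun φ * pbar α : End R (Form R M)) = pbar α * numFun fun m n => φ m (n - 1) := by
  rw [numFun_eq_coeffMap, numFun_eq_coeffMap, coeffMap_pbar]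

/-- Two spinors of operators whose components commute with one another and with the exterior
multiplication by forms. -/
structure CommutingSpinors (u v : Spinor R M) : Prop where
  left : u 1 * u 0 = u 0 * u 1
  right : v 1 * v 0 = v 0 * v 1
  cross : ∀ α β, v α * u β = u β * v α
  wedge_left : ∀ ω α, u α * wedge ω = wedge ω * u α
  wedge_right : ∀ ω α, v α * wedge ω = wedge ω * v α

theorem CommutingSpinors.symm {u v : Spinor R M} (H : CommutingSpinors u v) :
    CommutingSpinors v u :=
  ⟨H.right, H.left, fun α β => (H.cross β α).symm, H.wedge_right, H.wedge_left⟩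

theorem y_wedge (ω : ExteriorAlgebra R M) (α : Fin 2) : y α * wedge ω = wedge ω * y α :=
  (wedge_mulVar ω _).symm

theorem ybar_wedge (ω : ExteriorAlgebra R M) (α : Fin 2) :
    ybar α * wedge ω = wedge ω * ybar α :=
  (wedge_mulVar ω _).symm

theorem p_wedge (ω : ExteriorAlgebra R M) (α : Fin 2) : p α * wedge ω = wedge ω * p α := by
  simp only [p, Finset.mul_sum, Finset.sum_mul, mul_smul_comm, smul_mul_assoc, wedge_partialY]

theorem pbar_wedge (ω : ExteriorAlgebra R M) (α : Fin 2) :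
    pbar α * wedge ω = wedge ω * pbar α := by
  simp only [pbar, Finset.mul_sum, Finset.sum_mul, mul_smul_comm, smul_mul_assoc, wedge_partialY]

theorem y_comm (α β : Fin 2) : (y α * y β : End R (Form R M)) = y β * y α := mulVar_comm _ _

theorem ybar_comm (α β : Fin 2) : (ybar α * ybar β : End R (Form R M)) = ybar β * ybar α :=
  mulVar_comm _ _

theorem p_comm (α β : Fin 2) : (p α * p β : End R (Form R M)) = p β * p α := by
  fin_cases α <;> fin_cases β <;>
    simp [p_zero, p_one, smul_smul, mul_comm, partialY_comm (Sum.inl 1) (Sum.inl 0)]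

theorem pbar_comm (α β : Fin 2) : (pbar α * pbar β : End R (Form R M)) = pbar β * pbar α := by
  fin_cases α <;> fin_cases β <;>
    simp [pbar_zero, pbar_one, smul_smul, mul_comm, partialY_comm (Sum.inr 1) (Sum.inr 0)]

theorem ybar_y (α β : Fin 2) : (ybar α * y β : End R (Form R M)) = y β * ybar α :=
  mulVar_comm _ _

theorem ybar_p (α β : Fin 2) : (ybar α * p β : End R (Form R M)) = p β * ybar α := by
  simp only [p, ybar, Finset.mul_sum, Finset.sum_mul, mul_smul_comm, smul_mul_assoc,
    partialY_mulVar Sum.inl_ne_inr]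

theorem pbar_y (α β : Fin 2) : (pbar α * y β : End R (Form R M)) = y β * pbar α := by
  simp only [pbar, y, Finset.mul_sum, Finset.sum_mul, mul_smul_comm, smul_mul_assoc,
    partialY_mulVar Sum.inr_ne_inl]

theorem pbar_p (α β : Fin 2) : (pbar α * p β : End R (Form R M)) = p β * pbar α := by
  simp only [p, pbar, Finset.mul_sum, Finset.sum_mul, mul_smul_comm, smul_mul_assoc]
  simp only [Fin.sum_univ_two, smul_add, smul_smul, partialY_comm (Sum.inr _) (Sum.inl _)]
  simp only [mul_comm]
  abel

theorem commutingSpinors_p_ybar : CommutingSpinors (R := R) (M := M) p ybar :=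
  ⟨p_comm _ _, ybar_comm _ _, ybar_p, p_wedge, ybar_wedge⟩

theorem commutingSpinors_y_pbar : CommutingSpinors (R := R) (M := M) y pbar :=
  ⟨y_comm _ _, pbar_comm _ _, pbar_y, y_wedge, pbar_wedge⟩

theorem commutingSpinors_p_pbar : CommutingSpinors (R := R) (M := M) p pbar :=
  ⟨p_comm _ _, pbar_comm _ _, pbar_p, p_wedge, pbar_wedge⟩

theorem mulVar_partialY_pair_apply (i j : Var) (f : Form R M) (d : Var →₀ ℕ) :
    MvPowerSeries.coeff d ((mulVar i * partialY i + mulVar j * partialY j : End R (Form R M)) f) =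
      ((d i + d j : ℕ) : R) • MvPowerSeries.coeff d f := by
  have key : ∀ k, MvPowerSeries.coeff d (mulVar k (partialY k f)) =
      ((d k : ℕ) : R) • MvPowerSeries.coeff d f := by
    intro k
    rcases exists_add_single_or_eq_zero k d with hd | ⟨e, rfl⟩
    · simp [coeff_mulVar_of_eq_zero _ hd, hd]
    · simp [coeff_mulVar_add, coeff_partialY]
  simp only [LinearMap.add_apply, Module.End.mul_apply, map_add, key, ← add_smul, Nat.cast_add]

/-- The Euler operator in `y`. -/
theorem y_p_antisymm :
    (y 0 * p 1 - y 1 * p 0 : End R (Form R M)) = numFun fun m _ => Complex.I * m := by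
  have : (y 0 * p 1 - y 1 * p 0 : End R (Form R M)) = cst R Complex.I •
      (mulVar (Sum.inl 0) * partialY (Sum.inl 0) + mulVar (Sum.inl 1) * partialY (Sum.inl 1)) := by
    simp [p_zero, p_one, y, cst_neg, smul_add]
  rw [this]
  ext1 f
  refine form_ext fun d => ?_
  rw [LinearMap.smul_apply, coeff_smul', mulVar_partialY_pair_apply, coeff_numFun,
    ← cst_natCast, smul_smul, ← cst_mul]
  simp [degY]

/-- The Euler operator in `ȳ`. -/
theorem ybar_pbar_antisymm :
    (ybar 0 * pbar 1 - ybar 1 * pbar 0 : End R (Form R M)) =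
      numFun fun _ n => Complex.I * n := by
  have : (ybar 0 * pbar 1 - ybar 1 * pbar 0 : End R (Form R M)) = cst R Complex.I •
      (mulVar (Sum.inr 0) * partialY (Sum.inr 0) + mulVar (Sum.inr 1) * partialY (Sum.inr 1)) := by
    simp [pbar_zero, pbar_one, ybar, cst_neg, smul_add]
  rw [this]
  ext1 f
  refine form_ext fun d => ?_
  rw [LinearMap.smul_apply, coeff_smul', mulVar_partialY_pair_apply, coeff_numFun,
    ← cst_natCast, smul_smul, ← cst_mul]
  simp [degYbar]

theorem p_y_zero_one : (p 0 * y 1 : End R (Form R M)) = y 1 * p 0 + cst R (-Complex.I) • 1 := by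
  simp [p_zero, y, partialY_mulVar_self, smul_add]

theorem p_y_one_zero : (p 1 * y 0 : End R (Form R M)) = y 0 * p 1 + cst R Complex.I • 1 := by
  simp [p_one, y, partialY_mulVar_self, smul_add]

theorem p_y_self (α : Fin 2) : (p α * y α : End R (Form R M)) = y α * p α := by
  fin_cases α <;> simp [p_zero, p_one, y, partialY_mulVar]

theorem pbar_ybar_zero_one :
    (pbar 0 * ybar 1 : End R (Form R M)) = ybar 1 * pbar 0 + cst R (-Complex.I) • 1 := by
  simp [pbar_zero, ybar, partialY_mulVar_self, smul_add]

theorem pbar_ybar_one_zero :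
    (pbar 1 * ybar 0 : End R (Form R M)) = ybar 0 * pbar 1 + cst R Complex.I • 1 := by
  simp [pbar_one, ybar, partialY_mulVar_self, smul_add]

theorem pbar_ybar_self (α : Fin 2) : (pbar α * ybar α : End R (Form R M)) = ybar α * pbar α := by
  fin_cases α <;> simp [pbar_zero, pbar_one, ybar, partialY_mulVar]

theorem p_y_antisymm :
    (p 0 * y 1 - p 1 * y 0 : End R (Form R M)) = numFun fun m _ => -Complex.I * (m + 2) := by
  have h1 := y_p_antisymm (R := R) (M := M)
  have h2 : (p 0 * y 1 - p 1 * y 0 : End R (Form R M)) =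
      cst R (-1) • (y 0 * p 1 - y 1 * p 0) + cst R (-2 * Complex.I) • 1 := by
    simp only [p_y_zero_one, p_y_one_zero, show (2 : ℂ) = 1 + 1 by norm_num, cst_neg, cst_mul,
      cst_add, cst_one]
    module
  rw [h2, h1, ← numFun_one, numFun_smul, numFun_smul, numFun_add]
  exact numFun_congr fun m n => by ring

theorem pbar_ybar_antisymm :
    (pbar 0 * ybar 1 - pbar 1 * ybar 0 : End R (Form R M)) =
      numFun fun _ n => -Complex.I * (n + 2) := by
  have h1 := ybar_pbar_antisymm (R := R) (M := M)
  have h2 : (pbar 0 * ybar 1 - pbar 1 * ybar 0 : End R (Form R M)) =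
      cst R (-1) • (ybar 0 * pbar 1 - ybar 1 * pbar 0) + cst R (-2 * Complex.I) • 1 := by
    simp only [pbar_ybar_zero_one, pbar_ybar_one_zero, show (2 : ℂ) = 1 + 1 by norm_num, cst_neg,
      cst_mul, cst_add, cst_one]
    module
  rw [h2, h1, ← numFun_one, numFun_smul, numFun_smul, numFun_add]
  exact numFun_congr fun m n => by ring

/-- A spinor `u` is exact if `u_α x^α = 0` has only the solutions `x^α = u^α z`. -/
def IsExact (u : Spinor R M) : Prop :=
  ∀ x : Fin 2 → Form R M, u 0 (x 1) = u 1 (x 0) → ∃ z, ∀ α, x α = u α z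

/-- The variables form a regular sequence. -/
theorem exists_eq_mulVar {i j : Var} (hij : i ≠ j) {f g : Form R M}
    (H : mulVar i g = mulVar j f) : ∃ z, f = mulVar i z ∧ g = mulVar j z := by
  have H' := fun d => congrArg (MvPowerSeries.coeff d) H
  obtain ⟨z, hz⟩ : ∃ z : Form R M,
      ∀ d, MvPowerSeries.coeff d z = MvPowerSeries.coeff (d + Finsupp.single i 1) f :=
    ⟨fun d => MvPowerSeries.coeff (d + Finsupp.single i 1) f, fun _ => rfl⟩
  refine ⟨z, form_ext fun d => ?_, form_ext fun d => ?_⟩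
  · rcases exists_add_single_or_eq_zero i d with hd | ⟨e, rfl⟩
    · rw [coeff_mulVar_of_eq_zero _ hd, ← coeff_mulVar_add j, ← H',
        coeff_mulVar_of_eq_zero _ (by simp [hd, hij.symm])]
    · rw [coeff_mulVar_add, hz]
  · rcases exists_add_single_or_eq_zero j d with hd | ⟨e, rfl⟩
    · rw [coeff_mulVar_of_eq_zero _ hd, ← coeff_mulVar_add i, H',
        coeff_mulVar_of_eq_zero _ (by simp [hd, hij])]
    · rw [coeff_mulVar_add, ← coeff_mulVar_add i, H', add_right_comm, coeff_mulVar_add, hz]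

/-- The antiderivative with respect to the variable `i` that vanishes at `0`. -/
noncomputable def antideriv (i : Var) (f : Form R M) : Form R M :=
  fun d => cst R (1 / (d i : ℂ)) • MvPowerSeries.coeff d (mulVar i f)

theorem coeff_antideriv (i : Var) (f : Form R M) (d : Var →₀ ℕ) :
    MvPowerSeries.coeff d (antideriv i f) =
      cst R (1 / (d i : ℂ)) • MvPowerSeries.coeff d (mulVar i f) := rfl

theorem partialY_antideriv (i : Var) (f : Form R M) : partialY i (antideriv i f) = f := by
  refine form_ext fun d => ?_
  rw [coeff_partialY, coeff_antideriv, coeff_mulVar_add, ← cst_natCast]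
  refine cst_smul_cancel ?_ _
  have : ((d i : ℂ) + 1) ≠ 0 := Nat.cast_add_one_ne_zero _
  simp [this]

theorem partialY_antideriv_of_ne {i j : Var} (hij : i ≠ j) (f : Form R M) :
    partialY i (antideriv j f) = antideriv j (partialY i f) := by
  refine form_ext fun d => ?_
  rw [coeff_partialY, coeff_antideriv, coeff_antideriv, ← Module.End.mul_apply,
    ← partialY_mulVar hij, Module.End.mul_apply, coeff_partialY, smul_comm]
  simp [hij]

theorem antideriv_zero (i : Var) : antideriv i (0 : Form R M) = 0 := by
  refine form_ext fun d => ?_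
  simp [coeff_antideriv]

/-- Integration of a closed gradient in two variables. -/
theorem exists_eq_partialY {i j : Var} (hij : i ≠ j) {f g : Form R M}
    (H : partialY i g = partialY j f) : ∃ z, f = partialY i z ∧ g = partialY j z := by
  -- the error `r` of the first guess does not depend on the variable `i`
  set r := g - partialY j (antideriv i f) with hr
  have hr0 : partialY i r = 0 := by
    rw [hr, map_sub, H, ← Module.End.mul_apply, partialY_comm, Module.End.mul_apply,
      partialY_antideriv, sub_self]
  refine ⟨antideriv i f + antideriv j r, ?_, ?_⟩
  · rw [map_add, partialY_antideriv, partialY_antideriv_of_ne hij, hr0, antideriv_zero, add_zero]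
  · rw [map_add, partialY_antideriv, hr, add_sub_cancel]

theorem isExact_y : IsExact (R := R) (M := M) y := by
  intro x hx
  obtain ⟨z, h0, h1⟩ := exists_eq_mulVar (by simp) hx
  exact ⟨z, fun α => by fin_cases α <;> assumption⟩

theorem isExact_ybar : IsExact (R := R) (M := M) ybar := by
  intro x hx
  obtain ⟨z, h0, h1⟩ := exists_eq_mulVar (by simp) hx
  exact ⟨z, fun α => by fin_cases α <;> assumption⟩

theorem cst_I_mul : cst R (-Complex.I) * cst R Complex.I = 1 := by
  rw [← cst_mul, neg_mul, Complex.I_mul_I, neg_neg, cst_one]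

theorem isExact_of_partialY {u : Spinor R M} {i j : Var} (hij : i ≠ j)
    (h0 : u 0 = cst R (-Complex.I) • partialY i) (h1 : u 1 = cst R Complex.I • partialY j) :
    IsExact u := by
  intro x hx
  obtain ⟨z, hz0, hz1⟩ := exists_eq_partialY hij (f := cst R Complex.I • x 0)
    (g := cst R (-Complex.I) • x 1) (by simpa [h0, h1] using hx)
  refine ⟨z, fun α => ?_⟩
  fin_cases α
  · simp only [Fin.zero_eta, h0, LinearMap.smul_apply, ← hz0, smul_smul, cst_I_mul, one_smul]
  · simp only [Fin.mk_one, h1, LinearMap.smul_apply, ← hz1, smul_smul,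
      mul_comm (cst R Complex.I), cst_I_mul, one_smul]

theorem isExact_p : IsExact (R := R) (M := M) p := isExact_of_partialY (by simp) p_zero p_one

theorem isExact_pbar : IsExact (R := R) (M := M) pbar :=
  isExact_of_partialY (by simp) pbar_zero pbar_one

theorem smul_partialY_surjective {a b : ℂ} (hab : a * b = 1) (i : Var) :
    Function.Surjective (cst R a • partialY i : End R (Form R M)) := fun f =>
  ⟨cst R b • antideriv i f, by
    rw [LinearMap.smul_apply, map_smul, partialY_antideriv, cst_smul_cancel hab]⟩

theorem p_surjective (α : Fin 2) : Function.Surjective (p α : End R (Form R M)) := by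
  fin_cases α
  · simpa only [Fin.zero_eta, p_zero] using
      smul_partialY_surjective (b := Complex.I) (by simp) _
  · simpa only [Fin.mk_one, p_one] using
      smul_partialY_surjective (b := -Complex.I) (by simp) _

theorem pbar_surjective (α : Fin 2) : Function.Surjective (pbar α : End R (Form R M)) := by
  fin_cases α
  · simpa only [Fin.zero_eta, pbar_zero] using
      smul_partialY_surjective (b := Complex.I) (by simp) _
  · simpa only [Fin.mk_one, pbar_one] using
      smul_partialY_surjective (b := -Complex.I) (by simp) _

end Spinors

/-! ### The frame of 1-forms and the components of forms -/

section Frame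

variable {R M : Type*} [CommRing R] [Algebra ℂ R] [AddCommGroup M] [Module R M]
variable (h : Module.Basis (Fin 2 × Fin 2) R M)

/-- Exterior multiplication by the vierbein 1-form `h_{αα'}`. -/
noncomputable def frame (α α' : Fin 2) : End R (Form R M) := wedge (h1 h α α')

theorem h1_mul_self (α α' : Fin 2) : h1 h α α' * h1 h α α' = 0 :=
  ExteriorAlgebra.ι_sq_zero _

theorem h1_mul_comm (α α' β β' : Fin 2) :
    h1 h α α' * h1 h β β' = -(h1 h β β' * h1 h α α') :=
  eq_neg_of_add_eq_zero_left (ExteriorAlgebra.ι_add_mul_swap _ _)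

theorem frame_self (α α' : Fin 2) (x : Form R M) :
    frame h α α' (frame h α α' x) = 0 := by
  rw [frame, ← Module.End.mul_apply, ← wedge_mul, h1_mul_self, wedge_zero, LinearMap.zero_apply]

theorem frame_comm (α α' β β' : Fin 2) (x : Form R M) :
    frame h α α' (frame h β β' x) = -frame h β β' (frame h α α' x) := by
  rw [frame, frame, ← Module.End.mul_apply, ← wedge_mul, h1_mul_comm, wedge_neg, wedge_mul]
  rfl

theorem frame_01_00 (x : Form R M) : frame h 0 1 (frame h 0 0 x) = -frame h 0 0 (frame h 0 1 x) :=
  frame_comm h _ _ _ _ x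

theorem frame_10_00 (x : Form R M) : frame h 1 0 (frame h 0 0 x) = -frame h 0 0 (frame h 1 0 x) :=
  frame_comm h _ _ _ _ x

theorem frame_11_00 (x : Form R M) : frame h 1 1 (frame h 0 0 x) = -frame h 0 0 (frame h 1 1 x) :=
  frame_comm h _ _ _ _ x

theorem frame_10_01 (x : Form R M) : frame h 1 0 (frame h 0 1 x) = -frame h 0 1 (frame h 1 0 x) :=
  frame_comm h _ _ _ _ x

theorem frame_11_01 (x : Form R M) : frame h 1 1 (frame h 0 1 x) = -frame h 0 1 (frame h 1 1 x) :=
  frame_comm h _ _ _ _ x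

theorem frame_11_10 (x : Form R M) : frame h 1 1 (frame h 1 0 x) = -frame h 1 0 (frame h 1 1 x) :=
  frame_comm h _ _ _ _ x

/-- The 1-form `h_{αα'} C^{αα'}`. -/
noncomputable def form1 (C : Fin 2 → Fin 2 → Form R M) : Form R M :=
  frame h 0 0 (C 0 0) + frame h 0 1 (C 0 1) + frame h 1 0 (C 1 0) + frame h 1 1 (C 1 1)

/-- The 2-form `½ (H_{αβ} A^{αβ} + H̄_{α'β'} B^{α'β'})` with symmetric `A` and `B`. A symmetric
bispinor is given by its three components, labelled by the sum of the two indices. -/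
noncomputable def form2 (A B : Fin 3 → Form R M) : Form R M :=
  frame h 0 0 (frame h 0 1 (A 0)) + frame h 1 0 (frame h 1 1 (A 2)) +
    (frame h 0 0 (frame h 1 1 (A 1)) - frame h 0 1 (frame h 1 0 (A 1))) +
    frame h 0 0 (frame h 1 0 (B 0)) + frame h 0 1 (frame h 1 1 (B 2)) +
    (frame h 0 0 (frame h 1 1 (B 1)) + frame h 0 1 (frame h 1 0 (B 1)))

/-- The 3-form `⅓ ℋ_{αα'} W^{αα'}`. -/
noncomputable def form3 (W : Fin 2 → Fin 2 → Form R M) : Form R M :=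
  frame h 0 0 (frame h 0 1 (frame h 1 0 (W 0 0))) +
    frame h 0 0 (frame h 0 1 (frame h 1 1 (W 0 1))) -
    frame h 0 0 (frame h 1 0 (frame h 1 1 (W 1 0))) -
    frame h 0 1 (frame h 1 0 (frame h 1 1 (W 1 1)))

/-- The 4-form `h_{00} h_{01} h_{10} h_{11} g`. -/
noncomputable def form4 (g : Form R M) : Form R M :=
  frame h 0 0 (frame h 0 1 (frame h 1 0 (frame h 1 1 g)))

/-- The divergence `u_β A^{αβ}` of a symmetric bispinor, up to a sign. -/
noncomputable def div (u : Spinor R M) (A : Fin 3 → Form R M) (α : Fin 2) : Form R M :=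
  ![u 1 (A 0) - u 0 (A 1), u 1 (A 1) - u 0 (A 2)] α

theorem hOp_apply (u v : Spinor R M) (f : Form R M) :
    hOp h u v f = form1 h fun α α' => u α (v α' f) := by
  simp [hOp, contract, form1, frame, add_assoc]

theorem wedge_H2 (α β : Fin 2) :
    (wedge (H2 h α β) : End R (Form R M)) =
      frame h α 0 * frame h β 1 - frame h α 1 * frame h β 0 := by
  simp [H2, eps, cst_zero, cst_neg, cst_one, wedge_add, wedge_neg, wedge_mul, frame, sub_eq_add_neg]

theorem wedge_Hbar2 (α β : Fin 2) :
    (wedge (Hbar2 h α β) : End R (Form R M)) =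
      frame h 0 α * frame h 1 β - frame h 1 α * frame h 0 β := by
  simp [Hbar2, eps, cst_zero, cst_neg, cst_one, wedge_add, wedge_neg, wedge_mul, frame,
    sub_eq_add_neg]

theorem wedge_H3 (α α' : Fin 2) :
    (wedge (H3 h α α') : End R (Form R M)) =
      frame h α 0 * wedge (Hbar2 h 1 α') - frame h α 1 * wedge (Hbar2 h 0 α') := by
  simp [H3, eps, cst_zero, cst_neg, cst_one, wedge_add, wedge_neg, wedge_mul, frame,
    sub_eq_add_neg]

theorem cst_half_smul_add {V : Type*} [AddCommGroup V] [Module R V] (x : V) :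
    cst R (1 / 2) • (x + x) = x := by
  have h2 : cst R 2 = 2 := map_ofNat (algebraMap ℂ R) 2
  rw [← two_smul R x, ← h2]
  exact cst_smul_cancel (by norm_num) x

theorem HOp_apply {u : Spinor R M} (hu : u 1 * u 0 = u 0 * u 1) (f : Form R M) :
    HOp h u u f = form2 h ![u 0 (u 0 f), u 0 (u 1 f), u 1 (u 1 f)] 0 := by
  have hu' : u 1 (u 0 f) = u 0 (u 1 f) := congrArg (fun L : End R (Form R M) => L f) hu
  rw [← cst_half_smul_add (R := R) (form2 h _ _), HOp, LinearMap.smul_apply]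
  congr 1
  simp only [contract, Fin.sum_univ_two, LinearMap.add_apply, Module.End.mul_apply, wedge_H2, hu',
    LinearMap.sub_apply, form2, frame_01_00, frame_10_00, frame_11_00, frame_10_01, frame_11_01,
    frame_11_10, Pi.zero_apply, map_zero, Matrix.cons_val]
  abel

theorem HbarOp_apply {v : Spinor R M} (hv : v 1 * v 0 = v 0 * v 1) (f : Form R M) :
    HbarOp h v v f = form2 h 0 ![v 0 (v 0 f), v 0 (v 1 f), v 1 (v 1 f)] := by
  have hv' : v 1 (v 0 f) = v 0 (v 1 f) := congrArg (fun L : End R (Form R M) => L f) hv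
  rw [← cst_half_smul_add (R := R) (form2 h _ _), HbarOp, LinearMap.smul_apply]
  congr 1
  simp only [contract, Fin.sum_univ_two, LinearMap.add_apply, Module.End.mul_apply, wedge_Hbar2,
    hv', LinearMap.sub_apply, form2, frame_01_00, frame_10_00, frame_11_00, frame_10_01,
    frame_11_01, frame_11_10, Pi.zero_apply, map_zero, Matrix.cons_val]
  abel

theorem H3Op_apply (u v : Spinor R M) (f : Form R M) :
    H3Op h u v f = (3 : R) • form3 h fun α α' => u α (v α' f) := by
  rw [show (3 : R) = 1 + 1 + 1 by norm_num, add_smul, add_smul, one_smul]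
  simp only [H3Op, contract, Fin.sum_univ_two, LinearMap.add_apply, Module.End.mul_apply, wedge_H3,
    wedge_Hbar2, LinearMap.sub_apply, form3, map_sub, map_neg, frame_self, frame_01_00,
    frame_10_00, frame_11_00, frame_10_01, frame_11_01, frame_11_10, map_zero]
  abel

variable {h}

theorem CommutingSpinors.apply {u v : Spinor R M} (H : CommutingSpinors u v) :
    (∀ x, u 1 (u 0 x) = u 0 (u 1 x)) ∧ (∀ x, v 1 (v 0 x) = v 0 (v 1 x)) ∧
      (∀ α β x, v α (u β x) = u β (v α x)) :=
  ⟨fun x => congrArg (fun L : End R (Form R M) => L x) H.left,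
    fun x => congrArg (fun L : End R (Form R M) => L x) H.right,
    fun α β x => congrArg (fun L : End R (Form R M) => L x) (H.cross α β)⟩

theorem CommutingSpinors.apply_frame {u v : Spinor R M} (H : CommutingSpinors u v) :
    (∀ α β β' x, u α (frame h β β' x) = frame h β β' (u α x)) ∧
      (∀ α β β' x, v α (frame h β β' x) = frame h β β' (v α x)) :=
  ⟨fun α β β' x => congrArg (fun L : End R (Form R M) => L x) (H.wedge_left (h1 h β β') α),
    fun α β β' x => congrArg (fun L : End R (Form R M) => L x) (H.wedge_right (h1 h β β') α)⟩

/-- `h(u, v)` on 1-forms. The components of the image are characterized rather than written out, to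
avoid the denominators of the mixed components. -/
theorem hOp_form1 {u v : Spinor R M} (H : CommutingSpinors u v)
    (C : Fin 2 → Fin 2 → Form R M) {A B : Fin 3 → Form R M}
    (h0 : A 0 = u 0 (v 0 (C 0 1) - v 1 (C 0 0))) (h2 : A 2 = u 1 (v 0 (C 1 1) - v 1 (C 1 0)))
    (h0' : B 0 = v 0 (u 0 (C 1 0) - u 1 (C 0 0))) (h2' : B 2 = v 1 (u 0 (C 1 1) - u 1 (C 0 1)))
    (h1 : A 1 + B 1 = u 0 (v 0 (C 1 1) - v 1 (C 1 0)) + v 1 (u 0 (C 1 0) - u 1 (C 0 0)))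
    (h1' : B 1 - A 1 = v 1 (u 0 (C 1 0) - u 1 (C 0 0)) - u 1 (v 0 (C 0 1) - v 1 (C 0 0))) :
    hOp h u v (form1 h C) = form2 h A B := by
  obtain ⟨hu, hv, hc⟩ := H.apply
  obtain ⟨fu, fv⟩ := H.apply_frame (h := h)
  have : form2 h A B = frame h 0 0 (frame h 0 1 (A 0)) + frame h 1 0 (frame h 1 1 (A 2)) +
      frame h 0 0 (frame h 1 1 (A 1 + B 1)) + frame h 0 1 (frame h 1 0 (B 1 - A 1)) +
      frame h 0 0 (frame h 1 0 (B 0)) + frame h 0 1 (frame h 1 1 (B 2)) := by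
    simp only [form2, map_add, map_sub]
    abel
  rw [this, h0, h2, h0', h2', h1, h1', hOp_apply, form1, form1]
  simp only [map_add, map_sub, map_neg, fu, fv, hu, hv, hc, frame_self, frame_01_00,
    frame_10_00, frame_11_00, frame_10_01, frame_11_01, frame_11_10]
  abel

theorem hOp_form2 {u v : Spinor R M} (H : CommutingSpinors u v) (A B : Fin 3 → Form R M) :
    hOp h u v (form2 h A B) =
      form3 h fun α α' => v α' (div u A α) - u α (div v B α') := by
  obtain ⟨hu, hv, hc⟩ := H.apply
  obtain ⟨fu, fv⟩ := H.apply_frame (h := h)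
  rw [hOp_apply, form1, form2, form3]
  simp only [div, map_add, map_sub, map_neg, map_zero, fu, fv, hu, hv, hc, frame_self, frame_01_00,
    frame_10_00, frame_11_00, frame_10_01, frame_11_01, frame_11_10, Matrix.cons_val]
  abel

theorem hOp_form3 {u v : Spinor R M} (H : CommutingSpinors u v) (W : Fin 2 → Fin 2 → Form R M) :
    hOp h u v (form3 h W) =
      form4 h (u 1 (v 0 (W 0 1) - v 1 (W 0 0)) - u 0 (v 0 (W 1 1) - v 1 (W 1 0))) := by
  obtain ⟨hu, hv, hc⟩ := H.apply
  obtain ⟨fu, fv⟩ := H.apply_frame (h := h)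
  rw [hOp_apply, form1, form3, form4]
  simp only [map_add, map_sub, map_neg, map_zero, fu, fv, hu, hv, hc, frame_self, frame_01_00,
    frame_10_00, frame_11_00, frame_10_01, frame_11_01, frame_11_10]
  abel

theorem HOp_form1 {u v : Spinor R M} (H : CommutingSpinors u v) (C : Fin 2 → Fin 2 → Form R M) :
    HOp h u u (form1 h C) = form3 h fun α α' => u α (u 0 (C 1 α') - u 1 (C 0 α')) := by
  obtain ⟨hu, hv, hc⟩ := H.apply
  obtain ⟨fu, fv⟩ := H.apply_frame (h := h)
  rw [HOp_apply h H.left, form1, form2, form3]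
  simp only [map_add, map_sub, map_neg, map_zero, fu, hu, frame_self, frame_01_00,
    frame_10_00, frame_11_00, frame_10_01, frame_11_01, frame_11_10, Matrix.cons_val,
    Pi.zero_apply]
  abel

theorem HbarOp_form1 {u v : Spinor R M} (H : CommutingSpinors u v)
    (C : Fin 2 → Fin 2 → Form R M) :
    HbarOp h v v (form1 h C) = form3 h fun α α' => -v α' (v 0 (C α 1) - v 1 (C α 0)) := by
  obtain ⟨hu, hv, hc⟩ := H.apply
  obtain ⟨fu, fv⟩ := H.apply_frame (h := h)
  rw [HbarOp_apply h H.right, form1, form2, form3]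
  simp only [map_add, map_sub, map_neg, map_zero, fv, hv, frame_self, frame_01_00,
    frame_10_00, frame_11_00, frame_10_01, frame_11_01, frame_11_10, Matrix.cons_val,
    Pi.zero_apply]
  abel

theorem HOp_form2 {u v : Spinor R M} (H : CommutingSpinors u v) (A B : Fin 3 → Form R M) :
    HOp h u u (form2 h A B) = form4 h (u 1 (div u A 0) - u 0 (div u A 1)) := by
  obtain ⟨hu, hv, hc⟩ := H.apply
  obtain ⟨fu, fv⟩ := H.apply_frame (h := h)
  rw [HOp_apply h H.left, form2, form2, form4]
  simp only [div, map_add, map_sub, map_neg, map_zero, fu, hu, frame_self, frame_01_00,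
    frame_10_00, frame_11_00, frame_10_01, frame_11_01, frame_11_10, Matrix.cons_val,
    Pi.zero_apply]
  abel

theorem HbarOp_form2 {u v : Spinor R M} (H : CommutingSpinors u v) (A B : Fin 3 → Form R M) :
    HbarOp h v v (form2 h A B) = -form4 h (v 1 (div v B 0) - v 0 (div v B 1)) := by
  obtain ⟨hu, hv, hc⟩ := H.apply
  obtain ⟨fu, fv⟩ := H.apply_frame (h := h)
  rw [HbarOp_apply h H.right, form2, form2, form4]
  simp only [div, map_add, map_sub, map_neg, map_zero, fv, hv, frame_self, frame_01_00,
    frame_10_00, frame_11_00, frame_10_01, frame_11_01, frame_11_10, Matrix.cons_val,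
    Pi.zero_apply]
  abel

end Frame

/-! ### Exactness for a pair of commuting spinors -/

section Exactness

variable {R M : Type*} [CommRing R] [Algebra ℂ R] [AddCommGroup M] [Module R M]
variable {u v : Spinor R M}

theorem exists_div_eq (hu : ∀ α, Function.Surjective (u α)) (s : Fin 2 → Form R M) :
    ∃ A, ∀ α, div u A α = s α := by
  obtain ⟨a, ha⟩ := hu 1 (s 0)
  obtain ⟨b, hb⟩ := hu 0 (-s 1)
  refine ⟨![a, 0, b], fun α => ?_⟩
  fin_cases α <;> simp [div, ha, hb]

/-- The antisymmetric part of `T` gives a contribution `v^α' u^α r`, which is absorbed by `s`. -/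
theorem exists_div_sub_div (H : CommutingSpinors u v) (hu : ∀ α, Function.Surjective (u α))
    (s : Fin 2 → Form R M) (T : Fin 2 → Fin 2 → Form R M) :
    ∃ A B, ∀ α α', v α' (s α) + u α (v 0 (T α' 1) - v 1 (T α' 0)) =
      v α' (div u A α) - u α (div v B α') := by
  obtain ⟨-, -, hc⟩ := H.apply
  set r := cst R (1 / 2) • (T 0 1 - T 1 0) with hr
  set q := cst R (1 / 2) • (T 0 1 + T 1 0) with hq
  have h01 : T 0 1 = q + r := by
    rw [← cst_half_smul_add (R := R) (T 0 1), hq, hr]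
    module
  have h10 : T 1 0 = q - r := by
    rw [← cst_half_smul_add (R := R) (T 1 0), hq, hr]
    module
  obtain ⟨A, hA⟩ := exists_div_eq hu fun α => s α + u α r
  refine ⟨A, ![T 0 0, q, T 1 1], fun α α' => ?_⟩
  rw [hA]
  fin_cases α' <;> simp [div, h01, h10, hc] <;> abel

/-- The bispinor `W` is determined up to `v^α' s^α` by its contraction with `v`. -/
theorem exists_decomposition (H : CommutingSpinors u v) (hv : IsExact v)
    {W : Fin 2 → Fin 2 → Form R M} {t : Fin 2 → Form R M}
    (ht : ∀ α, v 0 (W α 1) - v 1 (W α 0) = u α (v 0 (t 1) - v 1 (t 0))) :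
    ∃ s : Fin 2 → Form R M, ∀ α α', W α α' = v α' (s α) + u α (t α') := by
  obtain ⟨-, -, hc⟩ := H.apply
  have : ∀ α, ∃ s, ∀ α', W α α' - u α (t α') = v α' s := fun α =>
    hv (fun α' => W α α' - u α (t α')) (by
      simp only [map_sub, hc]
      have := ht α
      rw [map_sub, sub_eq_sub_iff_add_eq_add] at this
      rw [sub_eq_sub_iff_add_eq_add, this, add_comm])
  choose s hs using this
  exact ⟨s, fun α α' => by rw [← hs, sub_add_cancel]⟩

/-- Exactness at the 3-forms, up to the terms `u^α l^α'` with `l` in the image of `1 - e`, where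
`e` is a projection onto the series of the form `v_α' t^α'`. -/
theorem exists_of_closed_three (H : CommutingSpinors u v) (hu : ∀ α, Function.Surjective (u α))
    (hu' : IsExact u) (hv : IsExact v) (e : End R (Form R M))
    (heu : ∀ α x, u α (e x) = e (u α x)) (hev : ∀ α x, e (v α x) = v α x)
    (he : ∀ z, ∃ t : Fin 2 → Form R M, e z = v 0 (t 1) - v 1 (t 0))
    {W : Fin 2 → Fin 2 → Form R M}
    (hW : u 1 (v 0 (W 0 1) - v 1 (W 0 0)) - u 0 (v 0 (W 1 1) - v 1 (W 1 0)) = 0) :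
    ∃ (A B : Fin 3 → Form R M) (l : Fin 2 → Form R M), ∀ α α', W α α' =
      v α' (div u A α) - u α (div v B α') + u α (l α' - e (l α')) := by
  obtain ⟨z, hz⟩ := hu' (fun α => v 0 (W α 1) - v 1 (W α 0)) (sub_eq_zero.mp hW).symm
  obtain ⟨t, ht⟩ := he z
  obtain ⟨s, hs⟩ := exists_decomposition H hv (W := W) (t := t) fun α => by
    rw [← ht, heu, ← hz, map_sub, hev, hev]
  choose T hT using fun α' => he (t α')
  obtain ⟨A, B, hAB⟩ := exists_div_sub_div H hu s T
  refine ⟨A, B, t, fun α α' => ?_⟩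
  rw [← hAB, ← hT, hs, map_sub]
  abel

/-- A 2-form is exact if `u_β A^{αβ}` and `v_β' B^{α'β'}` are given by the same series `r`. -/
theorem exists_form1_of_div_eq (h : Module.Basis (Fin 2 × Fin 2) R M) (H : CommutingSpinors u v)
    (hu : ∀ α, Function.Surjective (u α)) (hv : ∀ α, Function.Surjective (v α))
    (hu' : IsExact u) (hv' : IsExact v) {A B : Fin 3 → Form R M} {r : Form R M}
    (hA : ∀ α, div u A α = u α r) (hB : ∀ α, div v B α = v α r) :
    ∃ C, hOp h u v (form1 h C) = form2 h A B := by
  obtain ⟨cu, cv, hc⟩ := H.apply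
  have key : ∀ (w : Spinor R M) (_ : IsExact w) (D : Fin 3 → Form R M)
      (_ : ∀ α, div w D α = w α r), ∃ k : Fin 2 → Form R M,
      D 0 = w 0 (k 0) ∧ D 1 + r = w 1 (k 0) ∧ D 1 - r = w 0 (k 1) ∧ D 2 = w 1 (k 1) := by
    intro w hw D hD
    have h0 := hD 0
    have h1 := hD 1
    simp only [div, Matrix.cons_val] at h0 h1
    obtain ⟨k0, hk0⟩ := hw ![D 0, D 1 + r] (by
      simp only [Matrix.cons_val, map_add, ← h0]; abel)
    obtain ⟨k1, hk1⟩ := hw ![D 1 - r, D 2] (by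
      simp only [Matrix.cons_val, map_sub, ← h1]; abel)
    exact ⟨![k0, k1], hk0 0, hk0 1, hk1 0, hk1 1⟩
  obtain ⟨k, hk0, hk1, hk2, hk3⟩ := key u hu' A hA
  obtain ⟨l, hl0, hl1, hl2, hl3⟩ := key v hv' B hB
  have hkl : u 1 (k 0) - u 0 (k 1) = v 1 (l 0) - v 0 (l 1) := by
    rw [← hk1, ← hk2, ← hl1, ← hl2]; abel
  choose κ hκ using fun α => hv 0 (k α)
  obtain ⟨g, hg⟩ := hv' ![l 0, l 1 - (u 0 (κ 1) - u 1 (κ 0))] (by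
    simp only [Matrix.cons_val, map_sub, hc, hκ]
    rw [← sub_add, sub_add_eq_add_sub, add_sub_assoc, hkl]; abel)
  obtain ⟨g', hg'⟩ := hu 0 g
  have hg0 : l 0 = v 0 g := hg 0
  have hg1 : l 1 = u 0 (κ 1) - u 1 (κ 0) + v 1 g := by
    have : l 1 - (u 0 (κ 1) - u 1 (κ 0)) = v 1 g := hg 1
    rw [← this]; abel
  have e1 : ∀ α', u 0 (v α' g') = v α' g := fun α' => by rw [← hc, hg']
  refine ⟨![![0, κ 0], ![v 0 g', κ 1 + v 1 g']], hOp_form1 H _ ?_ ?_ ?_ ?_ ?_ ?_⟩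
  · simp [hk0, hκ]
  · simp [hk3, hκ, cv]
  · simp [hl0, hg0, e1]
  · simp only [Matrix.cons_val, map_add, e1, hl3, hg1, map_sub]; abel
  · rw [show A 1 + B 1 = (A 1 - r) + (B 1 + r) by abel, hk2, hl1, hg0]
    simp [hκ, cv, e1]
  · rw [show B 1 - A 1 = (B 1 + r) - (A 1 + r) by abel, hk1, hl1, hg0]
    simp [hκ, e1]

end Exactness

/-! ### Functions of the degrees, applied to series -/

section Concrete

variable {R M : Type*} [CommRing R] [Algebra ℂ R] [AddCommGroup M] [Module R M]

theorem apply_eq_of_mul_eq {L L' K K' : End R (Form R M)} (H : L * L' = K * K') (x : Form R M) :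
    L (L' x) = K (K' x) :=
  congrArg (fun E : End R (Form R M) => E x) H

theorem numFun_numFun (φ ψ : ℤ → ℤ → ℂ) (x : Form R M) :
    numFun φ (numFun ψ x) = numFun (fun m n => φ m n * ψ m n) x :=
  congrArg (fun E : End R (Form R M) => E x) (numFun_mul φ ψ)

theorem cst_smul_numFun (c : ℂ) (φ : ℤ → ℤ → ℂ) (x : Form R M) :
    cst R c • numFun φ x = numFun (fun m n => c * φ m n) x :=
  congrArg (fun E : End R (Form R M) => E x) (numFun_smul c φ)

theorem numFun_add_numFun (φ ψ : ℤ → ℤ → ℂ) (x : Form R M) :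
    numFun φ x + numFun ψ x = numFun (fun m n => φ m n + ψ m n) x :=
  congrArg (fun E : End R (Form R M) => E x) (numFun_add φ ψ)

theorem numFun_sub_numFun (φ ψ : ℤ → ℤ → ℂ) (x : Form R M) :
    numFun φ x - numFun ψ x = numFun (fun m n => φ m n - ψ m n) x := by
  refine form_ext fun d => ?_
  simp only [map_sub, coeff_numFun, cst_sub, sub_smul]

theorem numFun_apply_congr {φ ψ : ℤ → ℤ → ℂ} (H : ∀ m n : ℕ, φ m n = ψ m n) (x : Form R M) :
    numFun φ x = numFun ψ x := by
  rw [numFun_congr H]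

theorem y_p_antisymm_apply (x : Form R M) :
    y 0 (p 1 x) - y 1 (p 0 x) = numFun (fun m _ => Complex.I * m) x :=
  congrArg (fun E : End R (Form R M) => E x) y_p_antisymm

theorem ybar_pbar_antisymm_apply (x : Form R M) :
    ybar 0 (pbar 1 x) - ybar 1 (pbar 0 x) = numFun (fun _ n => Complex.I * n) x :=
  congrArg (fun E : End R (Form R M) => E x) ybar_pbar_antisymm

theorem p_y_antisymm_apply (x : Form R M) :
    p 0 (y 1 x) - p 1 (y 0 x) = numFun (fun m _ => -Complex.I * (m + 2)) x :=
  congrArg (fun E : End R (Form R M) => E x) p_y_antisymm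

theorem pbar_ybar_antisymm_apply (x : Form R M) :
    pbar 0 (ybar 1 x) - pbar 1 (ybar 0 x) = numFun (fun _ n => -Complex.I * (n + 2)) x :=
  congrArg (fun E : End R (Form R M) => E x) pbar_ybar_antisymm

/-- The double divergence of `y^α y^β x`. -/
theorem div_div_y (x : Form R M) :
    p 1 (div p ![y 0 (y 0 x), y 0 (y 1 x), y 1 (y 1 x)] 0) -
      p 0 (div p ![y 0 (y 0 x), y 0 (y 1 x), y 1 (y 1 x)] 1) =
      numFun (fun m _ => -(m + 2) * (m + 3)) x := by
  -- the left-hand side is `P (P x) - i P x` for `P = p^0 y^1 - p^1 y^0`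
  have e : ∀ x : Form R M, numFun (fun m _ => -(m + 2) * (m + 3)) x =
      (p 0 (y 1 (p 0 (y 1 x) - p 1 (y 0 x))) - p 1 (y 0 (p 0 (y 1 x) - p 1 (y 0 x)))) -
        cst R Complex.I • (p 0 (y 1 x) - p 1 (y 0 x)) := by
    intro x
    simp only [p_y_antisymm_apply, numFun_numFun]
    rw [cst_smul_numFun, numFun_sub_numFun]
    refine numFun_apply_congr (fun m n => ?_) x
    linear_combination (-(m + 2 : ℂ) ^ 2 - (m + 2)) * Complex.I_mul_I
  have h1 : ∀ x : Form R M, y 1 (p 0 x) = p 0 (y 1 x) + cst R Complex.I • x := fun x => by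
    have := congrArg (fun E : End R (Form R M) => E x) p_y_zero_one
    simp only [Module.End.mul_apply, LinearMap.add_apply, LinearMap.smul_apply, cst_neg,
      Module.End.one_apply] at this
    rw [this]; module
  have h2 : ∀ x : Form R M, y 0 (p 1 x) = p 1 (y 0 x) - cst R Complex.I • x := fun x => by
    have := congrArg (fun E : End R (Form R M) => E x) p_y_one_zero
    simp only [Module.End.mul_apply, LinearMap.add_apply, LinearMap.smul_apply,
      Module.End.one_apply] at this
    rw [this]; module
  have h3 : ∀ α (x : Form R M), y α (p α x) = p α (y α x) := fun α x =>
    (apply_eq_of_mul_eq (p_y_self α) x).symm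
  have h4 : ∀ x : Form R M, p 1 (p 0 x) = p 0 (p 1 x) := apply_eq_of_mul_eq (p_comm _ _)
  have h5 : ∀ x : Form R M, y 1 (y 0 x) = y 0 (y 1 x) := apply_eq_of_mul_eq (y_comm _ _)
  rw [e]
  simp only [div, Matrix.cons_val, map_sub, map_add, map_smul, h1, h2, h3, h4, h5]
  module

/-- The double divergence of `ȳ^α' ȳ^β' x`. -/
theorem div_div_ybar (x : Form R M) :
    pbar 1 (div pbar ![ybar 0 (ybar 0 x), ybar 0 (ybar 1 x), ybar 1 (ybar 1 x)] 0) -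
      pbar 0 (div pbar ![ybar 0 (ybar 0 x), ybar 0 (ybar 1 x), ybar 1 (ybar 1 x)] 1) =
      numFun (fun _ n => -(n + 2) * (n + 3)) x := by
  have e : ∀ x : Form R M, numFun (fun _ n => -(n + 2) * (n + 3)) x =
      (pbar 0 (ybar 1 (pbar 0 (ybar 1 x) - pbar 1 (ybar 0 x))) -
          pbar 1 (ybar 0 (pbar 0 (ybar 1 x) - pbar 1 (ybar 0 x)))) -
        cst R Complex.I • (pbar 0 (ybar 1 x) - pbar 1 (ybar 0 x)) := by
    intro x
    simp only [pbar_ybar_antisymm_apply, numFun_numFun]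
    rw [cst_smul_numFun, numFun_sub_numFun]
    refine numFun_apply_congr (fun m n => ?_) x
    linear_combination (-(n + 2 : ℂ) ^ 2 - (n + 2)) * Complex.I_mul_I
  have h1 : ∀ x : Form R M, ybar 1 (pbar 0 x) = pbar 0 (ybar 1 x) + cst R Complex.I • x := by
    intro x
    have := congrArg (fun E : End R (Form R M) => E x) pbar_ybar_zero_one
    simp only [Module.End.mul_apply, LinearMap.add_apply, LinearMap.smul_apply, cst_neg,
      Module.End.one_apply] at this
    rw [this]; module
  have h2 : ∀ x : Form R M, ybar 0 (pbar 1 x) = pbar 1 (ybar 0 x) - cst R Complex.I • x := by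
    intro x
    have := congrArg (fun E : End R (Form R M) => E x) pbar_ybar_one_zero
    simp only [Module.End.mul_apply, LinearMap.add_apply, LinearMap.smul_apply,
      Module.End.one_apply] at this
    rw [this]; module
  have h3 : ∀ α (x : Form R M), ybar α (pbar α x) = pbar α (ybar α x) := fun α x =>
    (apply_eq_of_mul_eq (pbar_ybar_self α) x).symm
  have h4 : ∀ x : Form R M, pbar 1 (pbar 0 x) = pbar 0 (pbar 1 x) :=
    apply_eq_of_mul_eq (pbar_comm _ _)
  have h5 : ∀ x : Form R M, ybar 1 (ybar 0 x) = ybar 0 (ybar 1 x) :=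
    apply_eq_of_mul_eq (ybar_comm _ _)
  rw [e]
  simp only [div, Matrix.cons_val, map_sub, map_add, map_smul, h1, h2, h3, h4, h5]
  module

end Concrete

/-! ### Components of the forms of a given degree -/

section Components

variable {R M : Type*} [CommRing R] [AddCommGroup M] [Module R M]

variable (R M) in
/-- The series whose coefficients are functions, that is, 0-forms. -/
noncomputable def functions : Submodule R (Form R M) := seriesIn R M fun _ _ => ⋀[R]^0 M

theorem mem_functions {f : Form R M} :
    f ∈ functions R M ↔ ∀ d, MvPowerSeries.coeff d f ∈ ⋀[R]^0 M := Iff.rfl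

theorem algebraMap_mem_exteriorPower_zero (r : R) :
    algebraMap R (ExteriorAlgebra R M) r ∈ ⋀[R]^0 M := by
  rw [ExteriorAlgebra.exteriorPower, pow_zero]
  exact Submodule.algebraMap_mem r

theorem mulVar_mem_functions (i : Var) {f : Form R M} (hf : f ∈ functions R M) :
    mulVar i f ∈ functions R M := fun d => by
  rw [coeff_mulVar]
  split_ifs
  · exact hf _
  · exact zero_mem _

theorem partialY_mem_functions (i : Var) {f : Form R M} (hf : f ∈ functions R M) :
    partialY i f ∈ functions R M := fun _ => Submodule.smul_mem _ _ (hf _)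

variable [Algebra ℂ R] (h : Module.Basis (Fin 2 × Fin 2) R M)

theorem y_mem_functions (α : Fin 2) {f : Form R M} (hf : f ∈ functions R M) :
    y α f ∈ functions R M := mulVar_mem_functions _ hf

theorem ybar_mem_functions (α : Fin 2) {f : Form R M} (hf : f ∈ functions R M) :
    ybar α f ∈ functions R M := mulVar_mem_functions _ hf

theorem p_mem_functions (α : Fin 2) {f : Form R M} (hf : f ∈ functions R M) :
    p α f ∈ functions R M := by
  simp only [p, LinearMap.sum_apply, LinearMap.smul_apply]
  exact sum_mem fun β _ => Submodule.smul_mem _ _ (partialY_mem_functions _ hf)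

theorem pbar_mem_functions (α : Fin 2) {f : Form R M} (hf : f ∈ functions R M) :
    pbar α f ∈ functions R M := by
  simp only [pbar, LinearMap.sum_apply, LinearMap.smul_apply]
  exact sum_mem fun β _ => Submodule.smul_mem _ _ (partialY_mem_functions _ hf)

theorem numFun_mem_functions (φ : ℤ → ℤ → ℂ) {f : Form R M} (hf : f ∈ functions R M) :
    numFun φ f ∈ functions R M := fun _ => Submodule.smul_mem _ _ (hf _)

theorem range_ι_eq_span : LinearMap.range (ExteriorAlgebra.ι R : M →ₗ[R] ExteriorAlgebra R M) =
    Submodule.span R {h1 h 0 0, h1 h 0 1, h1 h 1 0, h1 h 1 1} := by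
  rw [LinearMap.range_eq_map, ← h.span_eq, Submodule.map_span]
  congr 1
  ext x
  simp [h1, eq_comm, or_assoc]

theorem span_mul_span_le {A : Type*} [Ring A] [Algebra R A] {s t r : Set A}
    (H : ∀ x ∈ s, ∀ z ∈ t, x * z ∈ Submodule.span R r) :
    Submodule.span R s * Submodule.span R t ≤ Submodule.span R r := by
  rw [Submodule.span_mul_span, Submodule.span_le]
  rintro _ ⟨x, hx, z, hz, rfl⟩
  exact H x hx z hz

/-- The rules bringing a product of vierbein 1-forms into the order `00`, `01`, `10`, `11`. -/
theorem h1_ordering : (h1 h 0 1 * h1 h 0 0 = -(h1 h 0 0 * h1 h 0 1)) ∧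
    (h1 h 1 0 * h1 h 0 0 = -(h1 h 0 0 * h1 h 1 0)) ∧
    (h1 h 1 1 * h1 h 0 0 = -(h1 h 0 0 * h1 h 1 1)) ∧
    (h1 h 1 0 * h1 h 0 1 = -(h1 h 0 1 * h1 h 1 0)) ∧
    (h1 h 1 1 * h1 h 0 1 = -(h1 h 0 1 * h1 h 1 1)) ∧
    (h1 h 1 1 * h1 h 1 0 = -(h1 h 1 0 * h1 h 1 1)) :=
  ⟨h1_mul_comm h _ _ _ _, h1_mul_comm h _ _ _ _, h1_mul_comm h _ _ _ _, h1_mul_comm h _ _ _ _,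
    h1_mul_comm h _ _ _ _, h1_mul_comm h _ _ _ _⟩

theorem h1_mul_self_mul (α α' : Fin 2) (x : ExteriorAlgebra R M) :
    h1 h α α' * (h1 h α α' * x) = 0 := by
  rw [← mul_assoc, h1_mul_self, zero_mul]

theorem h1_ordering_mul (x : ExteriorAlgebra R M) :
    (h1 h 0 1 * (h1 h 0 0 * x) = -(h1 h 0 0 * (h1 h 0 1 * x))) ∧
    (h1 h 1 0 * (h1 h 0 0 * x) = -(h1 h 0 0 * (h1 h 1 0 * x))) ∧
    (h1 h 1 1 * (h1 h 0 0 * x) = -(h1 h 0 0 * (h1 h 1 1 * x))) ∧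
    (h1 h 1 0 * (h1 h 0 1 * x) = -(h1 h 0 1 * (h1 h 1 0 * x))) ∧
    (h1 h 1 1 * (h1 h 0 1 * x) = -(h1 h 0 1 * (h1 h 1 1 * x))) ∧
    (h1 h 1 1 * (h1 h 1 0 * x) = -(h1 h 1 0 * (h1 h 1 1 * x))) := by
  obtain ⟨e1, e2, e3, e4, e5, e6⟩ := h1_ordering h
  simp only [← mul_assoc, e1, e2, e3, e4, e5, e6, neg_mul, and_self]

theorem exteriorPower_two_le : ⋀[R]^2 M ≤ Submodule.span R
    {h1 h 0 0 * h1 h 0 1, h1 h 1 0 * h1 h 1 1, h1 h 0 0 * h1 h 1 1, h1 h 0 1 * h1 h 1 0,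
      h1 h 0 0 * h1 h 1 0, h1 h 0 1 * h1 h 1 1} := by
  rw [ExteriorAlgebra.exteriorPower, pow_two, range_ι_eq_span h]
  obtain ⟨e1, e2, e3, e4, e5, e6⟩ := h1_ordering h
  refine span_mul_span_le fun x hx z hz => ?_
  simp only [Set.mem_insert_iff, Set.mem_singleton_iff] at hx hz
  rcases hx with rfl | rfl | rfl | rfl <;> rcases hz with rfl | rfl | rfl | rfl
  all_goals
    try simp only [e1, e2, e3, e4, e5, e6, h1_mul_self, zero_mem, neg_mem_iff]
  all_goals exact Submodule.subset_span (by simp)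

theorem exteriorPower_three_le : ⋀[R]^3 M ≤ Submodule.span R
    {h1 h 0 0 * (h1 h 0 1 * h1 h 1 0), h1 h 0 0 * (h1 h 0 1 * h1 h 1 1),
      h1 h 0 0 * (h1 h 1 0 * h1 h 1 1), h1 h 0 1 * (h1 h 1 0 * h1 h 1 1)} := by
  rw [ExteriorAlgebra.exteriorPower, pow_succ']
  refine (mul_le_mul' le_rfl (exteriorPower_two_le h)).trans ?_
  rw [range_ι_eq_span h]
  obtain ⟨e1, e2, e3, e4, e5, e6⟩ := h1_ordering h
  have E := h1_ordering_mul h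
  simp only [forall_and] at E
  obtain ⟨E1, E2, E3, E4, E5, E6⟩ := E
  refine span_mul_span_le fun x hx z hz => ?_
  simp only [Set.mem_insert_iff, Set.mem_singleton_iff] at hx hz
  rcases hx with rfl | rfl | rfl | rfl <;> rcases hz with rfl | rfl | rfl | rfl | rfl | rfl
  all_goals
    try simp only [e1, e2, e3, e4, e5, e6, E1, E2, E3, E4, E5, E6, h1_mul_self, h1_mul_self_mul,
      zero_mem, neg_mem_iff, mul_neg, neg_neg, mul_zero, neg_zero]
  all_goals exact Submodule.subset_span (by simp)

theorem exteriorPower_four_le : ⋀[R]^4 M ≤ Submodule.span R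
    {h1 h 0 0 * (h1 h 0 1 * (h1 h 1 0 * h1 h 1 1))} := by
  rw [ExteriorAlgebra.exteriorPower, pow_succ']
  refine (mul_le_mul' le_rfl (exteriorPower_three_le h)).trans ?_
  rw [range_ι_eq_span h]
  obtain ⟨e1, e2, e3, e4, e5, e6⟩ := h1_ordering h
  have E := h1_ordering_mul h
  simp only [forall_and] at E
  obtain ⟨E1, E2, E3, E4, E5, E6⟩ := E
  refine span_mul_span_le fun x hx z hz => ?_
  simp only [Set.mem_insert_iff, Set.mem_singleton_iff] at hx hz
  rcases hx with rfl | rfl | rfl | rfl <;> rcases hz with rfl | rfl | rfl | rfl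
  all_goals
    try simp only [e1, e2, e3, e4, e5, e6, E1, E2, E3, E4, E5, E6, h1_mul_self, h1_mul_self_mul,
      zero_mem, neg_mem_iff, mul_neg, neg_neg, mul_zero, neg_zero]
  all_goals exact Submodule.subset_span (by simp)

theorem coeff_frame (α α' : Fin 2) (f : Form R M) (d : Var →₀ ℕ) :
    MvPowerSeries.coeff d (frame h α α' f) = h1 h α α' * MvPowerSeries.coeff d f :=
  coeff_wedge _ _ _

/-- The series with given scalar coefficients. -/
noncomputable def ofScalars (r : (Var →₀ ℕ) → R) : Form R M :=
  fun d => algebraMap R (ExteriorAlgebra R M) (r d)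

theorem coeff_ofScalars (r : (Var →₀ ℕ) → R) (d : Var →₀ ℕ) :
    MvPowerSeries.coeff d (ofScalars r : Form R M) = algebraMap R (ExteriorAlgebra R M) (r d) := rfl

theorem ofScalars_mem (r : (Var →₀ ℕ) → R) : (ofScalars r : Form R M) ∈ functions R M :=
  fun d => algebraMap_mem_exteriorPower_zero (r d)

theorem exists_form2_eq {f : Form R M} (hf : ∀ d, MvPowerSeries.coeff d f ∈ ⋀[R]^2 M) :
    ∃ A B, (∀ i, A i ∈ functions R M) ∧ (∀ i, B i ∈ functions R M) ∧ form2 h A B = f := by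
  have H := fun d => exteriorPower_two_le h (hf d)
  simp only [Submodule.mem_span_insert, Submodule.mem_span_singleton] at H
  choose r₁ z₁ H₁ e₁ using H
  choose r₂ z₂ H₂ e₂ using H₁
  choose r₃ z₃ H₃ e₃ using H₂
  choose r₄ z₄ H₄ e₄ using H₃
  choose r₅ z₅ H₅ e₅ using H₄
  choose r₆ e₆ using H₅
  refine ⟨![ofScalars r₁, cst R (1 / 2) • (ofScalars r₃ - ofScalars r₄), ofScalars r₂],
    ![ofScalars r₅, cst R (1 / 2) • (ofScalars r₃ + ofScalars r₄), ofScalars r₆], ?_, ?_, ?_⟩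
  · intro i
    fin_cases i
    · exact ofScalars_mem _
    · exact Submodule.smul_mem _ _ (sub_mem (ofScalars_mem _) (ofScalars_mem _))
    · exact ofScalars_mem _
  · intro i
    fin_cases i
    · exact ofScalars_mem _
    · exact Submodule.smul_mem _ _ (add_mem (ofScalars_mem _) (ofScalars_mem _))
    · exact ofScalars_mem _
  · refine form_ext fun d => ?_
    rw [e₁, e₂, e₃, e₄, e₅, ← e₆, ← cst_half_smul_add (R := R) (h1 h 0 0 * h1 h 1 1),
      ← cst_half_smul_add (R := R) (h1 h 0 1 * h1 h 1 0)]
    simp only [form2, Matrix.cons_val, map_add, map_sub, coeff_frame, coeff_smul', coeff_ofScalars,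
      Algebra.algebraMap_eq_smul_one, mul_smul_comm, mul_one, mul_add, mul_sub]
    module

theorem exists_form3_eq {f : Form R M} (hf : ∀ d, MvPowerSeries.coeff d f ∈ ⋀[R]^3 M) :
    ∃ W, (∀ α α', W α α' ∈ functions R M) ∧ form3 h W = f := by
  have H := fun d => exteriorPower_three_le h (hf d)
  simp only [Submodule.mem_span_insert, Submodule.mem_span_singleton] at H
  choose r₁ z₁ H₁ e₁ using H
  choose r₂ z₂ H₂ e₂ using H₁
  choose r₃ z₃ H₃ e₃ using H₂
  choose r₄ e₄ using H₃
  refine ⟨![![ofScalars r₁, ofScalars r₂], ![-ofScalars r₃, -ofScalars r₄]], ?_, ?_⟩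
  · intro α α'
    fin_cases α <;> fin_cases α'
    · exact ofScalars_mem _
    · exact ofScalars_mem _
    · exact neg_mem (ofScalars_mem _)
    · exact neg_mem (ofScalars_mem _)
  · refine form_ext fun d => ?_
    rw [e₁, e₂, e₃, ← e₄]
    simp only [form3, Matrix.cons_val, map_add, map_sub, map_neg, coeff_frame, coeff_ofScalars,
      Algebra.algebraMap_eq_smul_one, mul_smul_comm, mul_one]
    module

theorem exists_form4_eq {f : Form R M} (hf : ∀ d, MvPowerSeries.coeff d f ∈ ⋀[R]^4 M) :
    ∃ g ∈ functions R M, form4 h g = f := by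
  have H := fun d => exteriorPower_four_le h (hf d)
  simp only [Submodule.mem_span_singleton] at H
  choose r e using H
  refine ⟨ofScalars r, ofScalars_mem r, form_ext fun d => ?_⟩
  rw [← e]
  simp only [form4, coeff_frame, coeff_ofScalars, Algebra.algebraMap_eq_smul_one, mul_smul_comm,
    mul_one]

/-- The determinant of the vierbein shows that its volume form has no annihilator. -/
theorem eq_zero_of_smul_volume_eq_zero {r : R}
    (hr : r • (h1 h 0 0 * (h1 h 0 1 * (h1 h 1 0 * h1 h 1 1))) = 0) : r = 0 := by
  let e : Fin 2 × Fin 2 ≃ Fin 4 := finProdFinEquiv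
  let b := h.reindex e
  let D : ∀ i, M [⋀^Fin i]→ₗ[R] R := Pi.single 4 b.det
  have hD := congrArg (ExteriorAlgebra.liftAlternating D) hr
  have hv : h1 h 0 0 * (h1 h 0 1 * (h1 h 1 0 * h1 h 1 1)) = ExteriorAlgebra.ιMulti R 4 b := by
    rw [ExteriorAlgebra.ιMulti_apply]
    have e0 : e.symm 0 = (0, 0) := rfl
    have e1 : e.symm 1 = (0, 1) := rfl
    have e2 : e.symm 2 = (1, 0) := rfl
    have e3 : e.symm 3 = (1, 1) := rfl
    simp [List.ofFn_succ, b, h1, e0, e1, e2, e3]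
  rw [hv, map_smul, ExteriorAlgebra.liftAlternating_apply_ιMulti] at hD
  simpa [D, b.det_self] using hD

theorem eq_zero_of_form4_eq_zero {g : Form R M} (hg : g ∈ functions R M) (H : form4 h g = 0) :
    g = 0 := by
  refine form_ext fun d => ?_
  have hd : MvPowerSeries.coeff d g ∈ (1 : Submodule R (ExteriorAlgebra R M)) := by
    simpa [ExteriorAlgebra.exteriorPower] using hg d
  obtain ⟨r, hr⟩ := Submodule.mem_one.mp hd
  have := congrArg (MvPowerSeries.coeff d) H
  simp only [form4, coeff_frame, ← hr, Algebra.algebraMap_eq_smul_one, mul_smul_comm, mul_one,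
    map_zero] at this
  rw [← hr, eq_zero_of_smul_volume_eq_zero h this, map_zero, map_zero]

theorem eq_zero_of_form3_eq_zero {W : Fin 2 → Fin 2 → Form R M}
    (hW : ∀ α α', W α α' ∈ functions R M) (H : form3 h W = 0) (α α' : Fin 2) : W α α' = 0 := by
  have key : ∀ β β', frame h β β' (form3 h W) = 0 := fun β β' => by rw [H, map_zero]
  have h00 : form4 h (W 0 0) = 0 := by simpa [form3, form4, frame_self, frame_01_00,
    frame_10_00, frame_11_00, frame_10_01, frame_11_01, frame_11_10] using key 1 1
  have h01 : form4 h (W 0 1) = 0 := by simpa [form3, form4, frame_self, frame_01_00,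
    frame_10_00, frame_11_00, frame_10_01, frame_11_01, frame_11_10] using key 1 0
  have h10 : form4 h (W 1 0) = 0 := by simpa [form3, form4, frame_self, frame_01_00,
    frame_10_00, frame_11_00, frame_10_01, frame_11_01, frame_11_10] using key 0 1
  have h11 : form4 h (W 1 1) = 0 := by simpa [form3, form4, frame_self, frame_01_00,
    frame_10_00, frame_11_00, frame_10_01, frame_11_01, frame_11_10] using key 0 0
  refine eq_zero_of_form4_eq_zero h (hW α α') ?_
  fin_cases α <;> fin_cases α'
  exacts [h00, h01, h10, h11]

end Components

/-! ### Form degree, spin, and projections -/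

section Projections

variable {R M : Type*} [CommRing R] [AddCommGroup M] [Module R M]

variable (R M) in
/-- The projection of differential forms onto their part of degree `q`. -/
noncomputable def degreeProj (q : ℕ) : End R (ExteriorAlgebra R M) :=
  GradedAlgebra.proj (fun i : ℕ => ⋀[R]^i M) q

theorem degreeProj_mem (q : ℕ) (x : ExteriorAlgebra R M) : degreeProj R M q x ∈ ⋀[R]^q M :=
  (DirectSum.decompose (fun i : ℕ => ⋀[R]^i M) x q).2

theorem degreeProj_of_mem {q : ℕ} {x : ExteriorAlgebra R M} (hx : x ∈ ⋀[R]^q M) :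
    degreeProj R M q x = x :=
  DirectSum.decompose_of_mem_same (fun i : ℕ => ⋀[R]^i M) hx

theorem degreeProj_mulLeft {k : ℕ} {ω : ExteriorAlgebra R M} (hω : ω ∈ ⋀[R]^k M) (q : ℕ) :
    degreeProj R M (k + q) * LinearMap.mulLeft R ω =
      LinearMap.mulLeft R ω * degreeProj R M q := by
  refine LinearMap.ext fun x => ?_
  exact DirectSum.coe_decompose_mul_add_of_left_mem (fun i : ℕ => ⋀[R]^i M) hω

variable [Algebra ℂ R]

/-- The components of the spinor `u` shift the bidegree in `(y, ȳ)` by `(a, b)`. -/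
def HasShift (u : Spinor R M) (a b : ℤ) : Prop :=
  ∀ (L : ℤ → ℤ → End R (ExteriorAlgebra R M)) (α : Fin 2),
    coeffMap L * u α = u α * coeffMap fun m n => L (m + a) (n + b)

theorem hasShift_y : HasShift (R := R) (M := M) y 1 0 := fun L α => by
  simpa only [add_zero] using coeffMap_y L α

theorem hasShift_ybar : HasShift (R := R) (M := M) ybar 0 1 := fun L α => by
  simpa only [add_zero] using coeffMap_ybar L α

theorem hasShift_p : HasShift (R := R) (M := M) p (-1) 0 := fun L α => by
  simpa only [add_zero, sub_eq_add_neg] using coeffMap_p L α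

theorem hasShift_pbar : HasShift (R := R) (M := M) pbar 0 (-1) := fun L α => by
  simpa only [add_zero, sub_eq_add_neg] using coeffMap_pbar L α

theorem coeffMap_contract {u v : Spinor R M} {a b a' b' : ℤ} (hu : HasShift u a b)
    (hv : HasShift v a' b') (wu : ∀ ω α, u α * wedge ω = wedge ω * u α)
    (wv : ∀ ω α, v α * wedge ω = wedge ω * v α) {T : Fin 2 → Fin 2 → ExteriorAlgebra R M}
    {L L' : ℤ → ℤ → End R (ExteriorAlgebra R M)}
    (hL : ∀ (m n : ℕ) α β, L (m + a' + a) (n + b' + b) * LinearMap.mulLeft R (T α β) =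
      LinearMap.mulLeft R (T α β) * L' m n) :
    coeffMap L * contract T u v = contract T u v * coeffMap L' := by
  simp only [contract, Finset.mul_sum, Finset.sum_mul]
  refine Finset.sum_congr rfl fun α _ => Finset.sum_congr rfl fun β _ => ?_
  rw [← wu, mul_assoc (u α), ← wv, ← mul_assoc, ← mul_assoc, hu, mul_assoc (u α), hv, mul_assoc,
    mul_assoc, coeffMap_wedge, mul_assoc, mul_assoc, wedge_coeffMap]
  congr 2
  exact coeffMap_congr fun m n => hL m n α β

theorem numFun_contract {u v : Spinor R M} {a b a' b' : ℤ} (hu : HasShift u a b)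
    (hv : HasShift v a' b') (wu : ∀ ω α, u α * wedge ω = wedge ω * u α)
    (wv : ∀ ω α, v α * wedge ω = wedge ω * v α) (T : Fin 2 → Fin 2 → ExteriorAlgebra R M)
    (φ : ℤ → ℤ → ℂ) (f : Form R M) :
    numFun φ (contract T u v f) =
      contract T u v (numFun (fun m n => φ (m + a' + a) (n + b' + b)) f) := by
  have := coeffMap_contract hu hv wu wv (T := T) (L := fun m n => cst R (φ m n) • 1)
    (L' := fun m n => cst R (φ (m + a' + a) (n + b' + b)) • 1) fun m n α β => by
      rw [smul_mul_assoc, mul_smul_comm, one_mul, mul_one]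
  exact congrArg (fun E : End R (Form R M) => E f) this

variable (h : Module.Basis (Fin 2 × Fin 2) R M) (η : ℂ)

theorem h1_mem (α α' : Fin 2) : h1 h α α' ∈ ⋀[R]^1 M := by
  rw [ExteriorAlgebra.exteriorPower, pow_one]
  exact LinearMap.mem_range_self _ _

theorem mul_mem_exteriorPower {i j : ℕ} {a b : ExteriorAlgebra R M} (ha : a ∈ ⋀[R]^i M)
    (hb : b ∈ ⋀[R]^j M) : a * b ∈ ⋀[R]^(i + j) M := by
  rw [ExteriorAlgebra.exteriorPower, pow_add]
  exact Submodule.mul_mem_mul ha hb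

theorem H2_mem (α β : Fin 2) : H2 h α β ∈ ⋀[R]^2 M :=
  sum_mem fun _ _ => sum_mem fun _ _ =>
    Submodule.smul_mem _ _ (mul_mem_exteriorPower (h1_mem h _ _) (h1_mem h _ _))

theorem Hbar2_mem (α β : Fin 2) : Hbar2 h α β ∈ ⋀[R]^2 M :=
  sum_mem fun _ _ => sum_mem fun _ _ =>
    Submodule.smul_mem _ _ (mul_mem_exteriorPower (h1_mem h _ _) (h1_mem h _ _))

theorem H3_mem (α β : Fin 2) : H3 h α β ∈ ⋀[R]^3 M :=
  sum_mem fun _ _ => sum_mem fun _ _ =>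
    Submodule.smul_mem _ _ (mul_mem_exteriorPower (h1_mem h _ _) (Hbar2_mem h _ _))

theorem numFun_hOp_p_ybar (φ : ℤ → ℤ → ℂ) (f : Form R M) :
    numFun φ (hOp h p ybar f) = hOp h p ybar (numFun (fun m n => φ (m - 1) (n + 1)) f) := by
  simpa only [hOp, add_zero, ← sub_eq_add_neg] using
    numFun_contract hasShift_p hasShift_ybar p_wedge ybar_wedge (h1 h) φ f

theorem numFun_hOp_y_pbar (φ : ℤ → ℤ → ℂ) (f : Form R M) :
    numFun φ (hOp h y pbar f) = hOp h y pbar (numFun (fun m n => φ (m + 1) (n - 1)) f) := by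
  simpa only [hOp, add_zero, ← sub_eq_add_neg] using
    numFun_contract hasShift_y hasShift_pbar y_wedge pbar_wedge (h1 h) φ f

theorem numFun_hOp_p_pbar (φ : ℤ → ℤ → ℂ) (f : Form R M) :
    numFun φ (hOp h p pbar f) = hOp h p pbar (numFun (fun m n => φ (m - 1) (n - 1)) f) := by
  simpa only [hOp, add_zero, ← sub_eq_add_neg] using
    numFun_contract hasShift_p hasShift_pbar p_wedge pbar_wedge (h1 h) φ f

theorem numFun_HOp_p (φ : ℤ → ℤ → ℂ) (f : Form R M) :
    numFun φ (HOp h p p f) = HOp h p p (numFun (fun m n => φ (m - 2) n) f) := by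
  have := numFun_contract hasShift_p hasShift_p p_wedge p_wedge (H2 h) φ f
  simp only [HOp, LinearMap.smul_apply, map_smul, this]
  congr 2
  exact numFun_apply_congr (fun m n => by ring_nf) f

theorem numFun_HbarOp_pbar (φ : ℤ → ℤ → ℂ) (f : Form R M) :
    numFun φ (HbarOp h pbar pbar f) =
      HbarOp h pbar pbar (numFun (fun m n => φ m (n - 2)) f) := by
  have := numFun_contract hasShift_pbar hasShift_pbar pbar_wedge pbar_wedge (Hbar2 h) φ f
  simp only [HbarOp, LinearMap.smul_apply, map_smul, this]
  congr 2
  exact numFun_apply_congr (fun m n => by ring_nf) f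

theorem numFun_HOp_y (φ : ℤ → ℤ → ℂ) (f : Form R M) :
    numFun φ (HOp h y y f) = HOp h y y (numFun (fun m n => φ (m + 2) n) f) := by
  have := numFun_contract hasShift_y hasShift_y y_wedge y_wedge (H2 h) φ f
  simp only [HOp, LinearMap.smul_apply, map_smul, this]
  congr 2

theorem numFun_HbarOp_ybar (φ : ℤ → ℤ → ℂ) (f : Form R M) :
    numFun φ (HbarOp h ybar ybar f) =
      HbarOp h ybar ybar (numFun (fun m n => φ m (n + 2)) f) := by
  have := numFun_contract hasShift_ybar hasShift_ybar ybar_wedge ybar_wedge (Hbar2 h) φ f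
  simp only [HbarOp, LinearMap.smul_apply, map_smul, this]
  congr 2

variable (R M) in
/-- The projection onto the `ω` sector of form degree `q` and spin `t / 2`. -/
noncomputable def projOmega (q t : ℕ) : End R (Form R M) :=
  coeffMap fun m n => if m + n + 2 = t then degreeProj R M q else 0

variable (R M) in
/-- The projection onto the `C` sector of form degree `q` and spin `t / 2`. -/
noncomputable def projC (q t : ℕ) : End R (Form R M) :=
  coeffMap fun m n => if |m - n| = t then degreeProj R M q else 0

theorem projOmega_projOmega (q t : ℕ) (f : Form R M) :
    projOmega R M q t (projOmega R M q t f) = projOmega R M q t f := by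
  refine form_ext fun d => ?_
  simp only [projOmega, coeff_coeffMap]
  split_ifs
  · exact degreeProj_of_mem (degreeProj_mem _ _)
  · rfl

theorem projC_projC (q t : ℕ) (f : Form R M) :
    projC R M q t (projC R M q t f) = projC R M q t f := by
  refine form_ext fun d => ?_
  simp only [projC, coeff_coeffMap]
  split_ifs
  · exact degreeProj_of_mem (degreeProj_mem _ _)
  · rfl

theorem projOmega_sigmaOmegaOmega (q t : ℕ) :
    projOmega R M (1 + q) t * sigmaOmegaOmega h = sigmaOmegaOmega h * projOmega R M q t := by
  have e1 : projOmega R M (1 + q) t * hOp h p ybar = hOp h p ybar * projOmega R M q t :=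
    coeffMap_contract hasShift_p hasShift_ybar p_wedge ybar_wedge fun m n α β => by
      rw [show ((m : ℤ) + 0 + -1) + (n + 1 + 0) + 2 = m + n + 2 by ring]
      split_ifs
      · exact degreeProj_mulLeft (h1_mem h _ _) q
      · simp
  have e2 : projOmega R M (1 + q) t * hOp h y pbar = hOp h y pbar * projOmega R M q t :=
    coeffMap_contract hasShift_y hasShift_pbar y_wedge pbar_wedge fun m n α β => by
      rw [show ((m : ℤ) + 0 + 1) + (n + -1 + 0) + 2 = m + n + 2 by ring]
      split_ifs
      · exact degreeProj_mulLeft (h1_mem h _ _) q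
      · simp
  have e3 : ∀ φ, projOmega R M q t * numFun φ = numFun φ * projOmega R M q t := fun φ => by
    rw [projOmega, numFun_eq_coeffMap, coeffMap_mul, coeffMap_mul]
    exact coeffMap_congr fun m n => by simp
  rw [sigmaOmegaOmega, mul_smul_comm, smul_mul_assoc, mul_add, add_mul, ← mul_assoc, ← mul_assoc,
    e1, e2, mul_assoc, mul_assoc, e3, e3, mul_assoc, mul_assoc]

theorem projC_sigmaCC (q t : ℕ) :
    projC R M (1 + q) t * sigmaCC h = sigmaCC h * projC R M q t := by
  have e1 : projC R M (1 + q) t * hOp h p pbar = hOp h p pbar * projC R M q t :=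
    coeffMap_contract hasShift_p hasShift_pbar p_wedge pbar_wedge fun m n α β => by
      rw [show ((m : ℤ) + 0 + -1) - (n + -1 + 0) = m - n by ring]
      split_ifs
      · exact degreeProj_mulLeft (h1_mem h _ _) q
      · simp
  rw [sigmaCC, mul_smul_comm, smul_mul_assoc, e1]

theorem projOmega_sigmaOmegaC (q t : ℕ) :
    projOmega R M (2 + q) t * sigmaOmegaC h η = sigmaOmegaC h η * projC R M q t := by
  let L : ℤ → ℤ → End R (ExteriorAlgebra R M) := fun m n =>
    if m + n = t then degreeProj R M q else 0
  have e1 : projOmega R M (2 + q) t * HOp h p p = HOp h p p * coeffMap L := by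
    rw [HOp, mul_smul_comm, smul_mul_assoc]
    congr 1
    refine coeffMap_contract hasShift_p hasShift_p p_wedge p_wedge fun m n α β => ?_
    simp only [L, show ((m : ℤ) + -1 + -1) + (n + 0 + 0) + 2 = m + n by ring]
    split_ifs
    · exact degreeProj_mulLeft (H2_mem h _ _) q
    · simp
  have e2 : projOmega R M (2 + q) t * HbarOp h pbar pbar = HbarOp h pbar pbar * coeffMap L := by
    rw [HbarOp, mul_smul_comm, smul_mul_assoc]
    congr 1
    refine coeffMap_contract hasShift_pbar hasShift_pbar pbar_wedge pbar_wedge fun m n α β => ?_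
    simp only [L, show ((m : ℤ) + 0 + 0) + (n + -1 + -1) + 2 = m + n by ring]
    split_ifs
    · exact degreeProj_mulLeft (Hbar2_mem h _ _) q
    · simp
  have e3 : coeffMap L * numFun (fun _ n => delta0 n) =
      numFun (fun _ n => delta0 n) * projC R M q t := by
    rw [projC, numFun_eq_coeffMap, coeffMap_mul, coeffMap_mul]
    refine coeffMap_congr fun m n => ?_
    rcases eq_or_ne n 0 with rfl | hn
    · simp [L, delta0]
    · simp [L, delta0, hn, cst_zero]
  have e4 : coeffMap L * numFun (fun m _ => delta0 m) =
      numFun (fun m _ => delta0 m) * projC R M q t := by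
    rw [projC, numFun_eq_coeffMap, coeffMap_mul, coeffMap_mul]
    refine coeffMap_congr fun m n => ?_
    rcases eq_or_ne m 0 with rfl | hm
    · simp [L, delta0]
    · simp [L, delta0, hm, cst_zero]
  rw [sigmaOmegaC, mul_add, add_mul, mul_smul_comm, mul_smul_comm, smul_mul_assoc, smul_mul_assoc,
    ← mul_assoc, ← mul_assoc, e1, e2, mul_assoc, mul_assoc, e3, e4, mul_assoc, mul_assoc]

theorem mem_rankOne {q t : ℕ} {w : Form R M × Form R M} :
    w ∈ rankOne R M (q + 1) t ↔ projOmega R M (q + 1) t w.1 = w.1 ∧ projC R M q t w.2 = w.2 := by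
  have key : ∀ (c : ℤ → ℤ → Prop) [∀ m n, Decidable (c m n)] (r : ℕ) (f : Form R M),
      (∀ d, MvPowerSeries.coeff d f ∈
        if c (degY d) (degYbar d) then ⋀[R]^r M else (⊥ : Submodule R (ExteriorAlgebra R M))) ↔
      coeffMap (fun m n => if c m n then degreeProj R M r else 0) f = f := by
    intro c _ r f
    constructor
    · refine fun H => form_ext fun d => ?_
      have hd := H d
      rw [coeff_coeffMap]
      split_ifs at hd ⊢
      · exact degreeProj_of_mem hd
      · rw [(Submodule.mem_bot R).mp hd, map_zero]
    · intro H d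
      rw [← H, coeff_coeffMap]
      split_ifs
      · exact degreeProj_mem _ _
      · simp
  rw [projOmega, projC, ← key (fun m n => m + n + 2 = t), ← key (fun m n => |m - n| = t), rankOne,
    Submodule.mem_prod]
  refine and_congr (forall_congr' fun d => ?_) Iff.rfl
  have : ((degY d : ℤ) + degYbar d + 2 = t) ↔ (degY d + degYbar d + 2 = t) := by
    exact_mod_cast Iff.rfl
  simp only [this]

theorem sigmaMinus_apply (w : Form R M × Form R M) :
    sigmaMinus h η w =
      (sigmaOmegaOmega h w.1 + sigmaOmegaC h η w.2, sigmaCC h w.2) := rfl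

/-- A field of rank one that is exact among all pairs of series is exact among the fields of its
own form degree and spin. -/
theorem mem_coboundaries {q t : ℕ} {w : Form R M × Form R M} (hw : w ∈ rankOne R M (q + 2) t)
    (H : ∃ w', sigmaMinus h η w' = w) : w ∈ coboundaries h η (q + 2) t := by
  obtain ⟨w', rfl⟩ := H
  refine ⟨(projOmega R M (q + 1) t w'.1, projC R M q t w'.2),
    mem_rankOne.mpr ⟨projOmega_projOmega _ _ _, projC_projC _ _ _⟩, ?_⟩
  obtain ⟨hw1, hw2⟩ := mem_rankOne.mp hw
  have e1 := congrArg (fun E : End R (Form R M) => E w'.1)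
    (projOmega_sigmaOmegaOmega h (q + 1) t)
  have e2 := congrArg (fun E : End R (Form R M) => E w'.2) (projOmega_sigmaOmegaC h η q t)
  have e3 := congrArg (fun E : End R (Form R M) => E w'.2) (projC_sigmaCC h q t)
  rw [add_comm 1] at e1 e3
  rw [add_comm 2] at e2
  simp only [Module.End.mul_apply] at e1 e2 e3
  simp only [sigmaMinus_apply, map_add] at hw1 hw2 ⊢
  rw [← e1, ← e2, ← e3, hw1, hw2]

end Projections

/-! ### Exactness at the 3-forms, and values on the representatives -/

section Exact

variable {R M : Type*} [CommRing R] [Algebra ℂ R] [AddCommGroup M] [Module R M]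
variable (h : Module.Basis (Fin 2 × Fin 2) R M)

theorem numFun_frame (φ : ℤ → ℤ → ℂ) (α α' : Fin 2) (f : Form R M) :
    numFun φ (frame h α α' f) = frame h α α' (numFun φ f) :=
  (apply_eq_of_mul_eq (wedge_numFun (h1 h α α') φ) f).symm

theorem numFun_form3 (φ : ℤ → ℤ → ℂ) (W : Fin 2 → Fin 2 → Form R M) :
    numFun φ (form3 h W) = form3 h fun α α' => numFun φ (W α α') := by
  simp only [form3, map_add, map_sub, numFun_frame]

theorem numFun_form4 (φ : ℤ → ℤ → ℂ) (g : Form R M) :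
    numFun φ (form4 h g) = form4 h (numFun φ g) := by
  simp only [form4, numFun_frame]

theorem form3_add (W W' : Fin 2 → Fin 2 → Form R M) :
    form3 h (fun α α' => W α α' + W' α α') = form3 h W + form3 h W' := by
  simp only [form3, map_add]
  abel

theorem form4_add (g g' : Form R M) : form4 h (g + g') = form4 h g + form4 h g' := by
  simp only [form4, map_add]

theorem form4_smul (r : R) (g : Form R M) : form4 h (r • g) = r • form4 h g := by
  simp only [form4, map_smul]

theorem form4_zero : form4 h (0 : Form R M) = 0 := by
  simp only [form4, map_zero]

theorem form4_sub (g g' : Form R M) : form4 h (g - g') = form4 h g - form4 h g' := by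
  simp only [form4, map_sub]

theorem form2_sub (A A' B B' : Fin 3 → Form R M) :
    form2 h (A - A') (B - B') = form2 h A B - form2 h A' B' := by
  simp only [form2, Pi.sub_apply, map_sub]
  abel

theorem div_sub (u : Spinor R M) (A A' : Fin 3 → Form R M) (α : Fin 2) :
    div u (A - A') α = div u A α - div u A' α := by
  fin_cases α <;> simp [div] <;> abel

theorem div_neg (u : Spinor R M) (A : Fin 3 → Form R M) (α : Fin 2) :
    div u (-A) α = -div u A α := by
  fin_cases α <;> simp [div] <;> abel

theorem div_zero (u : Spinor R M) (α : Fin 2) : div u 0 α = 0 := by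
  fin_cases α <;> simp [div]

theorem numFun_y_apply (φ : ℤ → ℤ → ℂ) (α : Fin 2) (x : Form R M) :
    numFun φ (y α x) = y α (numFun (fun m n => φ (m + 1) n) x) :=
  apply_eq_of_mul_eq (numFun_y φ α) x

theorem numFun_ybar_apply (φ : ℤ → ℤ → ℂ) (α : Fin 2) (x : Form R M) :
    numFun φ (ybar α x) = ybar α (numFun (fun m n => φ m (n + 1)) x) :=
  apply_eq_of_mul_eq (numFun_ybar φ α) x

theorem numFun_p_apply (φ : ℤ → ℤ → ℂ) (α : Fin 2) (x : Form R M) :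
    numFun φ (p α x) = p α (numFun (fun m n => φ (m - 1) n) x) :=
  apply_eq_of_mul_eq (numFun_p φ α) x

theorem numFun_pbar_apply (φ : ℤ → ℤ → ℂ) (α : Fin 2) (x : Form R M) :
    numFun φ (pbar α x) = pbar α (numFun (fun m n => φ m (n - 1)) x) :=
  apply_eq_of_mul_eq (numFun_pbar φ α) x

theorem numFun_eq_self {φ : ℤ → ℤ → ℂ} (H : ∀ m n : ℕ, φ m n = 1) (x : Form R M) :
    numFun φ x = x := by
  rw [numFun_apply_congr (ψ := fun _ _ => 1) H, numFun_one, Module.End.one_apply]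

theorem numFun_eq_zero {φ : ℤ → ℤ → ℂ} (H : ∀ m n : ℕ, φ m n = 0) (x : Form R M) :
    numFun φ x = 0 := by
  rw [numFun_apply_congr (ψ := fun _ _ => 0) H, numFun_zero, LinearMap.zero_apply]

/-- Every series without terms of degree zero in `y` is of the form `y_α t^α`. -/
theorem exists_numFun_eq_y (z : Form R M) :
    ∃ t : Fin 2 → Form R M, numFun (fun m _ => 1 - delta0 m) z = y 0 (t 1) - y 1 (t 0) := by
  refine ⟨fun α => p α (numFun (fun m _ => (Complex.I * m)⁻¹) z), ?_⟩
  rw [y_p_antisymm_apply, numFun_numFun]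
  refine numFun_apply_congr (fun m n => ?_) z
  rcases eq_or_ne m 0 with rfl | hm
  · simp [delta0]
  · rw [mul_inv_cancel₀ (by simp [hm])]
    simp [delta0, hm]

/-- Every series without terms of degree zero in `ȳ` is of the form `ȳ_α' t^α'`. -/
theorem exists_numFun_eq_ybar (z : Form R M) :
    ∃ t : Fin 2 → Form R M,
      numFun (fun _ n => 1 - delta0 n) z = ybar 0 (t 1) - ybar 1 (t 0) := by
  refine ⟨fun α => pbar α (numFun (fun _ n => (Complex.I * n)⁻¹) z), ?_⟩
  rw [ybar_pbar_antisymm_apply, numFun_numFun]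
  refine numFun_apply_congr (fun m n => ?_) z
  rcases eq_or_ne n 0 with rfl | hn
  · simp [delta0]
  · rw [mul_inv_cancel₀ (by simp [hn])]
    simp [delta0, hn]

theorem delta0_add_one (m : ℕ) : delta0 ((m : ℤ) + 1) = 0 := by
  simp only [delta0, ite_eq_right_iff]
  omega

theorem delta0_mul_self (k : ℤ) : delta0 k * delta0 k = delta0 k := by
  simp [delta0]

theorem p_eq_zero {x : Form R M} (hx : numFun (fun m _ => delta0 m) x = x) (α : Fin 2) :
    p α x = 0 := by
  have : numFun (fun m _ => delta0 (m + 1)) (p α x) = p α x := by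
    rw [numFun_p_apply]
    simp only [sub_add_cancel, hx]
  rw [← this, numFun_eq_zero fun m n => delta0_add_one m]

theorem pbar_eq_zero {x : Form R M} (hx : numFun (fun _ n => delta0 n) x = x) (α : Fin 2) :
    pbar α x = 0 := by
  have : numFun (fun _ n => delta0 (n + 1)) (pbar α x) = pbar α x := by
    rw [numFun_pbar_apply]
    simp only [sub_add_cancel, hx]
  rw [← this, numFun_eq_zero fun m n => delta0_add_one n]

/-- A series annihilated by all derivatives in `y` is constant in `y`. -/
theorem numFun_delta0_of_p_eq_zero {x : Form R M} (hx : ∀ α, p α x = 0) :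
    numFun (fun m _ => delta0 m) x = x := by
  have h0 : numFun (fun m _ => Complex.I * m) x = 0 := by
    rw [← y_p_antisymm_apply, hx, hx, map_zero, map_zero, sub_zero]
  have h1 := congrArg (numFun fun m _ => (Complex.I * m)⁻¹) h0
  rw [numFun_numFun, map_zero] at h1
  rw [← add_zero (numFun _ x), ← h1, numFun_add_numFun]
  refine numFun_eq_self (fun m n => ?_) x
  rcases eq_or_ne m 0 with rfl | hm
  · simp [delta0]
  · rw [inv_mul_cancel₀ (by simp [hm])]
    simp [delta0, hm]

theorem numFun_delta0_of_pbar_eq_zero {x : Form R M} (hx : ∀ α, pbar α x = 0) :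
    numFun (fun _ n => delta0 n) x = x := by
  have h0 : numFun (fun _ n => Complex.I * n) x = 0 := by
    rw [← ybar_pbar_antisymm_apply, hx, hx, map_zero, map_zero, sub_zero]
  have h1 := congrArg (numFun fun _ n => (Complex.I * n)⁻¹) h0
  rw [numFun_numFun, map_zero] at h1
  rw [← add_zero (numFun _ x), ← h1, numFun_add_numFun]
  refine numFun_eq_self (fun m n => ?_) x
  rcases eq_or_ne n 0 with rfl | hn
  · simp [delta0]
  · rw [inv_mul_cancel₀ (by simp [hn])]
    simp [delta0, hn]

/-- The 3-forms closed under `h(p, p̄)` are exact. -/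
theorem exists_hOp_p_pbar_eq_of_three {C : Form R M}
    (hC : ∀ d, MvPowerSeries.coeff d C ∈ ⋀[R]^3 M) (H : hOp h p pbar C = 0) :
    ∃ C', hOp h p pbar C' = C := by
  obtain ⟨W, hW, rfl⟩ := exists_form3_eq h hC
  rw [hOp_form3 commutingSpinors_p_pbar] at H
  have H' := eq_zero_of_form4_eq_zero h (by
    refine sub_mem (p_mem_functions _ (sub_mem ?_ ?_)) (p_mem_functions _ (sub_mem ?_ ?_)) <;>
      exact pbar_mem_functions _ (hW _ _)) H
  obtain ⟨A, B, l, hAB⟩ := exists_of_closed_three commutingSpinors_p_pbar p_surjective isExact_p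
    isExact_pbar 1 (fun _ _ => rfl) (fun _ _ => rfl) (fun z => by
      obtain ⟨t, ht⟩ := pbar_surjective 0 z
      exact ⟨![0, t], by simp [ht]⟩) H'
  refine ⟨form2 h A B, ?_⟩
  rw [hOp_form2 commutingSpinors_p_pbar]
  congr 1
  funext α α'
  rw [hAB α α', Module.End.one_apply, sub_self, map_zero, add_zero]

/-- The 3-forms closed under `h(p, ȳ)` are exact, up to the image of `H(p, p)`. -/
theorem exists_hOp_p_ybar_eq {ω : Form R M} (hω : ∀ d, MvPowerSeries.coeff d ω ∈ ⋀[R]^3 M)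
    (H : hOp h p ybar ω = 0) :
    ∃ ω' C', hOp h p ybar ω' + HOp h p p C' = ω ∧ numFun (fun _ n => delta0 n) C' = C' := by
  obtain ⟨W, hW, rfl⟩ := exists_form3_eq h hω
  rw [hOp_form3 commutingSpinors_p_ybar] at H
  have H' := eq_zero_of_form4_eq_zero h (by
    refine sub_mem (p_mem_functions _ (sub_mem ?_ ?_)) (p_mem_functions _ (sub_mem ?_ ?_)) <;>
      exact ybar_mem_functions _ (hW _ _)) H
  obtain ⟨A, B, l, hAB⟩ := exists_of_closed_three commutingSpinors_p_ybar p_surjective isExact_p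
    isExact_ybar (numFun fun _ n => 1 - delta0 n) (fun α x => by rw [numFun_p_apply])
    (fun α x => by
      rw [numFun_ybar_apply, numFun_eq_self]
      exact fun m n => by rw [delta0_add_one, sub_zero]) exists_numFun_eq_ybar H'
  choose c hc using fun α' => p_surjective (R := R) (M := M) 0 (l α')
  have hl : ∀ x : Form R M,
      x - numFun (fun _ n => 1 - delta0 n) x = numFun (fun _ n => delta0 n) x := fun x => by
    nth_rw 1 [← numFun_eq_self (φ := fun _ _ => 1) (fun _ _ => rfl) x]
    rw [numFun_sub_numFun]
    exact numFun_apply_congr (fun m n => by ring) x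
  let C : Fin 2 → Fin 2 → Form R M :=
    ![fun _ => 0, fun α' => numFun (fun _ n => delta0 n) (c α')]
  refine ⟨form2 h A B, form1 h C, ?_, ?_⟩
  · rw [hOp_form2 commutingSpinors_p_ybar, HOp_form1 commutingSpinors_p_ybar, ← form3_add]
    congr 1
    funext α α'
    rw [hAB α α', hl]
    simp only [C, Matrix.cons_val, map_zero, sub_zero, ← hc, numFun_p_apply]
  · simp only [form1, map_add, numFun_frame, C, Matrix.cons_val, map_zero, numFun_numFun,
      delta0_mul_self]

/-- The 3-forms closed under `h(y, p̄)` are exact, up to the image of `H̄(p̄, p̄)`. -/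
theorem exists_hOp_y_pbar_eq {ω : Form R M} (hω : ∀ d, MvPowerSeries.coeff d ω ∈ ⋀[R]^3 M)
    (H : hOp h y pbar ω = 0) :
    ∃ ω' C', hOp h y pbar ω' + HbarOp h pbar pbar C' = ω ∧
      numFun (fun m _ => delta0 m) C' = C' := by
  obtain ⟨W, hW, rfl⟩ := exists_form3_eq h hω
  rw [hOp_form3 commutingSpinors_y_pbar] at H
  have H' := eq_zero_of_form4_eq_zero h (by
    refine sub_mem (y_mem_functions _ (sub_mem ?_ ?_)) (y_mem_functions _ (sub_mem ?_ ?_)) <;>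
      exact pbar_mem_functions _ (hW _ _)) H
  obtain ⟨A, B, l, hAB⟩ := exists_of_closed_three commutingSpinors_y_pbar.symm pbar_surjective
    isExact_pbar isExact_y (numFun fun m _ => 1 - delta0 m)
    (fun α x => by rw [numFun_pbar_apply])
    (fun α x => by
      rw [numFun_y_apply, numFun_eq_self]
      exact fun m n => by rw [delta0_add_one, sub_zero]) exists_numFun_eq_y
    (W := fun α α' => W α' α) (by
      simp only [map_sub, apply_eq_of_mul_eq (pbar_y _ _)] at H' ⊢
      rw [← H']
      abel)
  choose c hc using fun α' => pbar_surjective (R := R) (M := M) 0 (l α')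
  have hl : ∀ x : Form R M,
      x - numFun (fun m _ => 1 - delta0 m) x = numFun (fun m _ => delta0 m) x := fun x => by
    nth_rw 1 [← numFun_eq_self (φ := fun _ _ => 1) (fun _ _ => rfl) x]
    rw [numFun_sub_numFun]
    exact numFun_apply_congr (fun m n => by ring) x
  let C : Fin 2 → Fin 2 → Form R M :=
    fun α => ![0, -numFun (fun m _ => delta0 m) (c α)]
  refine ⟨form2 h (-B) (-A), form1 h C, ?_, ?_⟩
  · rw [hOp_form2 commutingSpinors_y_pbar, HbarOp_form1 commutingSpinors_y_pbar, ← form3_add]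
    congr 1
    funext α α'
    rw [hAB α' α, hl]
    simp only [C, Matrix.cons_val, map_zero, sub_zero, ← hc, numFun_pbar_apply, map_neg, div_neg]
    abel
  · simp only [form1, map_add, map_neg, numFun_frame, C, Matrix.cons_val, map_zero, numFun_numFun,
      delta0_mul_self]

/-- The 3-forms without terms of degree zero in `y` are covered by `h(p, ȳ)` and `h(y, p̄)`. -/
theorem exists_hOp_add_hOp_eq {ω : Form R M} (hω : ∀ d, MvPowerSeries.coeff d ω ∈ ⋀[R]^3 M)
    (H : numFun (fun m _ => 1 - delta0 m) ω = ω) :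
    ∃ ω' ω'', hOp h p ybar ω' + hOp h y pbar ω'' = ω := by
  obtain ⟨W, hW, rfl⟩ := exists_form3_eq h hω
  -- `W^α'` is decomposed into its parts `ȳ^α' s` and `p̄^α' s'`
  have hdec : ∀ W : Fin 2 → Form R M, ∃ s s', ∀ α', W α' = ybar α' s + pbar α' s' := by
    intro W
    -- `p̄^α' X - ȳ^α' Z` is an invertible multiple of `W^α'`
    set X := ybar 0 (W 1) - ybar 1 (W 0) with hX
    set Z := pbar 0 (W 1) - pbar 1 (W 0) with hZ
    have key : ∀ α', pbar α' X - ybar α' Z =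
        numFun (fun _ n => Complex.I * (n + 1)) (W α') := by
      have e : ∀ x : Form R M, numFun (fun _ n => Complex.I * (n + 1)) x =
          ybar 0 (pbar 1 x) - ybar 1 (pbar 0 x) + cst R Complex.I • x := fun x => by
        rw [ybar_pbar_antisymm_apply]
        nth_rw 3 [← numFun_eq_self (φ := fun _ _ => 1) (fun _ _ => rfl) x]
        rw [cst_smul_numFun, numFun_add_numFun]
        exact numFun_apply_congr (fun m n => by ring) x
      have h1 : ∀ x : Form R M,
          pbar 0 (ybar 1 x) = ybar 1 (pbar 0 x) - cst R Complex.I • x := fun x => by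
        have := congrArg (fun E : End R (Form R M) => E x) pbar_ybar_zero_one
        simpa only [Module.End.mul_apply, LinearMap.add_apply, LinearMap.smul_apply, cst_neg,
          Module.End.one_apply, neg_smul, ← sub_eq_add_neg] using this
      have h2 : ∀ x : Form R M,
          pbar 1 (ybar 0 x) = ybar 0 (pbar 1 x) + cst R Complex.I • x := fun x =>
        congrArg (fun E : End R (Form R M) => E x) pbar_ybar_one_zero
      have h3 : ∀ α (x : Form R M), pbar α (ybar α x) = ybar α (pbar α x) := fun α =>
        apply_eq_of_mul_eq (pbar_ybar_self α)
      intro α'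
      rw [e, hX, hZ]
      fin_cases α' <;> simp only [Fin.zero_eta, Fin.mk_one, map_sub, h1, h2, h3] <;> abel
    refine ⟨-numFun (fun _ n => (Complex.I * (n + 2))⁻¹) Z,
      numFun (fun _ n => (Complex.I * n)⁻¹) X, fun α' => ?_⟩
    have := congrArg (numFun fun _ n => (Complex.I * (n + 1))⁻¹) (key α')
    rw [numFun_numFun, numFun_eq_self (φ := fun _ _ => _ * _), map_sub, numFun_pbar_apply,
      numFun_ybar_apply] at this
    · rw [← this, map_neg, add_comm, ← sub_eq_add_neg]
      congr 2
      · exact numFun_apply_congr (fun m n => by push_cast; ring_nf) _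
      · exact numFun_apply_congr (fun m n => by push_cast; ring_nf) _
    · intro m n
      have : ((n : ℂ) + 1) ≠ 0 := Nat.cast_add_one_ne_zero n
      exact inv_mul_cancel₀ (by simp [this])
  rw [numFun_form3] at H
  choose s s' hs using fun α => hdec (W α)
  obtain ⟨A, hA⟩ := exists_div_eq p_surjective fun α => numFun (fun m _ => 1 - delta0 m) (s α)
  choose T hT using fun α => exists_numFun_eq_y (s' α)
  obtain ⟨A', B', hAB⟩ := exists_div_sub_div commutingSpinors_y_pbar.symm pbar_surjective 0 T
  refine ⟨form2 h A 0, form2 h (-B') (-A'), ?_⟩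
  rw [← H, hOp_form2 commutingSpinors_p_ybar, hOp_form2 commutingSpinors_y_pbar, ← form3_add]
  congr 1
  funext α α'
  have e := hAB α' α
  rw [← hT, Pi.zero_apply, map_zero, zero_add] at e
  rw [hs, map_add, numFun_ybar_apply, numFun_pbar_apply, e, hA, div_neg, div_neg, div_zero,
    map_zero, map_neg, map_neg]
  abel

/-- The image of `ℋ(y, p̄) g` under `h(p, ȳ)`; the factor vanishes only for degree zero in `ȳ`,
where `ℋ(y, p̄) g = 0`. -/
theorem hOp_p_ybar_H3Op (g : Form R M) :
    hOp h p ybar (H3Op h y pbar g) = form4 h (numFun (fun m n => -3 * (m + 2) * n) g) := by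
  have e : (3 : R) = cst R 3 := (map_ofNat (algebraMap ℂ R) 3).symm
  rw [H3Op_apply, map_smul, hOp_form3 commutingSpinors_p_ybar, ← form4_smul]
  congr 1
  have c : ∀ α β (x : Form R M), ybar α (y β x) = y β (ybar α x) := fun α β =>
    apply_eq_of_mul_eq (ybar_y α β)
  simp only [c]
  rw [← map_sub, ← map_sub, ybar_pbar_antisymm_apply, ← neg_sub, p_y_antisymm_apply, numFun_numFun,
    e, smul_neg, ← neg_smul, ← cst_neg, cst_smul_numFun]
  refine numFun_apply_congr (fun m n => ?_) g
  push_cast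
  linear_combination (3 * (m + 2) * n : ℂ) * Complex.I_mul_I

/-- The image of `ℋ(p, ȳ) g` under `h(y, p̄)`; the factor vanishes only for degree zero in `y`,
where `ℋ(p, ȳ) g = 0`. -/
theorem hOp_y_pbar_H3Op (g : Form R M) :
    hOp h y pbar (H3Op h p ybar g) = form4 h (numFun (fun m n => -3 * m * (n + 2)) g) := by
  have e : (3 : R) = cst R 3 := (map_ofNat (algebraMap ℂ R) 3).symm
  rw [H3Op_apply, map_smul, hOp_form3 commutingSpinors_y_pbar, ← form4_smul]
  congr 1
  have c : ∀ α β (x : Form R M), pbar α (p β x) = p β (pbar α x) := fun α β =>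
    apply_eq_of_mul_eq (pbar_p α β)
  simp only [c]
  rw [← map_sub, ← map_sub, pbar_ybar_antisymm_apply, ← neg_sub, y_p_antisymm_apply, numFun_numFun,
    e, smul_neg, ← neg_smul, ← cst_neg, cst_smul_numFun]
  refine numFun_apply_congr (fun m n => ?_) g
  push_cast
  linear_combination (3 * m * (n + 2) : ℂ) * Complex.I_mul_I

theorem HOp_y_apply (φ : Form R M) :
    HOp h y y φ = form2 h ![y 0 (y 0 φ), y 0 (y 1 φ), y 1 (y 1 φ)] 0 :=
  HOp_apply h (y_comm _ _) φ

theorem HbarOp_ybar_apply (φ : Form R M) :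
    HbarOp h ybar ybar φ = form2 h 0 ![ybar 0 (ybar 0 φ), ybar 0 (ybar 1 φ), ybar 1 (ybar 1 φ)] :=
  HbarOp_apply h (ybar_comm _ _) φ

theorem HOp_p_HOp_y (φ : Form R M) :
    HOp h p p (HOp h y y φ) = form4 h (numFun (fun m _ => -(m + 2) * (m + 3)) φ) := by
  rw [HOp_y_apply, HOp_form2 commutingSpinors_p_pbar, div_div_y]

theorem HbarOp_pbar_HbarOp_ybar (φ : Form R M) :
    HbarOp h pbar pbar (HbarOp h ybar ybar φ) =
      -form4 h (numFun (fun _ n => -(n + 2) * (n + 3)) φ) := by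
  rw [HbarOp_ybar_apply, HbarOp_form2 commutingSpinors_p_pbar, div_div_ybar]

theorem HOp_p_HbarOp_ybar (φ : Form R M) : HOp h p p (HbarOp h ybar ybar φ) = 0 := by
  rw [HbarOp_ybar_apply, HOp_form2 commutingSpinors_p_pbar, div_zero, div_zero, map_zero, map_zero,
    sub_zero, form4_zero]

theorem pbar_y_y_eq_zero {φ : Form R M} (hφ : numFun (fun _ n => delta0 n) φ = φ)
    (α β γ : Fin 2) : pbar α (y β (y γ φ)) = 0 := by
  rw [apply_eq_of_mul_eq (pbar_y _ _), apply_eq_of_mul_eq (pbar_y _ _), pbar_eq_zero hφ, map_zero,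
    map_zero]

theorem p_ybar_ybar_eq_zero {φ : Form R M} (hφ : numFun (fun m _ => delta0 m) φ = φ)
    (α β γ : Fin 2) : p α (ybar β (ybar γ φ)) = 0 := by
  rw [← apply_eq_of_mul_eq (ybar_p _ _), ← apply_eq_of_mul_eq (ybar_p _ _), p_eq_zero hφ, map_zero,
    map_zero]

theorem hOp_p_pbar_HOp_y {φ : Form R M} (hφ : numFun (fun _ n => delta0 n) φ = φ) :
    hOp h p pbar (HOp h y y φ) = 0 := by
  have e := pbar_y_y_eq_zero hφ
  have c : ∀ α β (x : Form R M), pbar α (p β x) = p β (pbar α x) := fun α β =>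
    apply_eq_of_mul_eq (pbar_p α β)
  rw [HOp_y_apply, hOp_form2 commutingSpinors_p_pbar]
  have : ∀ α α', pbar α' (div p ![y 0 (y 0 φ), y 0 (y 1 φ), y 1 (y 1 φ)] α) = 0 := by
    intro α α'
    fin_cases α <;> simp [div, c, e]
  simp only [this, div_zero, map_zero, sub_zero]
  simp [form3]

theorem hOp_p_pbar_HbarOp_ybar {φ : Form R M} (hφ : numFun (fun m _ => delta0 m) φ = φ) :
    hOp h p pbar (HbarOp h ybar ybar φ) = 0 := by
  have e := p_ybar_ybar_eq_zero hφ
  have c : ∀ α β (x : Form R M), p β (pbar α x) = pbar α (p β x) := fun α β x =>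
    (apply_eq_of_mul_eq (pbar_p α β) x).symm
  rw [HbarOp_ybar_apply, hOp_form2 commutingSpinors_p_pbar]
  have : ∀ α α',
      p α (div pbar ![ybar 0 (ybar 0 φ), ybar 0 (ybar 1 φ), ybar 1 (ybar 1 φ)] α') = 0 := by
    intro α α'
    fin_cases α' <;> simp [div, c, e]
  simp only [this, div_zero, map_zero, sub_zero]
  simp [form3]

end Exact

/-! ### Supports in the bidegree -/

section Support

variable {R M : Type*} [CommRing R] [Algebra ℂ R] [AddCommGroup M] [Module R M]

open Classical in
/-- The indicator function of a set of bidegrees. -/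
noncomputable def ind (c : ℤ → ℤ → Prop) (m n : ℤ) : ℂ := if c m n then 1 else 0

/-- All terms of the series `f` have a bidegree `(m, n)` in `(y, ȳ)` with `c m n`. -/
def SupportedOn (c : ℤ → ℤ → Prop) (f : Form R M) : Prop := numFun (ind c) f = f

namespace SupportedOn

variable {c c' : ℤ → ℤ → Prop} {f g : Form R M}

theorem numFun_congr (hf : SupportedOn c f) {φ ψ : ℤ → ℤ → ℂ}
    (H : ∀ m n : ℕ, c m n → φ m n = ψ m n) : numFun φ f = numFun ψ f := by
  rw [← hf, numFun_numFun, numFun_numFun]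
  refine numFun_apply_congr (fun m n => ?_) f
  by_cases hc : c m n
  · rw [H m n hc]
  · simp [ind, hc]

theorem numFun_eq_self (hf : SupportedOn c f) {φ : ℤ → ℤ → ℂ}
    (H : ∀ m n : ℕ, c m n → φ m n = 1) : numFun φ f = f := by
  rw [hf.numFun_congr (ψ := fun _ _ => 1) H, numFun_one, Module.End.one_apply]

theorem numFun_eq_zero (hf : SupportedOn c f) {φ : ℤ → ℤ → ℂ}
    (H : ∀ m n : ℕ, c m n → φ m n = 0) : numFun φ f = 0 := by
  rw [hf.numFun_congr (ψ := fun _ _ => 0) H, numFun_zero, LinearMap.zero_apply]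

theorem mono (hf : SupportedOn c f) (H : ∀ m n : ℕ, c m n → c' m n) : SupportedOn c' f :=
  hf.numFun_eq_self fun m n hc => if_pos (H m n hc)

theorem eq_zero (hf : SupportedOn c f) (H : ∀ m n : ℕ, ¬c m n) : f = 0 := by
  rw [← hf]
  exact hf.numFun_eq_zero fun m n hc => (H m n hc).elim

theorem numFun (hf : SupportedOn c f) (φ : ℤ → ℤ → ℂ) : SupportedOn c (numFun φ f) := by
  rw [SupportedOn, numFun_numFun]
  exact hf.numFun_congr fun m n hc => by simp [ind, hc]

theorem indicator (c : ℤ → ℤ → Prop) (f : Form R M) :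
    SupportedOn c (HigherSpin.numFun (ind c) f) := by
  rw [SupportedOn, numFun_numFun]
  exact numFun_apply_congr (fun m n => by simp [ind]) f

theorem numFun_of_ne_zero {φ : ℤ → ℤ → ℂ} (H : ∀ m n : ℕ, φ m n ≠ 0 → c m n) (f : Form R M) :
    SupportedOn c (HigherSpin.numFun φ f) := by
  rw [SupportedOn, numFun_numFun]
  refine numFun_apply_congr (fun m n => ?_) f
  by_cases h0 : φ m n = 0
  · rw [h0, mul_zero]
  · simp [ind, H m n h0]

theorem and (hf : SupportedOn c f) (hf' : SupportedOn c' f) :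
    SupportedOn (fun m n => c m n ∧ c' m n) f := by
  rw [SupportedOn, hf.numFun_congr (ψ := ind c') fun m n hc => by
    by_cases h' : c' m n <;> simp [ind, hc, h'], hf']

theorem add (hf : SupportedOn c f) (hg : SupportedOn c g) : SupportedOn c (f + g) := by
  rw [SupportedOn, map_add, hf, hg]

theorem sub (hf : SupportedOn c f) (hg : SupportedOn c g) : SupportedOn c (f - g) := by
  rw [SupportedOn, map_sub, hf, hg]

theorem smul (r : R) (hf : SupportedOn c f) : SupportedOn c (r • f) := by
  rw [SupportedOn, map_smul, hf]

theorem neg (hf : SupportedOn c f) : SupportedOn c (-f) := by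
  rw [SupportedOn, map_neg, hf]

theorem contract {u v : Spinor R M} {a b a' b' : ℤ} (hu : HasShift u a b)
    (hv : HasShift v a' b') (wu : ∀ ω α, u α * wedge ω = wedge ω * u α)
    (wv : ∀ ω α, v α * wedge ω = wedge ω * v α) (T : Fin 2 → Fin 2 → ExteriorAlgebra R M)
    (hf : SupportedOn c f) (H : ∀ m n : ℕ, c m n → c' (m + a' + a) (n + b' + b)) :
    SupportedOn c' (contract T u v f) := by
  rw [SupportedOn, numFun_contract hu hv wu wv,
    hf.numFun_eq_self fun m n hc => by simp [ind, H m n hc]]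

variable (h : Module.Basis (Fin 2 × Fin 2) R M)

theorem hOp_p_ybar (hf : SupportedOn c f) (H : ∀ m n : ℕ, c m n → c' (m - 1) (n + 1)) :
    SupportedOn c' (hOp h p ybar f) :=
  hf.contract hasShift_p hasShift_ybar p_wedge ybar_wedge _ (by simpa [← sub_eq_add_neg] using H)

theorem hOp_y_pbar (hf : SupportedOn c f) (H : ∀ m n : ℕ, c m n → c' (m + 1) (n - 1)) :
    SupportedOn c' (hOp h y pbar f) :=
  hf.contract hasShift_y hasShift_pbar y_wedge pbar_wedge _ (by simpa [← sub_eq_add_neg] using H)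

theorem hOp_p_pbar (hf : SupportedOn c f) (H : ∀ m n : ℕ, c m n → c' (m - 1) (n - 1)) :
    SupportedOn c' (hOp h p pbar f) :=
  hf.contract hasShift_p hasShift_pbar p_wedge pbar_wedge _ (by simpa [← sub_eq_add_neg] using H)

theorem H3Op_p_ybar (hf : SupportedOn c f) (H : ∀ m n : ℕ, c m n → c' (m - 1) (n + 1)) :
    SupportedOn c' (H3Op h p ybar f) :=
  hf.contract hasShift_p hasShift_ybar p_wedge ybar_wedge _ (by simpa [← sub_eq_add_neg] using H)

theorem H3Op_y_pbar (hf : SupportedOn c f) (H : ∀ m n : ℕ, c m n → c' (m + 1) (n - 1)) :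
    SupportedOn c' (H3Op h y pbar f) :=
  hf.contract hasShift_y hasShift_pbar y_wedge pbar_wedge _ (by simpa [← sub_eq_add_neg] using H)

theorem HOp_p (hf : SupportedOn c f) (H : ∀ m n : ℕ, c m n → c' (m - 2) n) :
    SupportedOn c' (HOp h p p f) :=
  smul _ (hf.contract hasShift_p hasShift_p p_wedge p_wedge _ fun m n hc => by
    convert H m n hc using 1 <;> ring)

theorem HbarOp_pbar (hf : SupportedOn c f) (H : ∀ m n : ℕ, c m n → c' m (n - 2)) :
    SupportedOn c' (HbarOp h pbar pbar f) :=
  smul _ (hf.contract hasShift_pbar hasShift_pbar pbar_wedge pbar_wedge _ fun m n hc => by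
    convert H m n hc using 1 <;> ring)

theorem HOp_y (hf : SupportedOn c f) (H : ∀ m n : ℕ, c m n → c' (m + 2) n) :
    SupportedOn c' (HOp h y y f) :=
  smul _ (hf.contract hasShift_y hasShift_y y_wedge y_wedge _ fun m n hc => by
    convert H m n hc using 1 <;> ring)

theorem HbarOp_ybar (hf : SupportedOn c f) (H : ∀ m n : ℕ, c m n → c' m (n + 2)) :
    SupportedOn c' (HbarOp h ybar ybar f) :=
  smul _ (hf.contract hasShift_ybar hasShift_ybar ybar_wedge ybar_wedge _ fun m n hc => by
    convert H m n hc using 1 <;> ring)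

theorem form4 (hf : SupportedOn c f) : SupportedOn c (form4 h f) := by
  rw [SupportedOn, numFun_form4, hf]

end SupportedOn

theorem supportedOn_of_eq {φ : ℤ → ℤ → ℂ} {c : ℤ → ℤ → Prop} {f : Form R M}
    (hf : numFun φ f = f) (H : ∀ m n : ℕ, φ m n ≠ 0 → c m n) : SupportedOn c f := by
  rw [← hf]
  exact SupportedOn.numFun_of_ne_zero H f

/-- Values of the coefficients in a submodule that depends on the bidegree split into a condition
on the values and a condition on the support. -/
theorem coeff_mem_and_supportedOn_iff (c : ℤ → ℤ → Prop) [∀ m n, Decidable (c m n)]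
    (S : Submodule R (ExteriorAlgebra R M)) (f : Form R M) :
    (∀ d, MvPowerSeries.coeff d f ∈ if c (degY d) (degYbar d) then S else ⊥) ↔
      (∀ d, MvPowerSeries.coeff d f ∈ S) ∧ SupportedOn c f := by
  constructor
  · refine fun H => ⟨fun d => ?_, form_ext fun d => ?_⟩ <;> have hd := H d
    · split_ifs at hd
      · exact hd
      · exact bot_le (a := S) hd
    · rw [coeff_numFun]
      split_ifs at hd with hc
      · simp [ind, hc, cst_one]
      · rw [(Submodule.mem_bot R).mp hd, smul_zero]
  · rintro ⟨H, H'⟩ d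
    split_ifs with hc
    · exact H d
    · rw [← H', coeff_numFun]
      simp [ind, hc, cst_zero]

theorem mem_rankOne_iff {q t : ℕ} {w : Form R M × Form R M} :
    w ∈ rankOne R M (q + 1) t ↔
      ((∀ d, MvPowerSeries.coeff d w.1 ∈ ⋀[R]^(q + 1) M) ∧
        SupportedOn (fun m n => m + n + 2 = t) w.1) ∧
      (∀ d, MvPowerSeries.coeff d w.2 ∈ ⋀[R]^q M) ∧
        SupportedOn (fun m n => |m - n| = t) w.2 := by
  rw [← coeff_mem_and_supportedOn_iff, ← coeff_mem_and_supportedOn_iff, rankOne,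
    Submodule.mem_prod]
  refine and_congr (forall_congr' fun d => ?_) Iff.rfl
  have : ((degY d : ℤ) + degYbar d + 2 = t) ↔ (degY d + degYbar d + 2 = t) := by
    exact_mod_cast Iff.rfl
  simp only [this]

theorem mem_bihom_iff {a b : ℕ} {f : Form R M} :
    f ∈ bihom R M a b ↔
      f ∈ functions R M ∧ SupportedOn (fun m n => m = a ∧ n = b) f := by
  rw [mem_functions, ← coeff_mem_and_supportedOn_iff]
  refine forall_congr' fun d => ?_
  simp only [Nat.cast_inj]

end Support

/-! ### The 2-forms of the `C` sector -/

section TwoForms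

variable {R M : Type*} [CommRing R] [Algebra ℂ R] [AddCommGroup M] [Module R M]
variable (h : Module.Basis (Fin 2 × Fin 2) R M) (η : ℂ)

theorem coeff_contract_mem {k : ℕ} {T : Fin 2 → Fin 2 → ExteriorAlgebra R M}
    (hT : ∀ α β, T α β ∈ ⋀[R]^k M) {u v : Spinor R M} {f : Form R M}
    (hf : ∀ α β, u α (v β f) ∈ functions R M) (d : Var →₀ ℕ) :
    MvPowerSeries.coeff d (contract T u v f) ∈ ⋀[R]^k M := by
  simp only [contract, LinearMap.sum_apply, Module.End.mul_apply, map_sum, coeff_wedge]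
  exact sum_mem fun α _ => sum_mem fun β _ => mul_mem_exteriorPower (hT α β) (hf α β d)

theorem coeff_HOp_y_mem {φ : Form R M} (hφ : φ ∈ functions R M) (d : Var →₀ ℕ) :
    MvPowerSeries.coeff d (HOp h y y φ) ∈ ⋀[R]^2 M := by
  rw [HOp, LinearMap.smul_apply, coeff_smul']
  exact Submodule.smul_mem _ _ (coeff_contract_mem (H2_mem h)
    (fun _ _ => y_mem_functions _ (y_mem_functions _ hφ)) d)

theorem coeff_HbarOp_ybar_mem {φ : Form R M} (hφ : φ ∈ functions R M) (d : Var →₀ ℕ) :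
    MvPowerSeries.coeff d (HbarOp h ybar ybar φ) ∈ ⋀[R]^2 M := by
  rw [HbarOp, LinearMap.smul_apply, coeff_smul']
  exact Submodule.smul_mem _ _ (coeff_contract_mem (Hbar2_mem h)
    (fun _ _ => ybar_mem_functions _ (ybar_mem_functions _ hφ)) d)

theorem coeff_H3Op_y_pbar_mem {ψ : Form R M} (hψ : ψ ∈ functions R M) (d : Var →₀ ℕ) :
    MvPowerSeries.coeff d (H3Op h y pbar ψ) ∈ ⋀[R]^3 M :=
  coeff_contract_mem (H3_mem h) (fun _ _ => y_mem_functions _ (pbar_mem_functions _ hψ)) d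

theorem coeff_H3Op_p_ybar_mem {ψ : Form R M} (hψ : ψ ∈ functions R M) (d : Var →₀ ℕ) :
    MvPowerSeries.coeff d (H3Op h p ybar ψ) ∈ ⋀[R]^3 M :=
  coeff_contract_mem (H3_mem h) (fun _ _ => p_mem_functions _ (ybar_mem_functions _ hψ)) d

theorem div_mem_functions {u : Spinor R M}
    (hu : ∀ (α : Fin 2) (x : Form R M), x ∈ functions R M → u α x ∈ functions R M)
    {A : Fin 3 → Form R M} (hA : ∀ i, A i ∈ functions R M) (α : Fin 2) :
    div u A α ∈ functions R M := by
  fin_cases α <;> exact sub_mem (hu _ _ (hA _)) (hu _ _ (hA _))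

/-- If `p_α p̄_α' (r - r') = 0`, then `r` and `r'` may be replaced by a single series without
changing `p^α r` and `p̄^α' r'`. -/
theorem exists_common_potential {r r' : Form R M}
    (H : ∀ α α', pbar α' (p α r) = p α (pbar α' r')) :
    ∃ ρ, (∀ α, p α ρ = p α r) ∧ ∀ α', pbar α' ρ = pbar α' r' := by
  set a := numFun (fun m _ => delta0 m) (r - r') with ha
  have ha0 : numFun (fun m _ => delta0 m) a = a := by
    rw [ha, numFun_numFun]
    simp only [delta0_mul_self]
  have ha1 : ∀ α', pbar α' a = pbar α' (r - r') := fun α' => by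
    rw [ha, ← numFun_pbar_apply (fun m _ => delta0 m)]
    refine numFun_delta0_of_p_eq_zero fun α => ?_
    rw [← apply_eq_of_mul_eq (pbar_p α' α), map_sub, map_sub, H,
      apply_eq_of_mul_eq (pbar_p α' α) r', sub_self]
  refine ⟨r - a, fun α => ?_, fun α' => ?_⟩
  · rw [map_sub, p_eq_zero ha0, sub_zero]
  · rw [map_sub, ha1, map_sub, sub_sub_cancel]

theorem neg_mul_add_three_ne_zero (k : ℕ) : -(((k : ℤ) : ℂ) + 2) * ((k : ℤ) + 3) ≠ 0 := by
  have h2 : ((k : ℂ) + 2) ≠ 0 := by exact_mod_cast (by omega : k + 2 ≠ 0)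
  have h3 : ((k : ℂ) + 3) ≠ 0 := by exact_mod_cast (by omega : k + 3 ≠ 0)
  exact mul_ne_zero (neg_ne_zero.mpr h2) h3

/-- The 2-forms closed under `h(p, p̄)` are exact, up to `H(y, y) φ(y)` and `H̄(ȳ, ȳ) χ(ȳ)`. -/
theorem exists_hOp_p_pbar_eq_of_two {C : Form R M}
    (hC : ∀ d, MvPowerSeries.coeff d C ∈ ⋀[R]^2 M) (H : hOp h p pbar C = 0) :
    ∃ C' φ χ, C = hOp h p pbar C' + HOp h y y φ + HbarOp h ybar ybar χ ∧
      φ ∈ functions R M ∧ χ ∈ functions R M ∧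
      numFun (fun _ n => delta0 n) φ = φ ∧ numFun (fun m _ => delta0 m) χ = χ := by
  obtain ⟨A, B, hA, hB, rfl⟩ := exists_form2_eq h hC
  have hs := div_mem_functions (fun α _ => p_mem_functions α) hA
  have ht := div_mem_functions (fun α _ => pbar_mem_functions α) hB
  rw [hOp_form2 commutingSpinors_p_pbar] at H
  have hcl : ∀ α α', pbar α' (div p A α) = p α (div pbar B α') := fun α α' =>
    sub_eq_zero.mp (eq_zero_of_form3_eq_zero h
      (W := fun α α' => pbar α' (div p A α) - p α (div pbar B α'))
      (fun α α' => sub_mem (pbar_mem_functions _ (hs α)) (p_mem_functions _ (ht α'))) H α α')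
  have cpp : ∀ x : Form R M, p 1 (p 0 x) = p 0 (p 1 x) := apply_eq_of_mul_eq (p_comm _ _)
  have cbb : ∀ x : Form R M, pbar 1 (pbar 0 x) = pbar 0 (pbar 1 x) :=
    apply_eq_of_mul_eq (pbar_comm _ _)
  have cbp : ∀ α β (x : Form R M), pbar α (p β x) = p β (pbar α x) := fun α β =>
    apply_eq_of_mul_eq (pbar_p α β)
  set f := p 1 (div p A 0) - p 0 (div p A 1) with hf
  set g := pbar 1 (div pbar B 0) - pbar 0 (div pbar B 1) with hg
  have hf0 : numFun (fun _ n => delta0 n) f = f := by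
    refine numFun_delta0_of_pbar_eq_zero fun α' => ?_
    rw [hf, map_sub, cbp, cbp, hcl, hcl, cpp, sub_self]
  have hg0 : numFun (fun m _ => delta0 m) g = g := by
    refine numFun_delta0_of_p_eq_zero fun α => ?_
    rw [hg, map_sub, ← cbp, ← cbp, ← hcl, ← hcl, cbb, sub_self]
  set φ := numFun (fun m _ => (-(m + 2) * (m + 3))⁻¹) f with hφ
  set χ := numFun (fun _ n => (-(n + 2) * (n + 3))⁻¹) g with hχ
  have hφ0 : numFun (fun _ n => delta0 n) φ = φ := by
    rw [hφ, numFun_numFun]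
    simp only [mul_comm (delta0 _)]
    rw [← numFun_numFun (fun m _ => (-(m + 2) * (m + 3))⁻¹) (fun _ n => delta0 n), hf0]
  have hχ0 : numFun (fun m _ => delta0 m) χ = χ := by
    rw [hχ, numFun_numFun]
    simp only [mul_comm (delta0 _)]
    rw [← numFun_numFun (fun _ n => (-(n + 2) * (n + 3))⁻¹) (fun m _ => delta0 m), hg0]
  have hφf : numFun (fun m _ => -(m + 2) * (m + 3)) φ = f := by
    rw [hφ, numFun_numFun]
    exact numFun_eq_self (fun m n => mul_inv_cancel₀ (neg_mul_add_three_ne_zero m)) f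
  have hχg : numFun (fun _ n => -(n + 2) * (n + 3)) χ = g := by
    rw [hχ, numFun_numFun]
    exact numFun_eq_self (fun m n => mul_inv_cancel₀ (neg_mul_add_three_ne_zero n)) g
  set A₁ := A - ![y 0 (y 0 φ), y 0 (y 1 φ), y 1 (y 1 φ)] with hA₁
  set B₁ := B - ![ybar 0 (ybar 0 χ), ybar 0 (ybar 1 χ), ybar 1 (ybar 1 χ)] with hB₁
  have hdA : p 1 (div p A₁ 0) - p 0 (div p A₁ 1) = 0 := by
    rw [hA₁, div_sub, div_sub, map_sub, map_sub, sub_sub_sub_comm, div_div_y, hφf, sub_self]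
  have hdB : pbar 1 (div pbar B₁ 0) - pbar 0 (div pbar B₁ 1) = 0 := by
    rw [hB₁, div_sub, div_sub, map_sub, map_sub, sub_sub_sub_comm, div_div_ybar, hχg, sub_self]
  have hcl₁ : ∀ α α', pbar α' (div p A₁ α) = p α (div pbar B₁ α') := by
    intro α α'
    have e1 : pbar α' (div p ![y 0 (y 0 φ), y 0 (y 1 φ), y 1 (y 1 φ)] α) = 0 := by
      fin_cases α <;> simp [div, cbp, pbar_y_y_eq_zero hφ0]
    have e2 : p α (div pbar ![ybar 0 (ybar 0 χ), ybar 0 (ybar 1 χ), ybar 1 (ybar 1 χ)] α') = 0 := by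
      fin_cases α' <;> simp [div, ← cbp, p_ybar_ybar_eq_zero hχ0]
    rw [hA₁, hB₁, div_sub, div_sub, map_sub, map_sub, hcl, e1, e2]
  obtain ⟨r, hr⟩ := isExact_p (div p A₁) (sub_eq_zero.mp hdA).symm
  obtain ⟨r', hr'⟩ := isExact_pbar (div pbar B₁) (sub_eq_zero.mp hdB).symm
  obtain ⟨ρ, hρ, hρ'⟩ := exists_common_potential (r := r) (r' := r') fun α α' => by
    rw [← hr, ← hr', hcl₁]
  obtain ⟨C, hC'⟩ := exists_form1_of_div_eq h commutingSpinors_p_pbar p_surjective pbar_surjective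
    isExact_p isExact_pbar (A := A₁) (B := B₁) (r := ρ) (fun α => by rw [hr, hρ])
    (fun α => by rw [hr', hρ'])
  refine ⟨form1 h C, φ, χ, ?_, ?_, ?_, hφ0, hχ0⟩
  · rw [hC', HOp_y_apply, HbarOp_ybar_apply, add_assoc, ← sub_eq_iff_eq_add, hA₁, hB₁, form2_sub,
      sub_right_inj]
    simp only [form2, Matrix.cons_val, Pi.zero_apply, map_zero]
    abel
  · exact numFun_mem_functions _ (sub_mem (p_mem_functions _ (hs 0)) (p_mem_functions _ (hs 1)))
  · exact numFun_mem_functions _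
      (sub_mem (pbar_mem_functions _ (ht 0)) (pbar_mem_functions _ (ht 1)))

end TwoForms

/-! ### The operator `Σ₋` on fields supported in a part of the bidegrees -/

section SigmaMinus

variable {R M : Type*} [CommRing R] [Algebra ℂ R] [AddCommGroup M] [Module R M]
variable (h : Module.Basis (Fin 2 × Fin 2) R M) (η : ℂ)

theorem sigmaMinus_mem {q t : ℕ} {w : Form R M × Form R M} (hw : w ∈ rankOne R M (q + 1) t) :
    sigmaMinus h η w ∈ rankOne R M (q + 2) t := by
  obtain ⟨h1, h2⟩ := mem_rankOne.mp hw
  have e1 := apply_eq_of_mul_eq (projOmega_sigmaOmegaOmega h (q + 1) t) w.1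
  have e2 := apply_eq_of_mul_eq (projOmega_sigmaOmegaC h η q t) w.2
  have e3 := apply_eq_of_mul_eq (projC_sigmaCC h q t) w.2
  rw [add_comm 1] at e1 e3
  rw [add_comm 2] at e2
  rw [h1] at e1
  rw [h2] at e2 e3
  refine mem_rankOne.mpr ⟨?_, e3⟩
  rw [sigmaMinus_apply, map_add, e1, e2]

theorem sigmaOmegaOmega_apply (f : Form R M) :
    sigmaOmegaOmega h f = cst R Complex.I •
      (hOp h p ybar (numFun (fun n nb => theta (n - nb - 1)) f) +
        hOp h y pbar (numFun (fun n nb => theta (nb - n - 1)) f)) := rfl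

theorem sigmaOmegaC_apply (f : Form R M) :
    sigmaOmegaC h η f =
      cst R (Complex.I / 2 * starRingEnd ℂ η) • HOp h p p (numFun (fun _ n => delta0 n) f) +
        cst R (Complex.I / 2 * η) • HbarOp h pbar pbar (numFun (fun m _ => delta0 m) f) := rfl

theorem sigmaCC_apply (f : Form R M) :
    sigmaCC h f = cst R (-Complex.I) • hOp h p pbar f := rfl

theorem theta_of_pos {k : ℤ} (hk : 0 < k) : theta k = 1 := if_pos hk

theorem theta_of_nonpos {k : ℤ} (hk : k ≤ 0) : theta k = 0 := if_neg hk.not_gt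

theorem delta0_zero : delta0 0 = 1 := if_pos rfl

theorem delta0_of_ne {k : ℤ} (hk : k ≠ 0) : delta0 k = 0 := if_neg hk

theorem sigmaOmegaOmega_of_left {f : Form R M} (hf : SupportedOn (fun m n => n + 2 ≤ m) f) :
    sigmaOmegaOmega h f = cst R Complex.I • hOp h p ybar f := by
  rw [sigmaOmegaOmega_apply, hf.numFun_eq_self fun m n hc => theta_of_pos (by omega),
    hf.numFun_eq_zero fun m n hc => theta_of_nonpos (by omega), map_zero, add_zero]

theorem sigmaOmegaOmega_of_right {f : Form R M} (hf : SupportedOn (fun m n => m + 2 ≤ n) f) :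
    sigmaOmegaOmega h f = cst R Complex.I • hOp h y pbar f := by
  rw [sigmaOmegaOmega_apply, hf.numFun_eq_zero (φ := fun n nb => theta (n - nb - 1))
    fun m n hc => theta_of_nonpos (by omega),
    hf.numFun_eq_self fun m n hc => theta_of_pos (by omega), map_zero, zero_add]

theorem sigmaOmegaOmega_of_center {f : Form R M}
    (hf : SupportedOn (fun m n => m ≤ n + 1 ∧ n ≤ m + 1) f) : sigmaOmegaOmega h f = 0 := by
  rw [sigmaOmegaOmega_apply, hf.numFun_eq_zero fun m n hc => theta_of_nonpos (by omega),
    hf.numFun_eq_zero fun m n hc => theta_of_nonpos (by omega), map_zero, map_zero, add_zero,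
    smul_zero]

theorem hOp_p_pbar_eq_zero_left {f : Form R M} (hf : SupportedOn (fun _ n => n = 0) f) :
    hOp h p pbar f = 0 :=
  (hf.hOp_p_pbar h (c' := fun _ n => n < 0) fun m n hc => by omega).eq_zero fun m n => by omega

theorem hOp_p_pbar_eq_zero_right {f : Form R M} (hf : SupportedOn (fun m _ => m = 0) f) :
    hOp h p pbar f = 0 :=
  (hf.hOp_p_pbar h (c' := fun m _ => m < 0) fun m n hc => by omega).eq_zero fun m n => by omega

theorem sigmaOmegaC_of_left {f : Form R M} (hf : SupportedOn (fun m n => n = 0 ∧ m ≠ 0) f) :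
    sigmaOmegaC h η f = cst R (Complex.I / 2 * starRingEnd ℂ η) • HOp h p p f := by
  rw [sigmaOmegaC_apply,
    hf.numFun_eq_self fun m n hc => by rw [hc.1, delta0_zero],
    hf.numFun_eq_zero fun m n hc => delta0_of_ne hc.2, map_zero, smul_zero, add_zero]

theorem sigmaOmegaC_of_right {f : Form R M} (hf : SupportedOn (fun m n => m = 0 ∧ n ≠ 0) f) :
    sigmaOmegaC h η f = cst R (Complex.I / 2 * η) • HbarOp h pbar pbar f := by
  rw [sigmaOmegaC_apply,
    hf.numFun_eq_zero fun m n hc => delta0_of_ne hc.2,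
    hf.numFun_eq_self fun m n hc => by rw [hc.1, delta0_zero], map_zero, smul_zero, zero_add]

theorem sigmaMinus_left {f g : Form R M} (hf : SupportedOn (fun m n => n + 2 ≤ m) f)
    (hg : SupportedOn (fun m n => n = 0 ∧ m ≠ 0) g) :
    sigmaMinus h η (f, g) = (cst R Complex.I • hOp h p ybar f +
      cst R (Complex.I / 2 * starRingEnd ℂ η) • HOp h p p g, 0) := by
  rw [sigmaMinus_apply, sigmaOmegaOmega_of_left h hf, sigmaOmegaC_of_left h η hg, sigmaCC_apply,
    hOp_p_pbar_eq_zero_left h (hg.mono fun m n hc => hc.1), smul_zero]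

theorem sigmaMinus_right {f g : Form R M} (hf : SupportedOn (fun m n => m + 2 ≤ n) f)
    (hg : SupportedOn (fun m n => m = 0 ∧ n ≠ 0) g) :
    sigmaMinus h η (f, g) = (cst R Complex.I • hOp h y pbar f +
      cst R (Complex.I / 2 * η) • HbarOp h pbar pbar g, 0) := by
  rw [sigmaMinus_apply, sigmaOmegaOmega_of_right h hf, sigmaOmegaC_of_right h η hg, sigmaCC_apply,
    hOp_p_pbar_eq_zero_right h (hg.mono fun m n hc => hc.1), smul_zero]

theorem hOp_HOp {u v : Spinor R M} (H : CommutingSpinors u v) (f : Form R M) :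
    hOp h u v (HOp h u u f) = 0 := by
  obtain ⟨hu, -, -⟩ := H.apply
  rw [HOp_apply h H.left, hOp_form2 H]
  have : ∀ α, div u ![u 0 (u 0 f), u 0 (u 1 f), u 1 (u 1 f)] α = 0 := by
    intro α
    fin_cases α <;> simp [div, hu]
  simp only [this, div_zero, map_zero, sub_zero]
  simp [form3]

theorem hOp_HbarOp {u v : Spinor R M} (H : CommutingSpinors u v) (f : Form R M) :
    hOp h u v (HbarOp h v v f) = 0 := by
  obtain ⟨-, hv, -⟩ := H.apply
  rw [HbarOp_apply h H.right, hOp_form2 H]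
  have : ∀ α, div v ![v 0 (v 0 f), v 0 (v 1 f), v 1 (v 1 f)] α = 0 := by
    intro α
    fin_cases α <;> simp [div, hv]
  simp only [this, div_zero, map_zero, sub_zero]
  simp [form3]

theorem HOp_hOp {u v : Spinor R M} (H : CommutingSpinors u v) (f : Form R M) :
    HOp h u u (hOp h u v f) = 0 := by
  obtain ⟨hu, -, -⟩ := H.apply
  rw [hOp_apply, HOp_form1 H]
  simp [hu, form3]

theorem HbarOp_hOp {u v : Spinor R M} (H : CommutingSpinors u v) (f : Form R M) :
    HbarOp h v v (hOp h u v f) = 0 := by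
  obtain ⟨-, hv, hc⟩ := H.apply
  rw [hOp_apply, HbarOp_form1 H]
  simp [hv, hc, form3]

theorem hOp_hOp {u v : Spinor R M} (H : CommutingSpinors u v) (f : Form R M) :
    hOp h u v (hOp h u v f) = 0 := by
  obtain ⟨hu, hv, hc⟩ := H.apply
  rw [hOp_apply h u v f, hOp_form1 H (A := 0) (B := 0)]
  · simp [form2]
  all_goals simp [hu, hv, hc]

/-- The part of `Σ₋² = 0` from the `C` sector to the `ω` sector. -/
theorem sigmaOmegaOmega_sigmaOmegaC_add (f : Form R M) :
    sigmaOmegaOmega h (sigmaOmegaC h η f) + sigmaOmegaC h η (sigmaCC h f) = 0 := by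
  have e1 : ∀ g : Form R M, sigmaOmegaOmega h (HOp h p p (numFun (fun _ n => delta0 n) g)) = 0 := by
    intro g
    have hs : SupportedOn (fun _ n => n = 0) (HOp h p p (numFun (fun _ n => delta0 n) g)) :=
      (SupportedOn.numFun_of_ne_zero (c := fun _ n => n = 0)
        (fun m n h0 => by by_contra hn; exact h0 (delta0_of_ne hn)) g).HOp_p h fun m n hc => hc
    rw [sigmaOmegaOmega_apply, hs.numFun_eq_zero (φ := fun n nb => theta (nb - n - 1))
      fun m n hc => theta_of_nonpos (by omega), numFun_HOp_p, hOp_HOp h commutingSpinors_p_ybar,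
      map_zero, add_zero, smul_zero]
  have e2 : ∀ g : Form R M,
      sigmaOmegaOmega h (HbarOp h pbar pbar (numFun (fun m _ => delta0 m) g)) = 0 := by
    intro g
    have hs : SupportedOn (fun m _ => m = 0)
        (HbarOp h pbar pbar (numFun (fun m _ => delta0 m) g)) :=
      (SupportedOn.numFun_of_ne_zero (c := fun m _ => m = 0)
        (fun m n h0 => by by_contra hn; exact h0 (delta0_of_ne hn)) g).HbarOp_pbar h
          fun m n hc => hc
    rw [sigmaOmegaOmega_apply, hs.numFun_eq_zero (φ := fun n nb => theta (n - nb - 1))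
      fun m n hc => theta_of_nonpos (by omega), numFun_HbarOp_pbar,
      hOp_HbarOp h commutingSpinors_y_pbar, map_zero, zero_add, smul_zero]
  have e3 : sigmaOmegaC h η (hOp h p pbar f) = 0 := by
    rw [sigmaOmegaC_apply, numFun_hOp_p_pbar, numFun_hOp_p_pbar, HOp_hOp h commutingSpinors_p_pbar,
      HbarOp_hOp h commutingSpinors_p_pbar, smul_zero, smul_zero, add_zero]
  rw [sigmaOmegaC_apply, map_add, map_smul, map_smul, e1, e2, sigmaCC_apply, map_smul, e3]
  simp only [smul_zero, add_zero]

theorem mem_of_cst_smul_mem {V : Type*} [AddCommGroup V] [Module R V] {S : Submodule R V} {c : ℂ}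
    (hc : c ≠ 0) {x : V} (hx : cst R c • x ∈ S) : x ∈ S := by
  have := S.smul_mem (cst R c⁻¹) hx
  rwa [cst_smul_cancel (inv_mul_cancel₀ hc)] at this

end SigmaMinus

/-! ### The `C` sector and the 4-forms of the `ω` sector -/

section Sectors

variable {R M : Type*} [CommRing R] [Algebra ℂ R] [AddCommGroup M] [Module R M]
variable (h : Module.Basis (Fin 2 × Fin 2) R M) (η : ℂ)

theorem projC_of_coeff_mem {q : ℕ} (t : ℕ) {f : Form R M}
    (hf : ∀ d, MvPowerSeries.coeff d f ∈ ⋀[R]^q M) :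
    projC R M q t f = numFun (ind fun m n => |m - n| = t) f := by
  refine form_ext fun d => ?_
  rw [projC, coeff_coeffMap, coeff_numFun, ind]
  split_ifs
  · rw [degreeProj_of_mem (hf d), cst_one, one_smul]
  · rw [cst_zero, zero_smul, LinearMap.zero_apply]

theorem zero_prod_projC_mem (q t : ℕ) (f : Form R M) :
    ((0, projC R M q t f) : Form R M × Form R M) ∈ rankOne R M (q + 1) t :=
  mem_rankOne.mpr ⟨map_zero _, projC_projC _ _ _⟩

theorem hOp_p_pbar_of_sigmaCC {C : Form R M} (H : sigmaCC h C = 0) : hOp h p pbar C = 0 :=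
  cst_smul_eq_zero (R := R) (a := -Complex.I) (neg_ne_zero.mpr Complex.I_ne_zero)
    (by rw [← sigmaCC_apply]; exact H)

theorem sigmaCC_cst_smul (C : Form R M) :
    sigmaCC h (cst R Complex.I • C) = hOp h p pbar C := by
  rw [sigmaCC_apply, map_smul, cst_smul_cancel (by simp)]

/-- There is no cohomology in the 3-forms of the `C` sector. -/
theorem exists_sigmaCC_eq_of_three {t : ℕ} {C : Form R M}
    (hC : ((0, C) : Form R M × Form R M) ∈ rankOne R M 4 t) (H : sigmaCC h C = 0) :
    ∃ C', ((0, C') : Form R M × Form R M) ∈ rankOne R M 3 t ∧ sigmaCC h C' = C := by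
  obtain ⟨C', hC'⟩ := exists_hOp_p_pbar_eq_of_three h (mem_rankOne_iff.mp hC).2.1
    (hOp_p_pbar_of_sigmaCC h H)
  refine ⟨projC R M 2 t (cst R Complex.I • C'), zero_prod_projC_mem _ _ _, ?_⟩
  rw [← apply_eq_of_mul_eq (projC_sigmaCC h 2 t), sigmaCC_cst_smul, hC']
  exact (mem_rankOne.mp hC).2

/-- The cohomology in the 2-forms of the `C` sector. -/
theorem exists_sigmaCC_eq_of_two {t : ℕ} {C : Form R M}
    (hC : ((0, C) : Form R M × Form R M) ∈ rankOne R M 3 t) (H : sigmaCC h C = 0) :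
    ∃ C' φ χ, ((0, C') : Form R M × Form R M) ∈ rankOne R M 2 t ∧
      C = sigmaCC h C' + (HOp h y y φ + HbarOp h ybar ybar χ) ∧
      φ ∈ functions R M ∧ χ ∈ functions R M ∧
      SupportedOn (fun m n => n = 0 ∧ m + 2 = t) φ ∧
      SupportedOn (fun m n => m = 0 ∧ n + 2 = t) χ := by
  obtain ⟨C', φ, χ, e, hφ, hχ, hφ0, hχ0⟩ := exists_hOp_p_pbar_eq_of_two h
    (mem_rankOne_iff.mp hC).2.1 (hOp_p_pbar_of_sigmaCC h H)
  have hφs : SupportedOn (fun _ n => n = 0) φ := supportedOn_of_eq hφ0 fun m n h0 => by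
    by_contra hn
    exact h0 (delta0_of_ne hn)
  have hχs : SupportedOn (fun m _ => m = 0) χ := supportedOn_of_eq hχ0 fun m n h0 => by
    by_contra hn
    exact h0 (delta0_of_ne hn)
  refine ⟨projC R M 1 t (cst R Complex.I • C'),
    numFun (ind fun m n => |m + 2 - n| = t) φ, numFun (ind fun m n => |m - (n + 2)| = t) χ,
    zero_prod_projC_mem _ _ _, ?_, numFun_mem_functions _ hφ, numFun_mem_functions _ hχ, ?_, ?_⟩
  · have e2 : projC R M (1 + 1) t C = C := (mem_rankOne.mp hC).2
    have e3 := congrArg (projC R M (1 + 1) t) e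
    rw [map_add, map_add, ← sigmaCC_cst_smul, apply_eq_of_mul_eq (projC_sigmaCC h 1 t),
      projC_of_coeff_mem t (coeff_HOp_y_mem h hφ),
      projC_of_coeff_mem t (coeff_HbarOp_ybar_mem h hχ),
      numFun_HOp_y, numFun_HbarOp_ybar, add_assoc] at e3
    exact e2.symm.trans e3
  · refine ((hφs.numFun _).and (SupportedOn.indicator _ φ)).mono fun m n hc => ⟨hc.1, ?_⟩
    have h1 := hc.1
    have h2 := hc.2
    rw [abs_of_nonneg (by omega)] at h2
    omega
  · refine ((hχs.numFun _).and (SupportedOn.indicator _ χ)).mono fun m n hc => ⟨hc.1, ?_⟩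
    have h1 := hc.1
    have h2 := hc.2
    rw [abs_of_nonpos (by omega)] at h2
    omega

/-- The map from the `C` sector to the `ω` sector detects the class of `H(y, y) φ(y)`. -/
theorem sigmaOmegaC_HOp_y {φ : Form R M} (hφ : SupportedOn (fun _ n => n = 0) φ) :
    sigmaOmegaC h η (HOp h y y φ) = cst R (Complex.I / 2 * starRingEnd ℂ η) •
      form4 h (numFun (fun m _ => -(m + 2) * (m + 3)) φ) := by
  rw [sigmaOmegaC_of_left h η (hφ.HOp_y h fun m n hc => ⟨hc, by omega⟩), HOp_p_HOp_y]

/-- The map from the `C` sector to the `ω` sector detects the class of `H̄(ȳ, ȳ) χ(ȳ)`. -/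
theorem sigmaOmegaC_HbarOp_ybar {χ : Form R M} (hχ : SupportedOn (fun m _ => m = 0) χ) :
    sigmaOmegaC h η (HbarOp h ybar ybar χ) = cst R (Complex.I / 2 * η) •
      -form4 h (numFun (fun _ n => -(n + 2) * (n + 3)) χ) := by
  rw [sigmaOmegaC_of_right h η (hχ.HbarOp_ybar h fun m n hc => ⟨hc, by omega⟩),
    HbarOp_pbar_HbarOp_ybar]

variable {η}

theorem half_I_mul_ne_zero (hη : η ≠ 0) : Complex.I / 2 * η ≠ 0 :=
  mul_ne_zero (div_ne_zero Complex.I_ne_zero two_ne_zero) hη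

theorem conj_ne_zero (hη : η ≠ 0) : starRingEnd ℂ η ≠ 0 := (map_ne_zero _).mpr hη

theorem zero_supportedOn (c : ℤ → ℤ → Prop) : SupportedOn c (0 : Form R M) := map_zero _

/-- All 4-forms in the `ω` sector are exact: for `m ≥ n ≥ 1` they are in the image of `h(p, ȳ)`,
for `n = 0` in the image of `H(p, p)`, and symmetrically for `m < n`. -/
theorem form4_mem_range (hη : η ≠ 0) (g : Form R M) :
    ((form4 h g, 0) : Form R M × Form R M) ∈ LinearMap.range (sigmaMinus h η) := by
  have ha : ∀ g : Form R M, SupportedOn (fun m n => 1 ≤ n ∧ n ≤ m) g →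
      ((form4 h g, 0) : Form R M × Form R M) ∈ LinearMap.range (sigmaMinus h η) := by
    intro g hg
    let ψ := numFun (fun m n => (-3 * (m + 2) * n)⁻¹) g
    refine mem_of_cst_smul_mem Complex.I_ne_zero ⟨(H3Op h y pbar ψ, 0), ?_⟩
    rw [sigmaMinus_left h η ((hg.numFun _).H3Op_y_pbar h fun m n hc => by omega)
      (zero_supportedOn _), hOp_p_ybar_H3Op, map_zero, smul_zero, add_zero, numFun_numFun,
      hg.numFun_eq_self, Prod.smul_mk, smul_zero]
    intro m n hc
    have h1 : ((m : ℂ) + 2) ≠ 0 := by exact_mod_cast (by omega : m + 2 ≠ 0)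
    have h2 : (n : ℂ) ≠ 0 := by exact_mod_cast (by omega : n ≠ 0)
    exact mul_inv_cancel₀ (by simp [h1, h2])
  have hb : ∀ g : Form R M, SupportedOn (fun m n => 1 ≤ m ∧ m ≤ n) g →
      ((form4 h g, 0) : Form R M × Form R M) ∈ LinearMap.range (sigmaMinus h η) := by
    intro g hg
    let ψ := numFun (fun m n => (-3 * m * (n + 2))⁻¹) g
    refine mem_of_cst_smul_mem Complex.I_ne_zero ⟨(H3Op h p ybar ψ, 0), ?_⟩
    rw [sigmaMinus_right h η ((hg.numFun _).H3Op_p_ybar h fun m n hc => by omega)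
      (zero_supportedOn _), hOp_y_pbar_H3Op, map_zero, smul_zero, add_zero, numFun_numFun,
      hg.numFun_eq_self, Prod.smul_mk, smul_zero]
    intro m n hc
    have h1 : ((n : ℂ) + 2) ≠ 0 := by exact_mod_cast (by omega : n + 2 ≠ 0)
    have h2 : (m : ℂ) ≠ 0 := by exact_mod_cast (by omega : m ≠ 0)
    exact mul_inv_cancel₀ (by simp [h1, h2])
  have hc : ∀ g : Form R M, SupportedOn (fun _ n => n = 0) g →
      ((form4 h g, 0) : Form R M × Form R M) ∈ LinearMap.range (sigmaMinus h η) := by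
    intro g hg
    let φ := numFun (fun m _ => (-(m + 2) * (m + 3))⁻¹) g
    refine mem_of_cst_smul_mem (half_I_mul_ne_zero (conj_ne_zero hη)) ⟨(0, HOp h y y φ), ?_⟩
    rw [sigmaMinus_left h η (zero_supportedOn _)
      ((hg.numFun _).HOp_y h fun m n hc => ⟨hc, by omega⟩), HOp_p_HOp_y, map_zero, smul_zero,
      zero_add, numFun_numFun, hg.numFun_eq_self, Prod.smul_mk, smul_zero]
    exact fun m n hc => mul_inv_cancel₀ (neg_mul_add_three_ne_zero m)
  have hd : ∀ g : Form R M, SupportedOn (fun m _ => m = 0) g →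
      ((form4 h g, 0) : Form R M × Form R M) ∈ LinearMap.range (sigmaMinus h η) := by
    intro g hg
    let φ := numFun (fun _ n => (-(n + 2) * (n + 3))⁻¹) g
    refine mem_of_cst_smul_mem (half_I_mul_ne_zero hη) ⟨(0, -HbarOp h ybar ybar φ), ?_⟩
    rw [sigmaMinus_right h η (zero_supportedOn _)
      (((hg.numFun _).HbarOp_ybar h fun m n hc => ⟨hc, by omega⟩).neg), map_neg,
      HbarOp_pbar_HbarOp_ybar, map_zero, smul_zero, zero_add, neg_neg, numFun_numFun,
      hg.numFun_eq_self, Prod.smul_mk, smul_zero]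
    exact fun m n hc => mul_inv_cancel₀ (neg_mul_add_three_ne_zero n)
  have hsum : g = numFun (ind fun m n => 1 ≤ n ∧ n ≤ m) g +
      numFun (ind fun m n => 1 ≤ m ∧ m < n) g + numFun (ind fun _ n => n = 0) g +
      numFun (ind fun m n => m = 0 ∧ 1 ≤ n) g := by
    rw [numFun_add_numFun, numFun_add_numFun, numFun_add_numFun, numFun_eq_self]
    intro m n
    simp only [ind]
    split_ifs <;> first | omega | norm_num
  have e : ((form4 h g, 0) : Form R M × Form R M) =
      (form4 h (numFun (ind fun m n => 1 ≤ n ∧ n ≤ m) g), 0) +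
      (form4 h (numFun (ind fun m n => 1 ≤ m ∧ m < n) g), 0) +
      (form4 h (numFun (ind fun _ n => n = 0) g), 0) +
      (form4 h (numFun (ind fun m n => m = 0 ∧ 1 ≤ n) g), 0) := by
    simp only [Prod.mk_add_mk, add_zero, ← form4_add, ← hsum]
  rw [e]
  exact add_mem (add_mem (add_mem (ha _ (SupportedOn.indicator _ g))
    (hb _ ((SupportedOn.indicator _ g).mono fun m n hc => ⟨hc.1, hc.2.le⟩)))
    (hc _ (SupportedOn.indicator _ g)))
    (hd _ ((SupportedOn.indicator _ g).mono fun m n hc => hc.1))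

/-- Exactness at the 4-forms: a cocycle is first made to vanish in the `C` sector. -/
theorem cocycles_four_le (hη : η ≠ 0) (t : ℕ) : cocycles h η 4 t ≤ coboundaries h η 4 t := by
  rintro ⟨ω, C⟩ ⟨hw, hker⟩
  refine mem_coboundaries h η hw ?_
  have hCC : sigmaCC h C = 0 := congrArg Prod.snd (LinearMap.mem_ker.mp hker)
  obtain ⟨C', hC', rfl⟩ := exists_sigmaCC_eq_of_three h
    (mem_rankOne.mpr ⟨map_zero _, (mem_rankOne.mp hw).2⟩) hCC
  have hsub := sub_mem hw (sigmaMinus_mem h η hC')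
  obtain ⟨g, -, hg⟩ := exists_form4_eq h (mem_rankOne_iff.mp hsub).1.1
  obtain ⟨w', hw'⟩ := form4_mem_range h hη g
  refine ⟨w' + (0, C'), ?_⟩
  rw [map_add, hw', hg, ← eq_sub_iff_add_eq]
  refine Prod.ext rfl ?_
  simp [sigmaMinus_apply]

end Sectors

/-! ### The 3-forms of the `ω` sector -/

section ThreeForms

variable {R M : Type*} [CommRing R] [Algebra ℂ R] [AddCommGroup M] [Module R M]
variable (h : Module.Basis (Fin 2 × Fin 2) R M) {η : ℂ}

theorem coeff_numFun_mem {q : ℕ} (φ : ℤ → ℤ → ℂ) {f : Form R M}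
    (hf : ∀ d, MvPowerSeries.coeff d f ∈ ⋀[R]^q M) (d : Var →₀ ℕ) :
    MvPowerSeries.coeff d (numFun φ f) ∈ ⋀[R]^q M :=
  Submodule.smul_mem _ _ (hf d)

theorem coeff_sub_mem {q : ℕ} {f g : Form R M} (hf : ∀ d, MvPowerSeries.coeff d f ∈ ⋀[R]^q M)
    (hg : ∀ d, MvPowerSeries.coeff d g ∈ ⋀[R]^q M) (d : Var →₀ ℕ) :
    MvPowerSeries.coeff d (f - g) ∈ ⋀[R]^q M :=
  sub_mem (hf d) (hg d)

theorem exists_hOp_eq_form4 {u v : Spinor R M} (H : CommutingSpinors u v)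
    (hu : ∀ (α : Fin 2) (x : Form R M), x ∈ functions R M → u α x ∈ functions R M)
    (hv : ∀ (α : Fin 2) (x : Form R M), x ∈ functions R M → v α x ∈ functions R M)
    {ω : Form R M} (hω : ∀ d, MvPowerSeries.coeff d ω ∈ ⋀[R]^3 M) :
    ∃ g ∈ functions R M, hOp h u v ω = form4 h g := by
  obtain ⟨W, hW, rfl⟩ := exists_form3_eq h hω
  exact ⟨_, sub_mem (hu _ _ (sub_mem (hv _ _ (hW _ _)) (hv _ _ (hW _ _))))
    (hu _ _ (sub_mem (hv _ _ (hW _ _)) (hv _ _ (hW _ _)))), hOp_form3 H W⟩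

/-- The volume form has no annihilator, and an invertible function of the degrees can be divided
out. -/
theorem eq_zero_of_form4_numFun_eq_zero {c : ℤ → ℤ → Prop} {φ : ℤ → ℤ → ℂ} {ψ : Form R M}
    (hψ : ψ ∈ functions R M) (hc : SupportedOn c ψ) (hφ : ∀ m n : ℕ, c m n → φ m n ≠ 0)
    (H : form4 h (numFun φ ψ) = 0) : ψ = 0 := by
  have h0 := eq_zero_of_form4_eq_zero h (numFun_mem_functions φ hψ) H
  rw [← hc.numFun_eq_self (φ := fun m n => (φ m n)⁻¹ * φ m n) fun m n h' =>
    inv_mul_cancel₀ (hφ m n h'), ← numFun_numFun, h0, map_zero]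

theorem left_factor_ne_zero (m n : ℕ) (hn : 1 ≤ n) :
    -3 * (((m : ℤ) : ℂ) + 2) * ((n : ℤ) : ℂ) ≠ 0 := by
  have h1 : ((m : ℂ) + 2) ≠ 0 := by exact_mod_cast (by omega : m + 2 ≠ 0)
  have h2 : (n : ℂ) ≠ 0 := by exact_mod_cast (by omega : n ≠ 0)
  simp [h1, h2]

theorem right_factor_ne_zero (m n : ℕ) (hm : 1 ≤ m) :
    -3 * ((m : ℤ) : ℂ) * (((n : ℤ) : ℂ) + 2) ≠ 0 := by
  have h1 : ((n : ℂ) + 2) ≠ 0 := by exact_mod_cast (by omega : n + 2 ≠ 0)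
  have h2 : (m : ℂ) ≠ 0 := by exact_mod_cast (by omega : m ≠ 0)
  simp [h1, h2]

/-- A value of `h(p, ȳ)` on a 3-form that has bidegree `(a, b)` with `b ≥ 1` is also attained on
`ℋ(y, p̄) ψ` for some `ψ`. -/
theorem exists_hOp_p_ybar_H3Op_eq {ω : Form R M} {a b : ℕ} (hb : 1 ≤ b)
    (hω : ∀ d, MvPowerSeries.coeff d ω ∈ ⋀[R]^3 M)
    (hs : SupportedOn (fun m n => m = a ∧ n = b) (hOp h p ybar ω)) :
    ∃ ψ ∈ bihom R M a b, hOp h p ybar (H3Op h y pbar ψ) = hOp h p ybar ω := by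
  obtain ⟨g, hg, e⟩ := exists_hOp_eq_form4 h commutingSpinors_p_ybar (fun α _ => p_mem_functions α)
    (fun α _ => ybar_mem_functions α) hω
  have hi := SupportedOn.indicator (fun m n => m = a ∧ n = b) g
  refine ⟨numFun (fun m n => (-3 * (m + 2) * n)⁻¹) (numFun (ind fun m n => m = a ∧ n = b) g),
    mem_bihom_iff.mpr ⟨numFun_mem_functions _ (numFun_mem_functions _ hg), hi.numFun _⟩, ?_⟩
  rw [hOp_p_ybar_H3Op, numFun_numFun, hi.numFun_eq_self, ← numFun_form4, ← e]
  · exact hs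
  · exact fun m n hc => mul_inv_cancel₀ (left_factor_ne_zero m n (by omega))

/-- A value of `h(y, p̄)` on a 3-form that has bidegree `(a, b)` with `a ≥ 1` is also attained on
`ℋ(p, ȳ) ψ` for some `ψ`. -/
theorem exists_hOp_y_pbar_H3Op_eq {ω : Form R M} {a b : ℕ} (ha : 1 ≤ a)
    (hω : ∀ d, MvPowerSeries.coeff d ω ∈ ⋀[R]^3 M)
    (hs : SupportedOn (fun m n => m = a ∧ n = b) (hOp h y pbar ω)) :
    ∃ ψ ∈ bihom R M a b, hOp h y pbar (H3Op h p ybar ψ) = hOp h y pbar ω := by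
  obtain ⟨g, hg, e⟩ := exists_hOp_eq_form4 h commutingSpinors_y_pbar (fun α _ => y_mem_functions α)
    (fun α _ => pbar_mem_functions α) hω
  have hi := SupportedOn.indicator (fun m n => m = a ∧ n = b) g
  refine ⟨numFun (fun m n => (-3 * m * (n + 2))⁻¹) (numFun (ind fun m n => m = a ∧ n = b) g),
    mem_bihom_iff.mpr ⟨numFun_mem_functions _ (numFun_mem_functions _ hg), hi.numFun _⟩, ?_⟩
  rw [hOp_y_pbar_H3Op, numFun_numFun, hi.numFun_eq_self, ← numFun_form4, ← e]
  · exact hs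
  · exact fun m n hc => mul_inv_cancel₀ (right_factor_ne_zero m n (by omega))

/-- On functions with equal degrees in `y` and `ȳ` the two composites agree. -/
theorem hOp_y_pbar_H3Op_eq {k : ℕ} {ψ : Form R M} (hψ : ψ ∈ bihom R M k k) :
    hOp h y pbar (H3Op h p ybar ψ) = hOp h p ybar (H3Op h y pbar ψ) := by
  rw [hOp_y_pbar_H3Op, hOp_p_ybar_H3Op, (mem_bihom_iff.mp hψ).2.numFun_congr]
  intro m n hc
  rw [hc.1, hc.2]
  ring

/-- A 3-form closed under `h(p, ȳ)` is `Σ₋`-exact if the potentials in the `ω` sector and in the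
`C` sector have only bidegrees where `Σ₋` acts by `h(p, ȳ)` and by `H(p, p)`, respectively. -/
theorem mem_range_of_hOp_p_ybar_eq_zero (hη : η ≠ 0) {c : ℤ → ℤ → Prop} {ω : Form R M}
    (hω : ∀ d, MvPowerSeries.coeff d ω ∈ ⋀[R]^3 M) (hs : SupportedOn c ω)
    (h1 : ∀ m n : ℕ, c (m - 1) (n + 1) → (n : ℤ) + 2 ≤ m) (h2 : ∀ m n : ℕ, c (m - 2) n → m ≠ 0)
    (H : hOp h p ybar ω = 0) :
    ((ω, 0) : Form R M × Form R M) ∈ LinearMap.range (sigmaMinus h η) := by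
  obtain ⟨ω', C', e, hC'⟩ := exists_hOp_p_ybar_eq h hω H
  have e' := congrArg (numFun (ind c)) e
  rw [hs, map_add, numFun_hOp_p_ybar, numFun_HOp_p] at e'
  have hC : SupportedOn (fun _ n => n = 0) C' := supportedOn_of_eq hC' fun m n h0 => by
    by_contra hn
    exact h0 (delta0_of_ne hn)
  refine ⟨(cst R (-Complex.I) • numFun (fun m n => ind c (m - 1) (n + 1)) ω',
    cst R (Complex.I / 2 * starRingEnd ℂ η)⁻¹ • numFun (fun m n => ind c (m - 2) n) C'), ?_⟩
  rw [sigmaMinus_left, map_smul, map_smul, cst_smul_cancel (by simp),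
    cst_smul_cancel (mul_inv_cancel₀ (half_I_mul_ne_zero (conj_ne_zero hη))), e']
  · refine (SupportedOn.numFun_of_ne_zero (fun m n h0 => h1 m n ?_) _).smul _
    by_contra hc
    exact h0 (if_neg hc)
  · refine (((hC.numFun _).and (SupportedOn.numFun_of_ne_zero (c := fun m _ => m ≠ 0)
      (fun m n h0 => ?_) _))).smul _
    have := h2 m n (by
      by_contra hc
      exact h0 (if_neg hc))
    exact_mod_cast this

/-- A 3-form closed under `h(y, p̄)` is `Σ₋`-exact if the potentials in the `ω` sector and in the
`C` sector have only bidegrees where `Σ₋` acts by `h(y, p̄)` and by `H̄(p̄, p̄)`, respectively. -/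
theorem mem_range_of_hOp_y_pbar_eq_zero (hη : η ≠ 0) {c : ℤ → ℤ → Prop} {ω : Form R M}
    (hω : ∀ d, MvPowerSeries.coeff d ω ∈ ⋀[R]^3 M) (hs : SupportedOn c ω)
    (h1 : ∀ m n : ℕ, c (m + 1) (n - 1) → (m : ℤ) + 2 ≤ n) (h2 : ∀ m n : ℕ, c m (n - 2) → n ≠ 0)
    (H : hOp h y pbar ω = 0) :
    ((ω, 0) : Form R M × Form R M) ∈ LinearMap.range (sigmaMinus h η) := by
  obtain ⟨ω', C', e, hC'⟩ := exists_hOp_y_pbar_eq h hω H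
  have e' := congrArg (numFun (ind c)) e
  rw [hs, map_add, numFun_hOp_y_pbar, numFun_HbarOp_pbar] at e'
  have hC : SupportedOn (fun m _ => m = 0) C' := supportedOn_of_eq hC' fun m n h0 => by
    by_contra hn
    exact h0 (delta0_of_ne hn)
  refine ⟨(cst R (-Complex.I) • numFun (fun m n => ind c (m + 1) (n - 1)) ω',
    cst R (Complex.I / 2 * η)⁻¹ • numFun (fun m n => ind c m (n - 2)) C'), ?_⟩
  rw [sigmaMinus_right, map_smul, map_smul, cst_smul_cancel (by simp),
    cst_smul_cancel (mul_inv_cancel₀ (half_I_mul_ne_zero hη)), e']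
  · refine (SupportedOn.numFun_of_ne_zero (fun m n h0 => h1 m n ?_) _).smul _
    by_contra hc
    exact h0 (if_neg hc)
  · refine (((hC.numFun _).and (SupportedOn.numFun_of_ne_zero (c := fun _ n => n ≠ 0)
      (fun m n h0 => ?_) _))).smul _
    have := h2 m n (by
      by_contra hc
      exact h0 (if_neg hc))
    exact_mod_cast this

/-- A 3-form all of whose terms have equal positive degrees in `y` and `ȳ` is exact. -/
theorem mem_range_of_center (η : ℂ) {ω : Form R M} (hω : ∀ d, MvPowerSeries.coeff d ω ∈ ⋀[R]^3 M)
    (hs : SupportedOn (fun m n => m = n ∧ 1 ≤ m) ω) :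
    ((ω, 0) : Form R M × Form R M) ∈ LinearMap.range (sigmaMinus h η) := by
  obtain ⟨ω', ω'', e⟩ := exists_hOp_add_hOp_eq h hω (hs.numFun_eq_self fun m n hc => by
    rw [delta0_of_ne (by omega), sub_zero])
  have e' := congrArg (numFun (ind fun m n => m = n ∧ 1 ≤ m)) e
  rw [hs, map_add, numFun_hOp_p_ybar, numFun_hOp_y_pbar] at e'
  refine mem_of_cst_smul_mem Complex.I_ne_zero
    ⟨(numFun (fun m n => ind (fun m n => m = n ∧ 1 ≤ m) (m - 1) (n + 1)) ω', 0) +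
      (numFun (fun m n => ind (fun m n => m = n ∧ 1 ≤ m) (m + 1) (n - 1)) ω'', 0), ?_⟩
  rw [map_add, sigmaMinus_left, sigmaMinus_right]
  · simp only [map_zero, smul_zero, add_zero, Prod.mk_add_mk, Prod.smul_mk, ← smul_add, e']
  · refine SupportedOn.numFun_of_ne_zero (fun m n h0 => ?_) _
    by_contra hc
    exact h0 (if_neg (by omega))
  · exact zero_supportedOn _
  · refine SupportedOn.numFun_of_ne_zero (fun m n h0 => ?_) _
    by_contra hc
    exact h0 (if_neg (by omega))
  · exact zero_supportedOn _

/-- The class of a 3-form with more `y` than `ȳ` is determined by its image under `h(p, ȳ)`. -/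
theorem sub_H3Op_y_pbar_mem_range (hη : η ≠ 0) {a b : ℕ} {ω ψ : Form R M} (hab : b ≤ a + 1)
    (hω : ∀ d, MvPowerSeries.coeff d ω ∈ ⋀[R]^3 M) (hs : SupportedOn (fun m n => n < m) ω)
    (hψ : ψ ∈ bihom R M a b) (H : hOp h p ybar (H3Op h y pbar ψ) = hOp h p ybar ω) :
    ((ω - H3Op h y pbar ψ, 0) : Form R M × Form R M) ∈ LinearMap.range (sigmaMinus h η) := by
  obtain ⟨hf, hψs⟩ := mem_bihom_iff.mp hψ
  refine mem_range_of_hOp_p_ybar_eq_zero h hη (c := fun m n => n < m)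
    (coeff_sub_mem hω (coeff_H3Op_y_pbar_mem h hf))
    (hs.sub (hψs.H3Op_y_pbar h fun m n hc => by omega)) (fun m n hc => by omega)
    (fun m n hc => by omega) ?_
  rw [map_sub, H, sub_self]

/-- The class of a 3-form with more `ȳ` than `y` is determined by its image under `h(y, p̄)`. -/
theorem sub_H3Op_p_ybar_mem_range (hη : η ≠ 0) {a b : ℕ} {ω ψ : Form R M} (hab : a ≤ b + 1)
    (hω : ∀ d, MvPowerSeries.coeff d ω ∈ ⋀[R]^3 M) (hs : SupportedOn (fun m n => m < n) ω)
    (hψ : ψ ∈ bihom R M a b) (H : hOp h y pbar (H3Op h p ybar ψ) = hOp h y pbar ω) :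
    ((ω - H3Op h p ybar ψ, 0) : Form R M × Form R M) ∈ LinearMap.range (sigmaMinus h η) := by
  obtain ⟨hf, hψs⟩ := mem_bihom_iff.mp hψ
  refine mem_range_of_hOp_y_pbar_eq_zero h hη (c := fun m n => m < n)
    (coeff_sub_mem hω (coeff_H3Op_p_ybar_mem h hf))
    (hs.sub (hψs.H3Op_p_ybar h fun m n hc => by omega)) (fun m n hc => by omega)
    (fun m n hc => by omega) ?_
  rw [map_sub, H, sub_self]

theorem supportedOn_sigmaOmegaOmega (f : Form R M) :
    SupportedOn (fun m n => m ≠ 0 ∧ n ≠ 0) (sigmaOmegaOmega h f) := by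
  have e1 : SupportedOn (fun m n => n + 2 ≤ m) (numFun (fun n nb => theta (n - nb - 1)) f) :=
    SupportedOn.numFun_of_ne_zero (fun m n h0 => by
      by_contra hc
      exact h0 (theta_of_nonpos (by omega))) f
  have e2 : SupportedOn (fun m n => m + 2 ≤ n) (numFun (fun n nb => theta (nb - n - 1)) f) :=
    SupportedOn.numFun_of_ne_zero (fun m n h0 => by
      by_contra hc
      exact h0 (theta_of_nonpos (by omega))) f
  rw [sigmaOmegaOmega_apply]
  exact ((e1.hOp_p_ybar h fun m n hc => by omega).add
    (e2.hOp_y_pbar h fun m n hc => by omega)).smul _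

/-- Every cocycle is equivalent to a sum of a cocycle in the `ω` sector and a cocycle in the `C`
sector of the form `H(y, y) φ(y) + H̄(ȳ, ȳ) χ(ȳ)`. -/
theorem exists_reduced_cocycle {t : ℕ} {w : Form R M × Form R M} (hw : w ∈ cocycles h η 3 t) :
    ∃ ω φ χ, w - (ω, HOp h y y φ + HbarOp h ybar ybar χ) ∈ LinearMap.range (sigmaMinus h η) ∧
      (∀ d, MvPowerSeries.coeff d ω ∈ ⋀[R]^3 M) ∧
      SupportedOn (fun m n => m + n + 2 = t) ω ∧ sigmaOmegaOmega h ω = 0 ∧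
      φ ∈ functions R M ∧ χ ∈ functions R M ∧
      SupportedOn (fun m n => n = 0 ∧ m + 2 = t) φ ∧
      SupportedOn (fun m n => m = 0 ∧ n + 2 = t) χ ∧
      cst R (starRingEnd ℂ η) • form4 h (numFun (fun m _ => -(m + 2) * (m + 3)) φ) =
        cst R η • form4 h (numFun (fun _ n => -(n + 2) * (n + 3)) χ) := by
  obtain ⟨ω, C⟩ := w
  obtain ⟨hw, hker⟩ := hw
  have hker' := LinearMap.mem_ker.mp hker
  rw [sigmaMinus_apply] at hker'
  have hCC : sigmaCC h C = 0 := congrArg Prod.snd hker'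
  have hω0 : sigmaOmegaOmega h ω + sigmaOmegaC h η C = 0 := congrArg Prod.fst hker'
  obtain ⟨C', φ, χ, hC', e, hφ, hχ, hφs, hχs⟩ := exists_sigmaCC_eq_of_two h
    (mem_rankOne.mpr ⟨map_zero _, (mem_rankOne.mp hw).2⟩) hCC
  have hsub := (mem_rankOne_iff.mp (sub_mem hw (sigmaMinus_mem h η hC'))).1
  have hsum : sigmaOmegaOmega h (ω - sigmaOmegaC h η C') +
      cst R (Complex.I / 2) • (cst R (starRingEnd ℂ η) •
        form4 h (numFun (fun m _ => -(m + 2) * (m + 3)) φ) -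
          cst R η • form4 h (numFun (fun _ n => -(n + 2) * (n + 3)) χ)) = 0 := by
    have e1 := eq_neg_of_add_eq_zero_left (sigmaOmegaOmega_sigmaOmegaC_add h η C')
    rw [← hω0, e, map_sub, e1, map_add, map_add,
      sigmaOmegaC_HOp_y h η (hφs.mono fun m n hc => hc.1),
      sigmaOmegaC_HbarOp_ybar h η (hχs.mono fun m n hc => hc.1), smul_sub, smul_smul, smul_smul,
      ← cst_mul, ← cst_mul, smul_neg]
    abel
  -- the two summands have disjoint supports
  have hsOO := supportedOn_sigmaOmegaOmega h (ω - sigmaOmegaC h η C')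
  have hzero : sigmaOmegaOmega h (ω - sigmaOmegaC h η C') = 0 := by
    generalize sigmaOmegaOmega h (ω - sigmaOmegaC h η C') = X at hsum hsOO ⊢
    have := congrArg (numFun (ind fun m n => m ≠ 0 ∧ n ≠ 0)) hsum
    rwa [map_add, hsOO, map_smul, map_sub, map_smul, map_smul,
      ((hφs.numFun _).form4 h).numFun_eq_zero, ((hχs.numFun _).form4 h).numFun_eq_zero, smul_zero,
      smul_zero, sub_zero, smul_zero, add_zero, map_zero] at this
    · exact fun m n hc => if_neg (by simp [hc.1])
    · exact fun m n hc => if_neg (by simp [hc.1])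
  refine ⟨ω - sigmaOmegaC h η C', φ, χ, ⟨(0, C'), ?_⟩, ?_, ?_, hzero, hφ, hχ, hφs, hχs, ?_⟩
  · rw [e, sigmaMinus_apply]
    simp
  · simpa [sigmaMinus_apply] using hsub.1
  · simpa [sigmaMinus_apply] using hsub.2
  · rw [hzero, zero_add] at hsum
    exact sub_eq_zero.mp (cst_smul_eq_zero (div_ne_zero Complex.I_ne_zero two_ne_zero) hsum)

/-- Except in spin one, every cocycle is equivalent to a cocycle in the `ω` sector. -/
theorem exists_cocycle_omega (hη : η ≠ 0) {t : ℕ} (ht : t ≠ 2) {w : Form R M × Form R M}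
    (hw : w ∈ cocycles h η 3 t) :
    ∃ ω, w - (ω, 0) ∈ LinearMap.range (sigmaMinus h η) ∧
      (∀ d, MvPowerSeries.coeff d ω ∈ ⋀[R]^3 M) ∧
      SupportedOn (fun m n => m + n + 2 = t) ω ∧ sigmaOmegaOmega h ω = 0 := by
  obtain ⟨ω, φ, χ, hr, hω, hs, h0, hφ, hχ, hφs, hχs, e⟩ := exists_reduced_cocycle h hw
  -- for `t ≠ 2` the two sides of `e` have disjoint supports
  have hφ0 : φ = 0 := by
    refine eq_zero_of_form4_numFun_eq_zero h hφ hφs (φ := fun m _ => -(m + 2) * (m + 3))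
      (fun m n _ => neg_mul_add_three_ne_zero m) (cst_smul_eq_zero (R := R) (conj_ne_zero hη) ?_)
    have := (((hφs.numFun fun m _ => -(m + 2) * (m + 3)).form4 h).smul
      (cst R (starRingEnd ℂ η))).and
      (e ▸ ((hχs.numFun fun _ n => -(n + 2) * (n + 3)).form4 h).smul (cst R η))
    exact this.eq_zero fun m n hc => by omega
  have hχ0 : χ = 0 := by
    refine eq_zero_of_form4_numFun_eq_zero h hχ hχs (φ := fun _ n => -(n + 2) * (n + 3))
      (fun m n _ => neg_mul_add_three_ne_zero n) (cst_smul_eq_zero (R := R) hη ?_)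
    rw [← e, hφ0, map_zero, form4_zero, smul_zero]
  refine ⟨ω, ?_, hω, hs, h0⟩
  simpa [hφ0, hχ0] using hr

end ThreeForms

/-! ### The cohomology at the 3-forms: low spins -/

section ThirdCohomology

variable {R M : Type*} [CommRing R] [Algebra ℂ R] [AddCommGroup M] [Module R M]
variable (h : Module.Basis (Fin 2 × Fin 2) R M) {η : ℂ}

theorem range_of_mem_coboundaries {q t : ℕ} {w : Form R M × Form R M}
    (hw : w ∈ coboundaries h η (q + 1) t) : w ∈ LinearMap.range (sigmaMinus h η) := by
  obtain ⟨w', -, e⟩ := hw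
  exact ⟨w', e⟩

theorem subsingleton_cohomology {q t : ℕ} (H : cocycles h η q t ≤ coboundaries h η q t) :
    Subsingleton (Cohomology h η q t) := by
  rw [Submodule.Quotient.subsingleton_iff, Submodule.submoduleOf_eq_top]
  exact H

/-- Representatives of the cohomology: it suffices that they are cocycles, that none but zero is a
coboundary, and that every cocycle is equivalent to one of them in the space of all pairs of
series. -/
theorem representedBy_of_linear {q t : ℕ} {N : Type*} [AddCommGroup N] [Module R N]
    {P : Submodule R N} {rep : N → Form R M × Form R M} (L : N →ₗ[R] Form R M × Form R M)
    (hL : ∀ ψ, L ψ = rep ψ) (hz : ∀ ψ ∈ P, rep ψ ∈ cocycles h η (q + 2) t)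
    (inj : ∀ ψ ∈ P, rep ψ ∈ LinearMap.range (sigmaMinus h η) → ψ = 0)
    (surj : ∀ w ∈ cocycles h η (q + 2) t,
      ∃ ψ ∈ P, w - rep ψ ∈ LinearMap.range (sigmaMinus h η)) :
    RepresentedBy h η (q + 2) t P rep := by
  obtain rfl : rep = L := funext fun ψ => (hL ψ).symm
  let Z : P →ₗ[R] cocycles h η (q + 2) t := L.restrict hz
  let F : P →ₗ[R] Cohomology h η (q + 2) t := Submodule.mkQ _ ∘ₗ Z
  have hF : Function.Bijective F := by
    constructor
    · refine (injective_iff_map_eq_zero F).mpr fun ψ hψ => Subtype.ext ?_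
      have hmem := (Submodule.Quotient.mk_eq_zero _).mp hψ
      exact inj ψ ψ.2 (range_of_mem_coboundaries h (q := q + 1) hmem)
    · intro x
      obtain ⟨w, rfl⟩ := Submodule.Quotient.mk_surjective _ x
      obtain ⟨ψ, hψ, hr⟩ := surj w w.2
      refine ⟨⟨ψ, hψ⟩, ((Submodule.Quotient.eq _).mpr ?_).symm⟩
      exact mem_coboundaries h η (sub_mem w.2.1 (hz ψ hψ).1) hr
  exact ⟨LinearEquiv.ofBijective F hF, fun ψ => ⟨hz ψ ψ.2, rfl⟩⟩

/-- The part of an exact 3-form of the `ω` sector with more `y` than `ȳ` is closed under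
`h(p, ȳ)`. -/
theorem hOp_p_ybar_of_mem_range {ω C : Form R M}
    (H : ((ω, C) : Form R M × Form R M) ∈ LinearMap.range (sigmaMinus h η)) :
    hOp h p ybar (numFun (ind fun m n => n < m) ω) = 0 := by
  obtain ⟨⟨ω', C'⟩, e⟩ := H
  have e1 : sigmaOmegaOmega h ω' + sigmaOmegaC h η C' = ω := congrArg Prod.fst e
  have s1 : SupportedOn (fun m n => m ≤ n)
      (hOp h y pbar (numFun (fun n nb => theta (nb - n - 1)) ω')) :=
    (SupportedOn.numFun_of_ne_zero (c := fun m n => m + 2 ≤ n) (fun m n h0 => by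
      by_contra hc
      exact h0 (theta_of_nonpos (by omega))) ω').hOp_y_pbar h fun m n hc => by omega
  have s2 : SupportedOn (fun m n => m ≤ n)
      (HbarOp h pbar pbar (numFun (fun m _ => delta0 m) C')) := by
    have s3 := (SupportedOn.numFun_of_ne_zero (φ := fun m _ => delta0 m)
      (c := fun m _ => m = 0) (fun m n h0 => by
      by_contra hc
      exact h0 (delta0_of_ne hc)) C').HbarOp_pbar h (c' := fun m _ => m = 0) fun m n hc => hc
    exact s3.mono fun m n hc => by omega
  have z1 := s1.numFun_eq_zero (φ := ind fun m n => n < m) fun m n hc => if_neg hc.not_gt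
  have z2 := s2.numFun_eq_zero (φ := ind fun m n => n < m) fun m n hc => if_neg hc.not_gt
  rw [← e1, sigmaOmegaOmega_apply, sigmaOmegaC_apply]
  simp only [map_add, map_smul, z1, z2, numFun_hOp_p_ybar, numFun_HOp_p,
    hOp_hOp h commutingSpinors_p_ybar, hOp_HOp h commutingSpinors_p_ybar, map_zero, smul_zero,
    add_zero]

/-- The part of an exact 3-form of the `ω` sector with more `ȳ` than `y` is closed under
`h(y, p̄)`. -/
theorem hOp_y_pbar_of_mem_range {ω C : Form R M}
    (H : ((ω, C) : Form R M × Form R M) ∈ LinearMap.range (sigmaMinus h η)) :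
    hOp h y pbar (numFun (ind fun m n => m < n) ω) = 0 := by
  obtain ⟨⟨ω', C'⟩, e⟩ := H
  have e1 : sigmaOmegaOmega h ω' + sigmaOmegaC h η C' = ω := congrArg Prod.fst e
  have s1 : SupportedOn (fun m n => n ≤ m)
      (hOp h p ybar (numFun (fun n nb => theta (n - nb - 1)) ω')) :=
    (SupportedOn.numFun_of_ne_zero (c := fun m n => n + 2 ≤ m) (fun m n h0 => by
      by_contra hc
      exact h0 (theta_of_nonpos (by omega))) ω').hOp_p_ybar h fun m n hc => by omega
  have s2 : SupportedOn (fun m n => n ≤ m)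
      (HOp h p p (numFun (fun _ n => delta0 n) C')) := by
    have s3 := (SupportedOn.numFun_of_ne_zero (φ := fun _ n => delta0 n)
      (c := fun _ n => n = 0) (fun m n h0 => by
      by_contra hc
      exact h0 (delta0_of_ne hc)) C').HOp_p h (c' := fun _ n => n = 0) fun m n hc => hc
    exact s3.mono fun m n hc => by omega
  have z1 := s1.numFun_eq_zero (φ := ind fun m n => m < n) fun m n hc => if_neg hc.not_gt
  have z2 := s2.numFun_eq_zero (φ := ind fun m n => m < n) fun m n hc => if_neg hc.not_gt
  rw [← e1, sigmaOmegaOmega_apply, sigmaOmegaC_apply]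
  simp only [map_add, map_smul, z1, z2, numFun_hOp_y_pbar, numFun_HbarOp_pbar,
    hOp_hOp h commutingSpinors_y_pbar, hOp_HbarOp h commutingSpinors_y_pbar, map_zero, smul_zero,
    add_zero]

/-- For spin less than one there are no fields in the `ω` sector. -/
theorem cocycles_three_le (hη : η ≠ 0) {t : ℕ} (ht : t < 2) :
    cocycles h η 3 t ≤ coboundaries h η 3 t := by
  intro w hw
  refine mem_coboundaries h η hw.1 ?_
  obtain ⟨ω, hr, -, hs, -⟩ := exists_cocycle_omega h hη (by omega) hw
  obtain rfl := hs.eq_zero fun m n => by omega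
  rwa [Prod.mk_zero_zero, sub_zero] at hr

theorem representedBy_spin_one (hη : η ≠ 0) :
    RepresentedBy h η 3 2 (bihom R M 0 0)
      (fun ψ => (0, cst R η • HOp h y y ψ +
        cst R (starRingEnd ℂ η) • HbarOp h ybar ybar ψ)) := by
  refine representedBy_of_linear h (q := 1) (LinearMap.inr R _ _ ∘ₗ
    (cst R η • HOp h y y + cst R (starRingEnd ℂ η) • HbarOp h ybar ybar)) (fun ψ => rfl) ?_ ?_ ?_
  · intro ψ hψ
    obtain ⟨hf, hs⟩ := mem_bihom_iff.mp hψ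
    have hs1 : SupportedOn (fun _ n => n = 0) ψ := hs.mono fun m n hc => hc.2
    have hs2 : SupportedOn (fun m _ => m = 0) ψ := hs.mono fun m n hc => hc.1
    refine ⟨mem_rankOne_iff.mpr ⟨⟨fun d => zero_mem _, zero_supportedOn _⟩, fun d => ?_, ?_⟩,
      LinearMap.mem_ker.mpr ?_⟩
    · exact add_mem (Submodule.smul_mem _ _ (coeff_HOp_y_mem h hf d))
        (Submodule.smul_mem _ _ (coeff_HbarOp_ybar_mem h hf d))
    · refine ((hs.HOp_y h ?_).smul _).add ((hs.HbarOp_ybar h ?_).smul _) <;> intro m n hc <;>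
        rw [hc.1, hc.2] <;> rfl
    · have e : numFun (fun m _ => -(m + 2) * (m + 3)) ψ =
          numFun (fun _ n => -(n + 2) * (n + 3)) ψ := hs.numFun_congr fun m n hc => by
        rw [hc.1, hc.2]
      have e1 := hOp_p_pbar_HOp_y h (φ := ψ) (hs1.numFun_eq_self fun m n hc => by
        rw [hc, delta0_zero])
      have e2 := hOp_p_pbar_HbarOp_ybar h (φ := ψ) (hs2.numFun_eq_self fun m n hc => by
        rw [hc, delta0_zero])
      rw [sigmaMinus_apply]
      refine Prod.ext ?_ ?_
      · simp only [map_zero, zero_add, map_add, map_smul, sigmaOmegaC_HOp_y h η hs1,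
          sigmaOmegaC_HbarOp_ybar h η hs2, e, smul_neg, smul_smul, ← cst_mul]
        rw [show η * (Complex.I / 2 * starRingEnd ℂ η) = starRingEnd ℂ η * (Complex.I / 2 * η) by
          ring, add_neg_cancel]
        rfl
      · simp only [map_add, map_smul, sigmaCC_apply, e1, e2, smul_zero, add_zero]
        rfl
  · rintro ψ hψ ⟨⟨ω', C'⟩, e⟩
    obtain ⟨hf, hs⟩ := mem_bihom_iff.mp hψ
    have e1 : sigmaCC h C' = cst R η • HOp h y y ψ +
      cst R (starRingEnd ℂ η) • HbarOp h ybar ybar ψ := congrArg Prod.snd e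
    have e2 := congrArg (HOp h p p) e1
    rw [sigmaCC_apply, map_smul, HOp_hOp h commutingSpinors_p_pbar, map_add, map_smul, map_smul,
      HOp_p_HOp_y, HOp_p_HbarOp_ybar, smul_zero, smul_zero, add_zero] at e2
    exact eq_zero_of_form4_numFun_eq_zero h hf hs (φ := fun m _ => -(m + 2) * (m + 3))
      (fun m n _ => neg_mul_add_three_ne_zero m) (cst_smul_eq_zero (R := R) hη e2.symm)
  · intro w hw
    obtain ⟨ω, φ, χ, hr, hω, hs, h0, hφ, hχ, hφs, hχs, e⟩ := exists_reduced_cocycle h hw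
    have hs0 : SupportedOn (fun m n => m = 0 ∧ n = 0) ω := hs.mono fun m n hc => by omega
    have hφ0 : SupportedOn (fun m n => m = 0 ∧ n = 0) φ := hφs.mono fun m n hc => by omega
    have hχ0 : SupportedOn (fun m n => m = 0 ∧ n = 0) χ := hχs.mono fun m n hc => by omega
    have hωr := mem_range_of_hOp_p_ybar_eq_zero h hη hω hs0 (fun m n hc => by omega)
      (fun m n hc => by omega) ((hs0.hOp_p_ybar h (c' := fun m _ => m < 0)
        fun m n hc => by omega).eq_zero fun m n => by omega)
    have e6 : (-6 : ℂ) ≠ 0 := by norm_num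
    have e' : cst R (starRingEnd ℂ η) • φ = cst R η • χ := by
      rw [hφ0.numFun_congr (ψ := fun _ _ => -6) fun m n hc => by rw [hc.1]; norm_num,
        hχ0.numFun_congr (ψ := fun _ _ => -6) fun m n hc => by rw [hc.2]; norm_num, ← form4_smul,
        ← form4_smul, ← map_smul, ← map_smul, ← sub_eq_zero, ← form4_sub, ← map_sub] at e
      exact sub_eq_zero.mp (eq_zero_of_form4_numFun_eq_zero h
        (sub_mem (Submodule.smul_mem _ _ hφ) (Submodule.smul_mem _ _ hχ))
        ((hφ0.smul _).sub (hχ0.smul _)) (fun m n _ => e6) e)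
    refine ⟨cst R η⁻¹ • φ, Submodule.smul_mem _ _ (mem_bihom_iff.mpr ⟨hφ, hφ0⟩), ?_⟩
    have e3 : HOp h y y φ + HbarOp h ybar ybar χ = cst R η • HOp h y y (cst R η⁻¹ • φ) +
        cst R (starRingEnd ℂ η) • HbarOp h ybar ybar (cst R η⁻¹ • φ) := by
      rw [map_smul, map_smul, cst_smul_cancel (mul_inv_cancel₀ hη), smul_comm, ← map_smul, e',
        map_smul, smul_comm, cst_smul_cancel (mul_inv_cancel₀ hη)]
    have := add_mem hr hωr
    rwa [show w - (ω, HOp h y y φ + HbarOp h ybar ybar χ) + (ω, 0) =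
      w - (0, HOp h y y φ + HbarOp h ybar ybar χ) by
        ext1 <;> simp, e3] at this

end ThirdCohomology

/-! ### The cohomology at the 3-forms: higher spins -/

section HigherSpins

variable {R M : Type*} [CommRing R] [Algebra ℂ R] [AddCommGroup M] [Module R M]
variable (h : Module.Basis (Fin 2 × Fin 2) R M) {η : ℂ}

theorem omega_mem_cocycles {t : ℕ} {ω : Form R M} (hω : ∀ d, MvPowerSeries.coeff d ω ∈ ⋀[R]^3 M)
    (hs : SupportedOn (fun m n => m + n + 2 = t) ω) (H : sigmaOmegaOmega h ω = 0) :
    ((ω, 0) : Form R M × Form R M) ∈ cocycles h η 3 t := by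
  refine ⟨mem_rankOne_iff.mpr ⟨⟨hω, hs⟩, fun d => zero_mem _, zero_supportedOn _⟩,
    LinearMap.mem_ker.mpr ?_⟩
  rw [sigmaMinus_apply, H, map_zero, map_zero, add_zero]
  rfl

theorem eq_zero_of_H3Op_y_pbar_closed {a b : ℕ} (hb : 1 ≤ b) {ψ : Form R M}
    (hψ : ψ ∈ bihom R M a b) (H : hOp h p ybar (H3Op h y pbar ψ) = 0) : ψ = 0 := by
  obtain ⟨hf, hs⟩ := mem_bihom_iff.mp hψ
  rw [hOp_p_ybar_H3Op] at H
  exact eq_zero_of_form4_numFun_eq_zero h hf hs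
    (fun m n hc => left_factor_ne_zero m n (by omega)) H

theorem eq_zero_of_H3Op_p_ybar_closed {a b : ℕ} (ha : 1 ≤ a) {ψ : Form R M}
    (hψ : ψ ∈ bihom R M a b) (H : hOp h y pbar (H3Op h p ybar ψ) = 0) : ψ = 0 := by
  obtain ⟨hf, hs⟩ := mem_bihom_iff.mp hψ
  rw [hOp_y_pbar_H3Op] at H
  exact eq_zero_of_form4_numFun_eq_zero h hf hs
    (fun m n hc => right_factor_ne_zero m n (by omega)) H

/-- The two parts of the cocycle condition in the `ω` sector. -/
theorem hOp_add_hOp_of_sigmaOmegaOmega {ω : Form R M} (H : sigmaOmegaOmega h ω = 0) :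
    hOp h p ybar (numFun (ind fun m n => n + 2 ≤ m) ω) =
      -hOp h y pbar (numFun (ind fun m n => m + 2 ≤ n) ω) := by
  have e1 : numFun (fun n nb => theta (n - nb - 1)) ω = numFun (ind fun m n => n + 2 ≤ m) ω := by
    refine numFun_apply_congr (fun m n => ?_) ω
    simp only [theta, ind]
    congr 1
    exact propext (by omega)
  have e2 : numFun (fun n nb => theta (nb - n - 1)) ω = numFun (ind fun m n => m + 2 ≤ n) ω := by
    refine numFun_apply_congr (fun m n => ?_) ω
    simp only [theta, ind]
    congr 1
    exact propext (by omega)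
  rw [sigmaOmegaOmega_apply, e1, e2] at H
  exact eq_neg_of_add_eq_zero_left (cst_smul_eq_zero (R := R) Complex.I_ne_zero H)

theorem hOp_p_ybar_indicator_supportedOn {t : ℕ} {ω : Form R M}
    (hs : SupportedOn (fun m n => m + n + 2 = t) ω) :
    SupportedOn (fun m n => n ≤ m ∧ m + n + 2 = t)
      (hOp h p ybar (numFun (ind fun m n => n + 2 ≤ m) ω)) :=
  ((SupportedOn.indicator _ ω).and (hs.numFun _)).hOp_p_ybar h fun m n hc => by omega

theorem hOp_y_pbar_indicator_supportedOn {t : ℕ} {ω : Form R M}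
    (hs : SupportedOn (fun m n => m + n + 2 = t) ω) :
    SupportedOn (fun m n => m ≤ n ∧ m + n + 2 = t)
      (hOp h y pbar (numFun (ind fun m n => m + 2 ≤ n) ω)) :=
  ((SupportedOn.indicator _ ω).and (hs.numFun _)).hOp_y_pbar h fun m n hc => by omega

theorem representedBy_integer_spin (hη : η ≠ 0) {k : ℕ} (hk : 1 ≤ k) :
    RepresentedBy h η 3 (2 * k + 2) (bihom R M k k)
      (fun ψ => (H3Op h y pbar ψ - H3Op h p ybar ψ, 0)) := by
  refine representedBy_of_linear h (q := 1) (LinearMap.inl R _ _ ∘ₗ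
    (H3Op h y pbar - H3Op h p ybar)) (fun ψ => rfl) ?_ ?_ ?_
  · intro ψ hψ
    obtain ⟨hf, hs⟩ := mem_bihom_iff.mp hψ
    refine omega_mem_cocycles h
      (coeff_sub_mem (coeff_H3Op_y_pbar_mem h hf) (coeff_H3Op_p_ybar_mem h hf))
      ((hs.H3Op_y_pbar h fun m n hc => by push_cast; omega).sub
        (hs.H3Op_p_ybar h fun m n hc => by push_cast; omega)) ?_
    rw [map_sub, sigmaOmegaOmega_of_left h (hs.H3Op_y_pbar h fun m n hc => by omega),
      sigmaOmegaOmega_of_right h (hs.H3Op_p_ybar h fun m n hc => by omega),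
      hOp_y_pbar_H3Op_eq h hψ, sub_self]
  · intro ψ hψ hr
    obtain ⟨hf, hs⟩ := mem_bihom_iff.mp hψ
    have s1 : SupportedOn (fun m n => n < m) (H3Op h y pbar ψ) :=
      hs.H3Op_y_pbar h fun m n hc => by omega
    have s2 : SupportedOn (fun m n => m < n) (H3Op h p ybar ψ) :=
      hs.H3Op_p_ybar h fun m n hc => by omega
    have := hOp_p_ybar_of_mem_range h hr
    rw [map_sub, s1, s2.numFun_eq_zero fun m n hc => if_neg hc.not_gt, sub_zero] at this
    exact eq_zero_of_H3Op_y_pbar_closed h hk hψ this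
  · intro w hw
    obtain ⟨ω, hr, hω, hs, h0⟩ := exists_cocycle_omega h hη (by omega) hw
    have e := hOp_add_hOp_of_sigmaOmegaOmega h h0
    have hP := hOp_p_ybar_indicator_supportedOn h hs
    have hQ := hOp_y_pbar_indicator_supportedOn h hs
    -- the common value of both sides of `e` has equal degrees in `y` and `ȳ`
    have hPs : SupportedOn (fun m n => m = k ∧ n = k)
        (hOp h p ybar (numFun (ind fun m n => n + 2 ≤ m) ω)) :=
      (hP.and (e ▸ hQ.neg)).mono fun m n hc => by
        push_cast at hc
        omega
    obtain ⟨ψ, hψ, eψ⟩ := exists_hOp_p_ybar_H3Op_eq h hk (coeff_numFun_mem _ hω) hPs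
    have r1 := sub_H3Op_y_pbar_mem_range h hη (by omega) (coeff_numFun_mem _ hω)
      ((SupportedOn.indicator _ ω).mono fun m n hc => by omega) hψ eψ
    have r2 := sub_H3Op_p_ybar_mem_range h hη (by omega)
      (coeff_numFun_mem (ind fun m n => m + 2 ≤ n) hω)
      ((SupportedOn.indicator _ ω).mono fun m n hc => by omega) (neg_mem hψ) (by
        rw [map_neg, map_neg, hOp_y_pbar_H3Op_eq h hψ, eψ, e, neg_neg])
    have r3 := mem_range_of_center h η (coeff_numFun_mem (ind fun m n => m = n ∧ 1 ≤ m) hω)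
      (SupportedOn.indicator _ ω)
    have hsum : numFun (ind fun m n => n + 2 ≤ m) ω + numFun (ind fun m n => m + 2 ≤ n) ω +
        numFun (ind fun m n => m = n ∧ 1 ≤ m) ω = ω := by
      rw [numFun_add_numFun, numFun_add_numFun]
      refine hs.numFun_eq_self fun m n hc => ?_
      push_cast at hc
      simp only [ind]
      split_ifs <;> first | omega | norm_num
    refine ⟨ψ, hψ, ?_⟩
    convert add_mem hr (add_mem (add_mem r1 r2) r3) using 1
    ext1
    · simp only [Prod.fst_sub, Prod.fst_add, map_neg]
      rw [show w.1 - ω = w.1 - (numFun (ind fun m n => n + 2 ≤ m) ω +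
        numFun (ind fun m n => m + 2 ≤ n) ω + numFun (ind fun m n => m = n ∧ 1 ≤ m) ω) by
        rw [hsum]]
      abel
    · simp

theorem representedBy_halfInteger_spin (hη : η ≠ 0) (k : ℕ) :
    RepresentedBy h η 3 (2 * k + 3) ((bihom R M k (k + 1)).prod (bihom R M (k + 1) k))
      (fun ψ => (H3Op h y pbar ψ.1 + H3Op h p ybar ψ.2, 0)) := by
  refine representedBy_of_linear h (q := 1) (LinearMap.inl R _ _ ∘ₗ
    (H3Op h y pbar).coprod (H3Op h p ybar)) (fun ψ => rfl) ?_ ?_ ?_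
  · rintro ⟨ψ, ψ'⟩ ⟨hψ, hψ'⟩
    obtain ⟨hf, hs⟩ := mem_bihom_iff.mp hψ
    obtain ⟨hf', hs'⟩ := mem_bihom_iff.mp hψ'
    refine omega_mem_cocycles h
      (fun d => add_mem (coeff_H3Op_y_pbar_mem h hf d) (coeff_H3Op_p_ybar_mem h hf' d))
      ((hs.H3Op_y_pbar h fun m n hc => by push_cast at hc ⊢; omega).add
        (hs'.H3Op_p_ybar h fun m n hc => by push_cast at hc ⊢; omega))
      (sigmaOmegaOmega_of_center h ((hs.H3Op_y_pbar h fun m n hc => by push_cast at hc; omega).add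
        (hs'.H3Op_p_ybar h fun m n hc => by push_cast at hc; omega)))
  · rintro ⟨ψ, ψ'⟩ ⟨hψ, hψ'⟩ hr
    obtain ⟨hf, hs⟩ := mem_bihom_iff.mp hψ
    obtain ⟨hf', hs'⟩ := mem_bihom_iff.mp hψ'
    have s1 : SupportedOn (fun m n => n < m) (H3Op h y pbar ψ) :=
      hs.H3Op_y_pbar h fun m n hc => by push_cast at hc; omega
    have s2 : SupportedOn (fun m n => m < n) (H3Op h p ybar ψ') :=
      hs'.H3Op_p_ybar h fun m n hc => by push_cast at hc; omega
    have e1 := hOp_p_ybar_of_mem_range h hr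
    have e2 := hOp_y_pbar_of_mem_range h hr
    rw [map_add, s1, s2.numFun_eq_zero fun m n hc => if_neg hc.not_gt, add_zero] at e1
    rw [map_add, s2, s1.numFun_eq_zero fun m n hc => if_neg hc.not_gt, zero_add] at e2
    exact Prod.ext (eq_zero_of_H3Op_y_pbar_closed h (by omega) hψ e1)
      (eq_zero_of_H3Op_p_ybar_closed h (by omega) hψ' e2)
  · intro w hw
    obtain ⟨ω, hr, hω, hs, h0⟩ := exists_cocycle_omega h hη (by omega) hw
    have e := hOp_add_hOp_of_sigmaOmegaOmega h h0
    have hP := hOp_p_ybar_indicator_supportedOn h hs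
    have hQ := hOp_y_pbar_indicator_supportedOn h hs
    -- the supports of both sides of `e` are disjoint, since `m + n` is odd
    have hP0 := (hP.and (e ▸ hQ.neg)).eq_zero fun m n hc => by
      push_cast at hc
      omega
    have hQ0 := neg_eq_zero.mp (e.symm.trans hP0)
    have d1 : numFun (ind fun m n => n < m) ω = numFun (ind fun m n => n + 2 ≤ m) ω +
        numFun (ind fun m n => m = n + 1) ω := by
      rw [numFun_add_numFun]
      refine numFun_apply_congr (fun m n => ?_) ω
      simp only [ind]
      split_ifs <;> first | omega | norm_num
    have d2 : numFun (ind fun m n => m < n) ω = numFun (ind fun m n => m + 2 ≤ n) ω +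
        numFun (ind fun m n => n = m + 1) ω := by
      rw [numFun_add_numFun]
      refine numFun_apply_congr (fun m n => ?_) ω
      simp only [ind]
      split_ifs <;> first | omega | norm_num
    have hPs : SupportedOn (fun m n => m = k ∧ n = (k + 1 : ℕ))
        (hOp h p ybar (numFun (ind fun m n => n < m) ω)) := by
      rw [d1, map_add, hP0, zero_add]
      exact ((SupportedOn.indicator _ ω).and (hs.numFun _)).hOp_p_ybar h fun m n hc => by
        push_cast at hc ⊢
        omega
    have hQs : SupportedOn (fun m n => m = (k + 1 : ℕ) ∧ n = k)
        (hOp h y pbar (numFun (ind fun m n => m < n) ω)) := by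
      rw [d2, map_add, hQ0, zero_add]
      exact ((SupportedOn.indicator _ ω).and (hs.numFun _)).hOp_y_pbar h fun m n hc => by
        push_cast at hc ⊢
        omega
    obtain ⟨ψ, hψ, eψ⟩ := exists_hOp_p_ybar_H3Op_eq h (by omega) (coeff_numFun_mem _ hω) hPs
    obtain ⟨ψ', hψ', eψ'⟩ := exists_hOp_y_pbar_H3Op_eq h (by omega) (coeff_numFun_mem _ hω) hQs
    have r1 := sub_H3Op_y_pbar_mem_range h hη (by omega) (coeff_numFun_mem _ hω)
      (SupportedOn.indicator _ ω) hψ eψ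
    have r2 := sub_H3Op_p_ybar_mem_range h hη (by omega) (coeff_numFun_mem _ hω)
      (SupportedOn.indicator _ ω) hψ' eψ'
    have hsum : numFun (ind fun m n => n < m) ω + numFun (ind fun m n => m < n) ω = ω := by
      rw [numFun_add_numFun]
      refine hs.numFun_eq_self fun m n hc => ?_
      push_cast at hc
      simp only [ind]
      split_ifs <;> first | omega | norm_num
    refine ⟨(ψ, ψ'), ⟨hψ, hψ'⟩, ?_⟩
    convert add_mem hr (add_mem r1 r2) using 1
    ext1
    · simp only [Prod.fst_sub, Prod.fst_add]
      rw [show w.1 - ω = w.1 - (numFun (ind fun m n => n < m) ω +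
        numFun (ind fun m n => m < n) ω) by
        rw [hsum]]
      abel
    · simp

end HigherSpins

end HigherSpin

theorem mainTheorem9 {R M : Type*} [CommRing R] [Algebra ℂ R] [AddCommGroup M] [Module R M]
    (h : Module.Basis (Fin 2 × Fin 2) R M) (η : ℂ) (hη : η ≠ 0) :
    -- `H^{3-2}` for `s = 0` and `s = 1/2`
    Subsingleton (HigherSpin.Cohomology h η 3 0) ∧
    Subsingleton (HigherSpin.Cohomology h η 3 1) ∧
    -- `H^{3-2}` for `s = 1`
    HigherSpin.RepresentedBy h η 3 2 (HigherSpin.bihom R M 0 0)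
      (fun ψ => (0,
        HigherSpin.cst R η • HigherSpin.HOp h HigherSpin.y HigherSpin.y ψ +
        HigherSpin.cst R (starRingEnd ℂ η) •
          HigherSpin.HbarOp h HigherSpin.ybar HigherSpin.ybar ψ)) ∧
    -- `H^{3-2}` for integer `s = m + 1 ≥ 2`
    (∀ m : ℕ, 1 ≤ m →
      HigherSpin.RepresentedBy h η 3 (2 * m + 2) (HigherSpin.bihom R M m m)
        (fun ψ => (HigherSpin.H3Op h HigherSpin.y HigherSpin.pbar ψ -
          HigherSpin.H3Op h HigherSpin.p HigherSpin.ybar ψ, 0))) ∧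
    -- `H^{3-2}` for half-integer `s = m + 3/2 ≥ 3/2`
    (∀ m : ℕ,
      HigherSpin.RepresentedBy h η 3 (2 * m + 3)
        ((HigherSpin.bihom R M m (m + 1)).prod (HigherSpin.bihom R M (m + 1) m))
        (fun ψ => (HigherSpin.H3Op h HigherSpin.y HigherSpin.pbar ψ.1 +
          HigherSpin.H3Op h HigherSpin.p HigherSpin.ybar ψ.2, 0))) ∧
    -- `H^{4-3}` for all spins
    (∀ t : ℕ, Subsingleton (HigherSpin.Cohomology h η 4 t)) :=
  ⟨HigherSpin.subsingleton_cohomology h (HigherSpin.cocycles_three_le h hη (by norm_num)),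
    HigherSpin.subsingleton_cohomology h (HigherSpin.cocycles_three_le h hη (by norm_num)),
    HigherSpin.representedBy_spin_one h hη,
    fun _ hm => HigherSpin.representedBy_integer_spin h hη hm,
    HigherSpin.representedBy_halfInteger_spin h hη,
    fun t => HigherSpin.subsingleton_cohomology h (HigherSpin.cocycles_four_le h hη t)⟩
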